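/- **Theorem A.** Let $D=(0,\pi)$, $\lambda_k=k^2$ and $\phi_k(x)=\sqrt{2/\pi}\,\sin(kx)$, $k\ge 1$, the eigenvalues and $L^2(D)$-normalized eigenfunctions of $-\Delta$ with zero Dirichlet boundary conditions. For $r\in\mathbb{R}$ let $H_r$ be the Sobolev space of all series $\Phi=\sum_{k\ge1}a_k(\Phi)\phi_k$ with $\|\Phi\|_{H_r}:=\bigl(\sum_{k\ge1}\lambda_k^{r}a_k(\Phi)^2\bigr)^{1/2}<\infty$; for $\Phi\in L^2(D)$ one has $a_k(\Phi)=\int_D\Phi(x)\phi_k(x)\,dx$. Let $\dot W$ be a Gaussian space-time white noise on $[0,\infty)\times D$ and let $u$ be the random field solution of the stochastic heat equation with additive noise $$\frac{\partial u}{\partial t}(t,x)=\frac{\partial^2 u}{\partial x^2}(t,x)+\dot W(t,x),\qquad (t,x)\in[0,\infty)\times(0,\pi),$$ with $u(t,0)=u(t,\pi)=0$ and $u(0,x)=0$; that is, $u$ is a measurable random field such that, for all $t\ge0$ and $x\in D$, almost surely $$u(t,x)=\int_0^t\int_D g(t-s;x,y)\,W(ds,dy),\qquad g(t;x,y)=\sum_{k\ge1}\phi_k(x)\phi_k(y)e^{-\lambda_kt}\mathbf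 1_{t>0}.$$ Let $(\Delta_n)_{n\ge1}$ be a sequence of strictly positive numbers decreasing to $0$, let $r<\frac12$, and define $$\tau_n(r):=\begin{cases}\Delta_n^{1/2}&\text{if } r<-\frac12,\\ (\Delta_n|\log\Delta_n|)^{1/2}&\text{if } r=-\frac12,\\ \Delta_n^{\frac14-\frac r2}&\text{if } -\frac12<r<\frac12,\end{cases}\qquad V^{n,r}_{m}(u,t):=\Delta_n\sum_{i=1}^{[t/\Delta_n]}\Bigl(\frac{\|u(i\Delta_n,\cdot)-u((i-1)\Delta_n,\cdot)\|_{H_r}}{\tau_n(r)}\Bigr)^{m}.$$ Then $u(t,\cdot)\in L^2(D)\cap H_r$ almost surely for every $t\ge0$, and for every integer $p\ge1$ and all $q,T\in(0,\infty)$, $$\lim_{n\to\infty}\mathbb{E}\Bigl[\sup_{t\in[0,T]}\bigl|V^{n,r}_{2p}(u,t)-K(r,p)\,t\bigr|^q\Bigr]=0,$$ where $$K(r,p):=\begin{cases}2^pB_p(x_1,\dots,x_p),\quad x_\ell=\frac{(\ell-1)!}{2}\,\zeta(-2\ell r),&\text{if } r<-\frac12,\\ 2^{-p}&\text{if } r=-\frac12,\\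 \Bigl(\dfrac{\Gamma(r+\frac12)}{2(\frac12-r)}\Bigr)^p&\text{if } -\frac12<r<\frac12.\end{cases}$$ Here $B_p(x_1,\dots,x_p)=\sum\frac{p!}{m_1!\cdots m_p!}\prod_{j=1}^p\bigl(\frac{x_j}{j!}\bigr)^{m_j}$, summed over all integers $m_1,\dots,m_p\ge0$ with $\sum_j j\,m_j=p$, is the complete Bell polynomial, $\zeta$ is the Riemann zeta function and $\Gamma$ is Euler's gamma function. -/

import Mathlib

open MeasureTheory ProbabilityTheory Filter Topology

noncomputable section

namespace HeatPV

/-- Lebesgue measure on the spatial domain `D = (0, π)`. -/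
def spaceMeasure : Measure ℝ := volume.restrict (Set.Ioo 0 Real.pi)

/-- Lebesgue measure on space-time `[0, ∞) × (0, π)`. -/
def spaceTimeMeasure : Measure (ℝ × ℝ) :=
  volume.restrict (Set.Ici (0 : ℝ) ×ˢ Set.Ioo 0 Real.pi)

/-- Eigenvalues `1, 4, 9, …` of minus the Dirichlet Laplacian on `(0, π)`. The index `k : ℕ`
stands for the `(k+1)`-st eigenvalue. -/
def eigenvalue (k : ℕ) : ℝ := ((k : ℝ) + 1) ^ 2

/-- The `L²(0, π)`-normalized eigenfunctions `x ↦ √(2/π) sin((k+1)x)`. -/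
def eigenfunction (k : ℕ) (x : ℝ) : ℝ :=
  Real.sqrt (2 / Real.pi) * Real.sin (((k : ℝ) + 1) * x)

/-- Each `eigenfunction k` solves the Dirichlet eigenvalue problem `-φ'' = λ φ` on `(0, π)`. -/
theorem eigenfunction_dirichlet (k : ℕ) :
    eigenfunction k 0 = 0 ∧ eigenfunction k Real.pi = 0 ∧
      ∀ x, HasDerivAt (deriv (eigenfunction k)) (-(eigenvalue k * eigenfunction k x)) x := by
  have hd : ∀ x, HasDerivAt (eigenfunction k)
      (Real.sqrt (2 / Real.pi) * (Real.cos (((k : ℝ) + 1) * x) * ((k : ℝ) + 1))) x := by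
    intro x
    have h1 : HasDerivAt (fun y : ℝ => ((k : ℝ) + 1) * y) ((k : ℝ) + 1) x := by
      simpa using (hasDerivAt_id x).const_mul ((k : ℝ) + 1)
    exact (h1.sin).const_mul _
  refine ⟨by simp [eigenfunction], ?_, fun x => ?_⟩
  · have h := Real.sin_nat_mul_pi (k + 1)
    push_cast at h
    simp [eigenfunction, h]
  · have hderiv : deriv (eigenfunction k) = fun x =>
        Real.sqrt (2 / Real.pi) * (Real.cos (((k : ℝ) + 1) * x) * ((k : ℝ) + 1)) :=
      funext fun x => (hd x).deriv
    rw [hderiv]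
    have h1 : HasDerivAt (fun y : ℝ => ((k : ℝ) + 1) * y) ((k : ℝ) + 1) x := by
      simpa using (hasDerivAt_id x).const_mul ((k : ℝ) + 1)
    refine (((h1.cos).mul_const ((k : ℝ) + 1)).const_mul (Real.sqrt (2 / Real.pi))).congr_deriv ?_
    simp only [eigenvalue, eigenfunction]
    ring

/-- The Dirichlet heat kernel
`g(t; x, y) = ∑ₖ φₖ(x) φₖ(y) exp(-λₖ t) 1_{t > 0}` on `(0, π)`. -/
def heatKernel (t x y : ℝ) : ℝ :=
  if 0 < t then
    ∑' k : ℕ, eigenfunction k x * eigenfunction k y * Real.exp (-(eigenvalue k * t))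
  else 0

/-- Space-time white noise on `[0, ∞) × (0, π)` as an isonormal Gaussian process: a centred
Gaussian family indexed by `L²([0, ∞) × (0, π))` whose covariance is the `L²` inner product. -/
structure IsWhiteNoise {Ω : Type*} [MeasurableSpace Ω]
    (W : Lp ℝ 2 spaceTimeMeasure → Ω → ℝ) (P : Measure Ω) : Prop where
  gaussian : IsGaussianProcess W P
  mean_zero : ∀ h, ∫ ω, W h ω ∂P = 0
  covariance : ∀ h₁ h₂, ∫ ω, W h₁ ω * W h₂ ω ∂P = inner ℝ h₁ h₂

open Classical in
/-- The Wiener integral `∫∫ f(s, y) W(ds, dy)` over `[0, ∞) × (0, π)` of a deterministic square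
integrable `f` (and `0` by convention if `f` is not square integrable). -/
def wienerIntegral {Ω : Type*} (W : Lp ℝ 2 spaceTimeMeasure → Ω → ℝ) (f : ℝ × ℝ → ℝ) : Ω → ℝ :=
  if hf : MemLp f 2 spaceTimeMeasure then W (hf.toLp f) else 0

/-- `u` is a random field solution of the stochastic heat equation `∂ₜ u = ∂ₓₓ u + Ẇ` on `(0, π)`
with zero Dirichlet boundary conditions and zero initial condition: for all `t ≥ 0`, `x ∈ (0, π)`,
`u(t, x) = ∫₀ᵗ ∫_D g(t - s; x, y) W(ds, dy)` almost surely. (The kernel vanishes for `s ≥ t`.)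
The measurability in `(x, ω)` at fixed times holds for every jointly measurable field, and so for
every predictable one. -/
structure IsRandomFieldSolution {Ω : Type*} [MeasurableSpace Ω]
    (W : Lp ℝ 2 spaceTimeMeasure → Ω → ℝ) (P : Measure Ω) (u : ℝ → ℝ → Ω → ℝ) : Prop where
  measurable : ∀ t, 0 ≤ t →
    AEMeasurable (fun z : ℝ × Ω => u t z.1 z.2) (spaceMeasure.prod P)
  mild : ∀ t, 0 ≤ t → ∀ x ∈ Set.Ioo 0 Real.pi,
    u t x =ᵐ[P] wienerIntegral W (fun z => heatKernel (t - z.1) x z.2)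

/-- The coefficients `aₖ(f) = ∫_D f φₖ dx` of a function `f` on `(0, π)` in the eigenbasis. -/
def coeffs (f : ℝ → ℝ) (k : ℕ) : ℝ := ∫ x, f x * eigenfunction k x ∂spaceMeasure

/-- An element of the Sobolev space `H_r` is a series `∑ₖ aₖ φₖ`, identified with its coefficient
sequence, such that `∑ₖ λₖ ^ r aₖ² < ∞`. -/
def MemH (r : ℝ) (a : ℕ → ℝ) : Prop := Summable fun k => eigenvalue k ^ r * a k ^ 2

/-- The norm of `H_r`. -/
def normH (r : ℝ) (a : ℕ → ℝ) : ℝ := Real.sqrt (∑' k, eigenvalue k ^ r * a k ^ 2)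

/-- The normalization `τ(r)` at mesh size `δ`. -/
def tau (r δ : ℝ) : ℝ :=
  if r < -1 / 2 then δ ^ (1 / 2 : ℝ)
  else if r = -1 / 2 then (δ * |Real.log δ|) ^ (1 / 2 : ℝ)
  else δ ^ (1 / 4 - r / 2)

/-- The normalized power variation of order `m` in `H_r`, at mesh size `δ` and time `t`, of a path
`v : time → space → ℝ`. -/
def powerVariation (r m δ : ℝ) (v : ℝ → ℝ → ℝ) (t : ℝ) : ℝ :=
  δ * ∑ i ∈ Finset.Icc 1 ⌊t / δ⌋₊,
    (normH r (coeffs fun x => v ((i : ℝ) * δ) x - v (((i : ℝ) - 1) * δ) x) / tau r δ) ^ m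

/-- The complete Bell polynomial `B_p(x₁, …, x_p)`: the sum over all `(m₁, …, m_p)` with
`∑ j mⱼ = p`, that is over the partitions of `p` with multiplicities `mⱼ`, of
`p! ∏ⱼ (xⱼ / j!)^{mⱼ} / mⱼ!`. -/
def completeBell (p : ℕ) (x : ℕ → ℝ) : ℝ :=
  ∑ π : Nat.Partition p, (p.factorial : ℝ) *
    ∏ j ∈ Finset.Icc 1 p,
      (x j / (j.factorial : ℝ)) ^ (π.parts.count j) / ((π.parts.count j).factorial : ℝ)

/-- The limiting constant `K(r, p)`. -/
def limitConst (r : ℝ) (p : ℕ) : ℝ :=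
  if r < -1 / 2 then
    2 ^ p * completeBell p fun l =>
      ((l - 1).factorial : ℝ) / 2 * (riemannZeta ((-2 * (l : ℝ) * r : ℝ) : ℂ)).re
  else if r = -1 / 2 then (2 ^ p)⁻¹
  else (Real.Gamma (r + 1 / 2) / (2 * (1 / 2 - r))) ^ p

end HeatPV

end

/-! The k-th coefficient of the solution is the Wiener integral of `heatMode k t`, an
Ornstein–Uhlenbeck process started at 0, and different k give orthogonal elements of L², hence
independent Gaussian variables (`ae_coeffs_solution_eq`). The squared, normalized H_r-norm of the
i-th increment is therefore a weighted sum of independent squared Gaussians, `stepEnergy`, and the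
power variation of order 2p is the Riemann average of its p-th powers (`ae_powerVariation_eq`). Up
to an exponentially decaying defect from stationarity, the mean of this sum is `energy r δ / tau r δ
^ 2`, which converges: by dominated convergence for r < -1/2, by comparison with the harmonic series
at r = -1/2, and as a Riemann sum for a Gamma integral when r > -1/2.

What remains random in the limit separates two cases. If r ≥ -1/2, no single mode carries a positive
share of the energy, so the variance of the energy of one step vanishes and each energy concentrates
at the limit c of the means; the constant is c^p, and no decorrelation in time is needed
(`tendsto_riemannAvg_stepEnergy_of_ge`). If r < -1/2, finitely many modes keep a positive share and
the energies stay random. The increments of the solution are then close in L² to those of the noise,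
whose energies are identically distributed and pairwise independent over time steps, so a variance
bound gives a law of large numbers (`tendsto_riemannAvg_stepEnergy_of_lt`). The constant is the p-th
moment of ∑ λ_k^r ξ_k² with independent standard Gaussians ξ_k; its cumulants are 2^{l-1}(l-1)!
ζ(-2lr), and complete Bell polynomials turn cumulants into moments.

Both cases yield L¹ convergence at each fixed t. Uniform moment bounds raise this to L^q, and
monotonicity of the average in t reduces the supremum over t to a finite grid
(`tendsto_lintegral_iSup_riemannAvg`). -/

namespace HeatPV

/-! ### Moments of the standard Gaussian -/

/-- The even moments of the standard Gaussian law. -/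
noncomputable def gaussianMoment (a : ℕ) : ℝ := ∫ x, x ^ (2 * a) ∂gaussianReal 0 1

theorem gaussianMoment_zero : gaussianMoment 0 = 1 := by
  simp [gaussianMoment]

theorem gaussianMoment_nonneg (a : ℕ) : 0 ≤ gaussianMoment a :=
  integral_nonneg fun x => by rw [pow_mul]; positivity

/-- Symmetry reduces the moment to a Gamma integral on the half-line. The closed form serves only to
derive the recursion `gaussianMoment_succ` from Γ(s+1) = sΓ(s). -/
theorem gaussianMoment_eq_Gamma (a : ℕ) :
    gaussianMoment a = (Real.sqrt (2 * Real.pi))⁻¹ *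
      (2 * ((1 / 2 : ℝ) ^ (-(2 * (a : ℝ) + 1) / 2) * (1 / 2) *
        Real.Gamma ((2 * (a : ℝ) + 1) / 2))) := by
  have h := integral_rpow_mul_exp_neg_mul_rpow (p := 2) (q := 2 * (a : ℝ)) (b := 1 / 2)
    (by norm_num) (by have : (0 : ℝ) ≤ a := by positivity
                      linarith) (by norm_num)
  rw [← h, gaussianMoment, integral_gaussianReal_eq_integral_smul (by norm_num),
    ← integral_comp_abs (f := fun x => x ^ (2 * (a : ℝ)) * Real.exp (-(1 / 2) * x ^ (2 : ℝ))),
    ← integral_const_mul]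
  refine integral_congr_ae (Eventually.of_forall fun x => ?_)
  have h1 : |x| ^ (2 * (a : ℝ)) = x ^ (2 * a) := by
    rw [show (2 * (a : ℝ)) = ((2 * a : ℕ) : ℝ) by push_cast; ring, Real.rpow_natCast, pow_mul,
      sq_abs, ← pow_mul]
  have h2 : |x| ^ (2 : ℝ) = x ^ 2 := by
    rw [show (2 : ℝ) = ((2 : ℕ) : ℝ) by norm_num, Real.rpow_natCast, sq_abs]
  simp only [h1, h2, gaussianPDFReal, smul_eq_mul, NNReal.coe_one, sub_zero, mul_one]
  rw [show -x ^ 2 / 2 = -(1 / 2) * x ^ 2 by ring]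
  ring

theorem gaussianMoment_succ (a : ℕ) :
    gaussianMoment (a + 1) = (2 * (a : ℝ) + 1) * gaussianMoment a := by
  rw [gaussianMoment_eq_Gamma, gaussianMoment_eq_Gamma]
  have e1 : (2 * ((a + 1 : ℕ) : ℝ) + 1) / 2 = (2 * (a : ℝ) + 1) / 2 + 1 := by push_cast; ring
  have e2 : -(2 * ((a + 1 : ℕ) : ℝ) + 1) / 2 = -(2 * (a : ℝ) + 1) / 2 + (-1) := by push_cast; ring
  rw [e1, e2, Real.Gamma_add_one (by positivity), Real.rpow_add (by norm_num), Real.rpow_neg_one]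
  ring

/-! ### Isonormal processes -/

section Noise

variable {Ω : Type*} [MeasurableSpace Ω] {P : Measure Ω}
  {W : Lp ℝ 2 spaceTimeMeasure → Ω → ℝ}

theorem IsWhiteNoise.aemeasurable (hW : IsWhiteNoise W P) (h : Lp ℝ 2 spaceTimeMeasure) :
    AEMeasurable (W h) P := hW.gaussian.aemeasurable h

theorem IsWhiteNoise.memLp (hW : IsWhiteNoise W P) (h : Lp ℝ 2 spaceTimeMeasure)
    {p : ENNReal} (hp : p ≠ ⊤) : MemLp (W h) p P :=
  (hW.gaussian.hasGaussianLaw_eval h).memLp hp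

theorem IsWhiteNoise.integrable_mul (hW : IsWhiteNoise W P) (g h : Lp ℝ 2 spaceTimeMeasure) :
    Integrable (fun ω => W g ω * W h ω) P :=
  (hW.memLp g (p := 2) (by simp)).integrable_mul (hW.memLp h (p := 2) (by simp))

theorem IsWhiteNoise.covariance_eq (hW : IsWhiteNoise W P) (g h : Lp ℝ 2 spaceTimeMeasure) :
    cov[W g, W h; P] = inner ℝ g h := by
  have := hW.gaussian.isProbabilityMeasure
  rw [covariance_eq_sub (hW.memLp g (by simp)) (hW.memLp h (by simp)), hW.mean_zero, hW.mean_zero]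
  simpa using hW.covariance g h

theorem IsWhiteNoise.integral_sq (hW : IsWhiteNoise W P) (h : Lp ℝ 2 spaceTimeMeasure) :
    ∫ ω, W h ω ^ 2 ∂P = ‖h‖ ^ 2 := by
  rw [← real_inner_self_eq_norm_sq, ← hW.covariance]
  simp [sq]

theorem IsWhiteNoise.integrable_sq (hW : IsWhiteNoise W P) (h : Lp ℝ 2 spaceTimeMeasure) :
    Integrable (fun ω => W h ω ^ 2) P := (hW.memLp h (p := 2) (by simp)).integrable_sq

theorem ae_eq_zero_of_integral_sq_eq_zero {f : Ω → ℝ} (hf : Integrable (fun ω => f ω ^ 2) P)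
    (h : ∫ ω, f ω ^ 2 ∂P = 0) : f =ᵐ[P] 0 := by
  have h2 := (integral_eq_zero_iff_of_nonneg (fun ω => by positivity) hf).1 h
  filter_upwards [h2] with ω hω
  simpa using hω

/-- Linearity is not part of `IsWhiteNoise`; the covariance forces it, because the second moment of
the defect expands into inner products that cancel. -/
theorem IsWhiteNoise.map_add (hW : IsWhiteNoise W P) (g h : Lp ℝ 2 spaceTimeMeasure) :
    W (g + h) =ᵐ[P] W g + W h := by
  have e : ∀ ω, (W (g + h) ω - (W g ω + W h ω)) ^ 2 =
      W (g + h) ω * W (g + h) ω + W g ω * W g ω + W h ω * W h ω + 2 * (W g ω * W h ω)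
        - 2 * (W (g + h) ω * W g ω) - 2 * (W (g + h) ω * W h ω) := fun ω => by ring
  have i := hW.integrable_mul
  have hint : Integrable (fun ω => (W (g + h) ω - (W g ω + W h ω)) ^ 2) P := by
    simp_rw [e]
    exact (((((i _ _).add (i _ _)).add (i _ _)).add ((i _ _).const_mul 2)).sub
      ((i _ _).const_mul 2)).sub ((i _ _).const_mul 2)
  have h0 : ∫ ω, (W (g + h) ω - (W g ω + W h ω)) ^ 2 ∂P = 0 := by
    simp_rw [e]
    rw [integral_sub, integral_sub, integral_add, integral_add, integral_add, integral_const_mul,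
      integral_const_mul, integral_const_mul]
    · simp only [hW.covariance, inner_add_left, inner_add_right, real_inner_comm g h]
      ring
    all_goals
      have a1 := i (g + h) (g + h)
      have a2 := i g g
      have a3 := i h h
      have a4 := i g h
      have a5 := i (g + h) g
      have a6 := i (g + h) h
      fun_prop
  have := ae_eq_zero_of_integral_sq_eq_zero hint h0
  filter_upwards [this] with ω hω
  simpa [sub_eq_zero] using hω

theorem IsWhiteNoise.map_smul (hW : IsWhiteNoise W P) (c : ℝ) (h : Lp ℝ 2 spaceTimeMeasure) :
    W (c • h) =ᵐ[P] fun ω => c * W h ω := by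
  have e : ∀ ω, (W (c • h) ω - c * W h ω) ^ 2 =
      W (c • h) ω * W (c • h) ω + c ^ 2 * (W h ω * W h ω)
        - 2 * c * (W (c • h) ω * W h ω) := fun ω => by ring
  have a1 := hW.integrable_mul (c • h) (c • h)
  have a2 := hW.integrable_mul h h
  have a3 := hW.integrable_mul (c • h) h
  have hint : Integrable (fun ω => (W (c • h) ω - c * W h ω) ^ 2) P := by
    simp_rw [e]
    fun_prop
  have h0 : ∫ ω, (W (c • h) ω - c * W h ω) ^ 2 ∂P = 0 := by
    simp_rw [e]
    rw [integral_sub (by fun_prop) (by fun_prop), integral_add a1 (by fun_prop),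
      integral_const_mul, integral_const_mul]
    simp only [hW.covariance, real_inner_smul_left, real_inner_smul_right]
    ring
  have := ae_eq_zero_of_integral_sq_eq_zero hint h0
  filter_upwards [this] with ω hω
  simpa [sub_eq_zero] using hω

theorem IsWhiteNoise.map_sub (hW : IsWhiteNoise W P) (g h : Lp ℝ 2 spaceTimeMeasure) :
    W (g - h) =ᵐ[P] W g - W h := by
  have h1 := hW.map_add g ((-1 : ℝ) • h)
  have h2 := hW.map_smul (-1) h
  rw [neg_one_smul, ← sub_eq_add_neg] at h1
  rw [neg_one_smul] at h2
  filter_upwards [h1, h2] with ω h1 h2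
  rw [h1, Pi.add_apply, h2, Pi.sub_apply]
  ring

theorem IsWhiteNoise.map_sum (hW : IsWhiteNoise W P) {ι : Type*} (s : Finset ι) (c : ι → ℝ)
    (h : ι → Lp ℝ 2 spaceTimeMeasure) :
    W (∑ i ∈ s, c i • h i) =ᵐ[P] fun ω => ∑ i ∈ s, c i * W (h i) ω := by
  classical
  induction s using Finset.induction_on with
  | empty =>
    have := hW.map_smul 0 0
    filter_upwards [this] with ω hω
    simpa using hω
  | insert a s ha ih =>
    rw [Finset.sum_insert ha]
    filter_upwards [hW.map_add (c a • h a) (∑ i ∈ s, c i • h i), hW.map_smul (c a) (h a), ih]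
      with ω h1 h2 h3
    simp [h1, h2, h3, Finset.sum_insert ha]

theorem IsWhiteNoise.map_eq_gaussianReal (hW : IsWhiteNoise W P)
    (h : Lp ℝ 2 spaceTimeMeasure) :
    P.map (W h) = gaussianReal 0 (‖h‖ ^ 2).toNNReal := by
  rw [(hW.gaussian.hasGaussianLaw_eval h).map_eq_gaussianReal, hW.mean_zero,
    ← covariance_self (hW.aemeasurable h), hW.covariance_eq, real_inner_self_eq_norm_sq]

theorem IsWhiteNoise.integral_pow (hW : IsWhiteNoise W P) (h : Lp ℝ 2 spaceTimeMeasure) (m : ℕ) :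
    ∫ ω, W h ω ^ (2 * m) ∂P = (‖h‖ ^ 2) ^ m * gaussianMoment m := by
  have h1 : P.map (W h) = (gaussianReal 0 1).map (‖h‖ * ·) := by
    rw [hW.map_eq_gaussianReal, gaussianReal_map_const_mul]
    congr 1
    · simp
    · ext
      simp
  have h2 : ∫ ω, W h ω ^ (2 * m) ∂P = ∫ x, x ^ (2 * m) ∂(P.map (W h)) :=
    (integral_map (f := fun x => x ^ (2 * m)) (hW.aemeasurable h) (by fun_prop)).symm
  rw [h2, h1, integral_map (f := fun x => x ^ (2 * m)) (by fun_prop) (by fun_prop), gaussianMoment,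
    ← integral_const_mul]
  simp_rw [mul_pow, pow_mul]

theorem IsWhiteNoise.integrable_pow (hW : IsWhiteNoise W P) (h : Lp ℝ 2 spaceTimeMeasure)
    (m : ℕ) : Integrable (fun ω => W h ω ^ m) P := by
  have := hW.gaussian.isProbabilityMeasure
  rcases eq_or_ne m 0 with rfl | hm
  · simp
  · have := (hW.memLp h (p := m) (by simp)).integrable_norm_pow hm
    refine (integrable_norm_iff (((hW.aemeasurable h).pow_const m).aestronglyMeasurable)).1 ?_
    simpa using this

theorem IsWhiteNoise.lintegral_pow (hW : IsWhiteNoise W P) (h : Lp ℝ 2 spaceTimeMeasure)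
    (m : ℕ) : ∫⁻ ω, ENNReal.ofReal (W h ω ^ 2) ^ m ∂P =
      ENNReal.ofReal ((‖h‖ ^ 2) ^ m * gaussianMoment m) := by
  rw [← hW.integral_pow, ofReal_integral_eq_lintegral_ofReal (hW.integrable_pow h _)
    (Eventually.of_forall fun ω => by simp only [pow_mul]; positivity)]
  simp_rw [pow_mul, ENNReal.ofReal_pow (sq_nonneg _)]

theorem IsWhiteNoise.lintegral_sq (hW : IsWhiteNoise W P) (h : Lp ℝ 2 spaceTimeMeasure) :
    ∫⁻ ω, ENNReal.ofReal (W h ω ^ 2) ∂P = ENNReal.ofReal (‖h‖ ^ 2) := by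
  rw [← hW.integral_sq, ofReal_integral_eq_lintegral_ofReal (hW.integrable_sq h)
    (Eventually.of_forall fun ω => sq_nonneg _)]

/-- Uncorrelated blocks of a Gaussian process are independent. Blocks are needed, and not only
single variables, because the noise energy of a time step involves a whole sequence of modes. -/
theorem IsWhiteNoise.iIndepFun (hW : IsWhiteNoise W P) {T S : Type*}
    (h : T → S → Lp ℝ 2 spaceTimeMeasure)
    (horth : ∀ i j, i ≠ j → ∀ k l, inner ℝ (h i k) (h j l) = (0 : ℝ)) :
    iIndepFun (fun t ω s => W (h t s) ω) P :=
  IsGaussianProcess.iIndepFun_of_covariance_eq_zero (S := fun _ => S)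
    (X := fun t s => W (h t s))
    (hW.gaussian.comp_right fun p : (_ : T) × S => h p.1 p.2)
    (fun t s => hW.aemeasurable _) fun i j hij k l => by
      rw [hW.covariance_eq, horth i j hij]

theorem IsWhiteNoise.iIndepFun_of_orthogonal (hW : IsWhiteNoise W P) {T : Type*}
    (h : T → Lp ℝ 2 spaceTimeMeasure) (horth : ∀ i j, i ≠ j → inner ℝ (h i) (h j) = (0 : ℝ)) :
    ProbabilityTheory.iIndepFun (fun t => W (h t)) P :=
  (hW.iIndepFun (fun t (_ : Unit) => h t) fun i j hij _ _ => horth i j hij).comp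
    (fun _ f => f ()) fun _ => measurable_pi_apply _

end Noise

end HeatPV

namespace HeatPV

/-! ### The eigenbasis -/

theorem eigenvalue_pos (k : ℕ) : 0 < eigenvalue k := by
  unfold eigenvalue; positivity

theorem one_le_eigenvalue (k : ℕ) : 1 ≤ eigenvalue k := by
  unfold eigenvalue
  have : (0 : ℝ) ≤ k := by positivity
  nlinarith

theorem eigenvalue_rpow (k : ℕ) (s : ℝ) : eigenvalue k ^ s = ((k : ℝ) + 1) ^ (2 * s) := by
  unfold eigenvalue
  rw [Real.rpow_mul (by positivity), ← Real.rpow_natCast ((k : ℝ) + 1) 2]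
  norm_num

theorem summable_eigenvalue_rpow {s : ℝ} (hs : s < -1 / 2) :
    Summable fun k => eigenvalue k ^ s := by
  simp_rw [eigenvalue_rpow]
  have h := (summable_nat_add_iff 1).2 (Real.summable_nat_rpow.2 (show 2 * s < -1 by linarith))
  simpa using h

theorem continuous_eigenfunction (k : ℕ) : Continuous (eigenfunction k) := by
  unfold eigenfunction; fun_prop

theorem abs_eigenfunction_le (k : ℕ) (x : ℝ) : |eigenfunction k x| ≤ 1 := by
  unfold eigenfunction
  rw [abs_mul, abs_of_nonneg (Real.sqrt_nonneg _)]
  have h1 : Real.sqrt (2 / Real.pi) ≤ 1 := by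
    rw [Real.sqrt_le_iff, one_pow, div_le_one Real.pi_pos]
    exact ⟨zero_le_one, Real.two_le_pi⟩
  exact mul_le_one₀ h1 (abs_nonneg _) (Real.abs_sin_le_one _)

instance : IsFiniteMeasure spaceMeasure := by
  unfold spaceMeasure
  infer_instance

theorem integral_cos_int_mul (c : ℤ) :
    ∫ x in (0 : ℝ)..Real.pi, Real.cos (c * x) = if c = 0 then Real.pi else 0 := by
  split_ifs with hc
  · simp [hc]
  · rw [intervalIntegral.integral_comp_mul_left _ (by exact_mod_cast hc), integral_cos]
    simp [Real.sin_int_mul_pi]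

theorem integral_eigenfunction_mul (k l : ℕ) :
    ∫ x, eigenfunction k x * eigenfunction l x ∂spaceMeasure = if k = l then 1 else 0 := by
  have hpt : ∀ x, eigenfunction k x * eigenfunction l x = Real.pi⁻¹ *
      (Real.cos (((k - l : ℤ) : ℝ) * x) - Real.cos (((k + l + 2 : ℤ) : ℝ) * x)) := by
    intro x
    have h := Real.two_mul_sin_mul_sin (((k : ℝ) + 1) * x) (((l : ℝ) + 1) * x)
    have hs : Real.sqrt (2 / Real.pi) * Real.sqrt (2 / Real.pi) = 2 / Real.pi :=
      Real.mul_self_sqrt (by positivity)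
    rw [show ((k : ℝ) + 1) * x - ((l : ℝ) + 1) * x = ((k - l : ℤ) : ℝ) * x by push_cast; ring,
      show ((k : ℝ) + 1) * x + ((l : ℝ) + 1) * x = ((k + l + 2 : ℤ) : ℝ) * x by
        push_cast; ring] at h
    rw [← h]
    unfold eigenfunction
    calc _ = (Real.sqrt (2 / Real.pi) * Real.sqrt (2 / Real.pi)) *
          (Real.sin (((k : ℝ) + 1) * x) * Real.sin (((l : ℝ) + 1) * x)) := by ring
      _ = _ := by rw [hs]; ring
  simp_rw [hpt]
  rw [integral_const_mul, spaceMeasure, ← integral_Ioc_eq_integral_Ioo,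
    ← intervalIntegral.integral_of_le Real.pi_pos.le,
    intervalIntegral.integral_sub (by apply Continuous.intervalIntegrable; fun_prop)
      (by apply Continuous.intervalIntegrable; fun_prop),
    integral_cos_int_mul, integral_cos_int_mul, if_neg (show ¬ ((k : ℤ) + l + 2 = 0) by omega)]
  by_cases h : k = l
  · simp [h, Real.pi_ne_zero]
  · rw [if_neg (by omega), if_neg h]
    simp

theorem memLp_eigenfunction (k : ℕ) (p : ENNReal) : MemLp (eigenfunction k) p spaceMeasure :=
  MemLp.of_bound (continuous_eigenfunction k).aestronglyMeasurable 1
    (Eventually.of_forall fun x => abs_eigenfunction_le k x)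

/-! ### Product elements of `L²([0, ∞) × (0, π))` -/

/-- Lebesgue measure on the time axis `[0, ∞)`. -/
noncomputable def timeMeasure : Measure ℝ := volume.restrict (Set.Ici 0)

instance : SFinite timeMeasure := by
  unfold timeMeasure
  infer_instance

theorem spaceTimeMeasure_eq_prod : spaceTimeMeasure = timeMeasure.prod spaceMeasure := by
  rw [timeMeasure, spaceMeasure, Measure.prod_restrict]
  rfl

theorem memLp_mul_eigenfunction (k : ℕ) {f : ℝ → ℝ} (hf : MemLp f 2 timeMeasure) :
    MemLp (fun z : ℝ × ℝ => f z.1 * eigenfunction k z.2) 2 spaceTimeMeasure := by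
  rw [spaceTimeMeasure_eq_prod]
  have hm : AEStronglyMeasurable (fun z : ℝ × ℝ => f z.1 * eigenfunction k z.2)
      (timeMeasure.prod spaceMeasure) :=
    hf.1.comp_fst.mul (continuous_eigenfunction k).aestronglyMeasurable.comp_snd
  rw [memLp_two_iff_integrable_sq hm]
  simp_rw [mul_pow]
  exact hf.integrable_sq.mul_prod (memLp_eigenfunction k 2).integrable_sq

/-- The element `(s, y) ↦ f(s) φₖ(y)` of `L²([0, ∞) × (0, π))`. -/
noncomputable def mode (k : ℕ) (f : ℝ → ℝ) (hf : MemLp f 2 timeMeasure) :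
    Lp ℝ 2 spaceTimeMeasure := (memLp_mul_eigenfunction k hf).toLp

theorem coeFn_mode (k : ℕ) {f : ℝ → ℝ} (hf : MemLp f 2 timeMeasure) :
    mode k f hf =ᵐ[spaceTimeMeasure] fun z => f z.1 * eigenfunction k z.2 :=
  MemLp.coeFn_toLp _

theorem inner_mode (k l : ℕ) {f g : ℝ → ℝ} (hf : MemLp f 2 timeMeasure)
    (hg : MemLp g 2 timeMeasure) :
    inner ℝ (mode k f hf) (mode l g hg) = if k = l then ∫ s, f s * g s ∂timeMeasure else 0 := by
  rw [L2.inner_def]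
  have h : ∀ᵐ z ∂spaceTimeMeasure, inner ℝ (mode k f hf z) (mode l g hg z) =
      (f z.1 * g z.1) * (eigenfunction k z.2 * eigenfunction l z.2) := by
    filter_upwards [coeFn_mode k hf, coeFn_mode l hg] with z h1 h2
    rw [h1, h2, RCLike.inner_apply, conj_trivial]
    ring
  rw [integral_congr_ae h, spaceTimeMeasure_eq_prod,
    integral_prod_mul (fun s => f s * g s) (fun y => eigenfunction k y * eigenfunction l y),
    integral_eigenfunction_mul]
  split_ifs <;> simp

/-! ### Time kernels -/

/-- The kernel `s ↦ exp(-λ(t - s)) 1_{s < t}`. -/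
noncomputable def expKernel (lam t : ℝ) : ℝ → ℝ :=
  (Set.Iio t).indicator fun s => Real.exp (-(lam * (t - s)))

theorem memLp_expKernel {lam : ℝ} (hl : 0 < lam) (t : ℝ) :
    MemLp (expKernel lam t) 2 timeMeasure := by
  unfold expKernel
  rw [memLp_indicator_iff_restrict measurableSet_Iio, timeMeasure,
    Measure.restrict_restrict measurableSet_Iio]
  have : IsFiniteMeasure (volume.restrict (Set.Iio t ∩ Set.Ici 0)) := by
    refine ⟨?_⟩
    rw [Measure.restrict_apply_univ, Set.inter_comm, Set.Ici_inter_Iio]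
    exact measure_Ico_lt_top
  refine MemLp.of_bound (by fun_prop) 1 ?_
  refine (ae_restrict_mem (measurableSet_Iio.inter measurableSet_Ici)).mono fun s hs => ?_
  rw [Real.norm_of_nonneg (Real.exp_pos _).le, Real.exp_le_one_iff]
  have := hs.1
  simp only [Set.mem_Iio] at this
  nlinarith

theorem memLp_indicator_Ioc (a b : ℝ) :
    MemLp ((Set.Ioc a b).indicator fun _ => (1 : ℝ)) 2 timeMeasure := by
  refine memLp_indicator_const 2 measurableSet_Ioc 1 (Or.inr ?_)
  rw [timeMeasure]
  exact ((Measure.restrict_apply_le _ _).trans_lt measure_Ioc_lt_top).ne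

theorem integral_exp_affine {c : ℝ} (hc : c ≠ 0) (d a b : ℝ) :
    ∫ s in a..b, Real.exp (c * s + d) = (Real.exp (c * b + d) - Real.exp (c * a + d)) / c := by
  have h : ∀ s ∈ Set.uIcc a b, HasDerivAt (fun s => Real.exp (c * s + d) / c)
      (Real.exp (c * s + d)) s := by
    intro s _
    have h1 : HasDerivAt (fun s : ℝ => c * s + d) c s := by
      simpa using ((hasDerivAt_id s).const_mul c).add_const d
    convert! h1.exp.div_const c using 1
    field_simp
  rw [intervalIntegral.integral_eq_sub_of_hasDerivAt h
    (by apply Continuous.intervalIntegrable; fun_prop)]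
  ring

/-- The endpoints are null, so it does not matter that `expKernel` lives on an open half-line and
the other indicators on half-open intervals. -/
theorem integral_timeMeasure_eq {f : ℝ → ℝ} {g : ℝ → ℝ} {a b : ℝ} (ha : 0 ≤ a) (hab : a ≤ b)
    (h : ∀ s, 0 ≤ s → s ≠ a → s ≠ b → f s = (Set.Ioc a b).indicator g s) :
    ∫ s, f s ∂timeMeasure = ∫ s in a..b, g s := by
  have hae : f =ᵐ[timeMeasure] (Set.Ioc a b).indicator g := by
    have h1 : ∀ᵐ s ∂timeMeasure, s ≠ a := by
      rw [timeMeasure]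
      exact Measure.ae_ne _ a
    have h2 : ∀ᵐ s ∂timeMeasure, s ≠ b := by
      rw [timeMeasure]
      exact Measure.ae_ne _ b
    have h3 : ∀ᵐ s ∂timeMeasure, (0 : ℝ) ≤ s := ae_restrict_mem measurableSet_Ici
    filter_upwards [h1, h2, h3] with s h1 h2 h3
    exact h s h3 h1 h2
  rw [integral_congr_ae hae, integral_indicator measurableSet_Ioc, timeMeasure,
    Measure.restrict_restrict measurableSet_Ioc, Set.inter_eq_left.2, 
    intervalIntegral.integral_of_le hab]
  exact fun s hs => ha.trans hs.1.le

theorem integral_expKernel_mul {lam : ℝ} (hl : 0 < lam) {a b : ℝ} (ha : 0 ≤ a) (hab : a ≤ b) :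
    ∫ s, expKernel lam a s * expKernel lam b s ∂timeMeasure =
      Real.exp (-(lam * (b - a))) * (1 - Real.exp (-(2 * lam * a))) / (2 * lam) := by
  rw [integral_timeMeasure_eq (g := fun s => Real.exp (2 * lam * s + -(lam * (a + b)))) le_rfl ha,
    integral_exp_affine (by positivity)]
  · rw [show 2 * lam * a + -(lam * (a + b)) = -(lam * (b - a)) by ring,
      show 2 * lam * 0 + -(lam * (a + b)) = -(lam * (b - a)) + -(2 * lam * a) by ring, Real.exp_add]
    ring
  · intro s hs h0 h1
    rcases lt_or_gt_of_ne h1 with h | h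
    · have hs0 : 0 < s := lt_of_le_of_ne hs (Ne.symm h0)
      simp only [expKernel, Set.indicator, Set.mem_Iio, h, h.trans_le hab, Set.mem_Ioc, hs0, h.le,
        if_true, and_self]
      rw [← Real.exp_add]
      congr 1
      ring
    · simp [expKernel, Set.indicator, not_lt.2 h.le, not_le.2 h]

theorem integral_expKernel_mul_indicator {lam : ℝ} (hl : 0 < lam) {a b : ℝ} (ha : 0 ≤ a)
    (hab : a ≤ b) :
    ∫ s, expKernel lam b s * (Set.Ioc a b).indicator (fun _ => (1 : ℝ)) s ∂timeMeasure =
      (1 - Real.exp (-(lam * (b - a)))) / lam := by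
  rw [integral_timeMeasure_eq (g := fun s => Real.exp (lam * s + -(lam * b))) ha hab,
    integral_exp_affine (by positivity)]
  · rw [show lam * b + -(lam * b) = 0 by ring, Real.exp_zero,
      show lam * a + -(lam * b) = -(lam * (b - a)) by ring]
  · intro s hs h0 h1
    by_cases h : s ∈ Set.Ioc a b
    · have hb : s < b := lt_of_le_of_ne h.2 h1
      simp only [expKernel, Set.indicator, Set.mem_Iio, hb, if_true, h, mul_one]
      congr 1
      ring
    · simp [Set.indicator_of_notMem h]

theorem integral_expKernel_mul_indicator_of_le {lam : ℝ} {a b : ℝ} :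
    ∫ s, expKernel lam a s * (Set.Ioc a b).indicator (fun _ => (1 : ℝ)) s ∂timeMeasure = 0 := by
  rw [integral_eq_zero_of_ae (Eventually.of_forall fun s => ?_)]
  by_cases h : s ∈ Set.Ioc a b
  · simp [expKernel, Set.indicator, not_lt.2 h.1.le]
  · simp [Set.indicator_of_notMem h]

theorem integral_indicator_mul_indicator {a b : ℝ} (ha : 0 ≤ a) (hab : a ≤ b) :
    ∫ s, (Set.Ioc a b).indicator (fun _ => (1 : ℝ)) s *
      (Set.Ioc a b).indicator (fun _ => (1 : ℝ)) s ∂timeMeasure = b - a := by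
  rw [integral_timeMeasure_eq (g := fun _ => (1 : ℝ)) ha hab]
  · simp
  · intro s _ _ _
    by_cases h : s ∈ Set.Ioc a b <;> simp [h]

/-- The element of `L²` whose Wiener integral is the `k`-th coefficient of the solution at `t`. -/
noncomputable def heatMode (k : ℕ) (t : ℝ) : Lp ℝ 2 spaceTimeMeasure :=
  mode k (expKernel (eigenvalue k) t) (memLp_expKernel (eigenvalue_pos k) t)

/-- The element of `L²` whose Wiener integral is the increment over `(a, b]` of the `k`-th
coefficient of the noise. -/
noncomputable def noiseMode (k : ℕ) (a b : ℝ) : Lp ℝ 2 spaceTimeMeasure :=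
  mode k _ (memLp_indicator_Ioc a b)

/-- The increment over `[a, b]` of `heatMode`. -/
noncomputable def heatIncr (k : ℕ) (a b : ℝ) : Lp ℝ 2 spaceTimeMeasure :=
  heatMode k b - heatMode k a

theorem inner_heatMode_of_ne {k l : ℕ} (h : k ≠ l) (a b : ℝ) :
    inner ℝ (heatMode k a) (heatMode l b) = (0 : ℝ) := by
  rw [heatMode, heatMode, inner_mode, if_neg h]

theorem inner_heatMode {a b : ℝ} (k : ℕ) (ha : 0 ≤ a) (hab : a ≤ b) :
    inner ℝ (heatMode k a) (heatMode k b) = Real.exp (-(eigenvalue k * (b - a))) *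
      (1 - Real.exp (-(2 * eigenvalue k * a))) / (2 * eigenvalue k) := by
  rw [heatMode, heatMode, inner_mode, if_pos rfl,
    integral_expKernel_mul (eigenvalue_pos k) ha hab]

theorem norm_sq_heatMode (k : ℕ) {t : ℝ} (ht : 0 ≤ t) :
    ‖heatMode k t‖ ^ 2 = (1 - Real.exp (-(2 * eigenvalue k * t))) / (2 * eigenvalue k) := by
  rw [← real_inner_self_eq_norm_sq, inner_heatMode k ht le_rfl]
  simp

theorem norm_sq_heatMode_le (k : ℕ) {t : ℝ} (ht : 0 ≤ t) :
    ‖heatMode k t‖ ^ 2 ≤ (eigenvalue k)⁻¹ := by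
  rw [norm_sq_heatMode k ht, div_le_iff₀ (by linarith [eigenvalue_pos k])]
  rw [show (eigenvalue k)⁻¹ * (2 * eigenvalue k) = 2 by
    have := (eigenvalue_pos k).ne'
    field_simp]
  linarith [Real.exp_pos (-(2 * eigenvalue k * t))]

theorem inner_heatIncr_of_ne {k l : ℕ} (h : k ≠ l) (a b a' b' : ℝ) :
    inner ℝ (heatIncr k a b) (heatIncr l a' b') = (0 : ℝ) := by
  simp [heatIncr, inner_sub_left, inner_sub_right, inner_heatMode_of_ne h]

/-- The first term is the increment variance of the stationary Ornstein–Uhlenbeck process; the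
second is the defect caused by the zero initial value, and it decays exponentially in `a`. -/
theorem norm_sq_heatIncr (k : ℕ) {a b : ℝ} (ha : 0 ≤ a) (hab : a ≤ b) :
    ‖heatIncr k a b‖ ^ 2 = (1 - Real.exp (-(eigenvalue k * (b - a)))) / eigenvalue k -
      Real.exp (-(2 * eigenvalue k * a)) * (1 - Real.exp (-(eigenvalue k * (b - a)))) ^ 2 /
        (2 * eigenvalue k) := by
  have hl := (eigenvalue_pos k).ne'
  rw [heatIncr, norm_sub_sq_real, norm_sq_heatMode k ha, norm_sq_heatMode k (ha.trans hab),
    real_inner_comm, inner_heatMode k ha hab,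
    show -(2 * eigenvalue k * b) = -(eigenvalue k * (b - a)) + (-(eigenvalue k * (b - a)) +
      -(2 * eigenvalue k * a)) by ring, Real.exp_add, Real.exp_add]
  field_simp
  ring

theorem norm_sq_heatIncr_le (k : ℕ) {a b : ℝ} (ha : 0 ≤ a) (hab : a ≤ b) :
    ‖heatIncr k a b‖ ^ 2 ≤ (1 - Real.exp (-(eigenvalue k * (b - a)))) / eigenvalue k := by
  rw [norm_sq_heatIncr k ha hab]
  have := eigenvalue_pos k
  have h : 0 ≤ Real.exp (-(2 * eigenvalue k * a)) *
    (1 - Real.exp (-(eigenvalue k * (b - a)))) ^ 2 / (2 * eigenvalue k) := by positivity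
  linarith

theorem norm_sq_noiseMode (k : ℕ) {a b : ℝ} (ha : 0 ≤ a) (hab : a ≤ b) :
    ‖noiseMode k a b‖ ^ 2 = b - a := by
  rw [← real_inner_self_eq_norm_sq, noiseMode, inner_mode, if_pos rfl,
    integral_indicator_mul_indicator ha hab]

theorem inner_noiseMode_of_ne {k l : ℕ} (h : k ≠ l) (a b a' b' : ℝ) :
    inner ℝ (noiseMode k a b) (noiseMode l a' b') = (0 : ℝ) := by
  rw [noiseMode, noiseMode, inner_mode, if_neg h]

theorem inner_noiseMode_of_disjoint (k l : ℕ) {a b a' b' : ℝ}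
    (h : Disjoint (Set.Ioc a b) (Set.Ioc a' b')) :
    inner ℝ (noiseMode k a b) (noiseMode l a' b') = (0 : ℝ) := by
  rw [noiseMode, noiseMode, inner_mode]
  split_ifs
  · rw [integral_eq_zero_of_ae (Eventually.of_forall fun s => ?_)]
    by_cases h1 : s ∈ Set.Ioc a b
    · simp [Set.indicator_of_notMem (Set.disjoint_left.1 h h1)]
    · simp [Set.indicator_of_notMem h1]
  · rfl

/-- The inner product of the two increments equals the stationary variance, which also bounds the
squared norm of the first, so one of the two copies cancels when the square is expanded. -/
theorem norm_sq_heatIncr_sub_noiseMode_le (k : ℕ) {a b : ℝ} (ha : 0 ≤ a) (hab : a ≤ b) :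
    ‖heatIncr k a b - noiseMode k a b‖ ^ 2 ≤
      (b - a) - (1 - Real.exp (-(eigenvalue k * (b - a)))) / eigenvalue k := by
  have h1 : inner ℝ (heatIncr k a b) (noiseMode k a b) =
      (1 - Real.exp (-(eigenvalue k * (b - a)))) / eigenvalue k := by
    rw [heatIncr, inner_sub_left, heatMode, heatMode, noiseMode, inner_mode, inner_mode,
      if_pos rfl, if_pos rfl, integral_expKernel_mul_indicator (eigenvalue_pos k) ha hab,
      integral_expKernel_mul_indicator_of_le, sub_zero]
  rw [norm_sub_sq_real, h1, norm_sq_noiseMode k ha hab]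
  linarith [norm_sq_heatIncr_le k ha hab]

end HeatPV

namespace HeatPV

/-! ### Expansion of the heat kernel -/

/-- Pythagoras bounds every finite block beyond N by the tail of `b`, and the bound survives the
limit. -/
theorem exists_hasSum_of_orthogonal {H : Type*} [NormedAddCommGroup H] [InnerProductSpace ℝ H]
    [CompleteSpace H] {h : ℕ → H} (horth : ∀ i j, i ≠ j → inner ℝ (h i) (h j) = 0) {b : ℕ → ℝ}
    (hb : Summable b) (hle : ∀ k, ‖h k‖ ^ 2 ≤ b k) :
    ∃ G, HasSum h G ∧ ∀ N, ‖G - ∑ k ∈ Finset.range N, h k‖ ^ 2 ≤ ∑' k, b (k + N) := by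
  have hV : OrthogonalFamily ℝ (fun k => (ℝ ∙ h k : Submodule ℝ H))
      fun k => (ℝ ∙ h k : Submodule ℝ H).subtypeₗᵢ := by
    refine OrthogonalFamily.of_pairwise fun i j hij => ?_
    simp only [Function.onFun, Submodule.isOrtho_span, Set.mem_singleton_iff]
    rintro u rfl v rfl
    exact horth i j hij
  let f : ∀ k, (ℝ ∙ h k : Submodule ℝ H) := fun k => ⟨h k, Submodule.mem_span_singleton_self _⟩
  have hb0 : ∀ k, 0 ≤ b k := fun k => (sq_nonneg _).trans (hle k)
  have hs : Summable h := by
    have := (hV.summable_iff_norm_sq_summable f).2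
      (Summable.of_nonneg_of_le (fun k => sq_nonneg _) (fun k => hle k) hb)
    exact this
  refine ⟨∑' k, h k, hs.hasSum, fun N => ?_⟩
  have h1 : Tendsto (fun M => ‖∑ k ∈ Finset.range M, h k - ∑ k ∈ Finset.range N, h k‖ ^ 2) atTop
      (𝓝 (‖∑' k, h k - ∑ k ∈ Finset.range N, h k‖ ^ 2)) :=
    ((hs.hasSum.tendsto_sum_nat.sub_const _).norm.pow 2)
  refine le_of_tendsto h1 ?_
  filter_upwards [eventually_ge_atTop N] with M hM
  rw [← Finset.sum_Ico_eq_sub _ hM]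
  have h2 := hV.norm_sum f (Finset.Ico N M)
  have h3 : ‖∑ k ∈ Finset.Ico N M, h k‖ ^ 2 = ∑ k ∈ Finset.Ico N M, ‖h k‖ ^ 2 := h2
  rw [h3]
  calc ∑ k ∈ Finset.Ico N M, ‖h k‖ ^ 2 ≤ ∑ k ∈ Finset.Ico N M, b k :=
        Finset.sum_le_sum fun k _ => hle k
    _ = ∑ k ∈ Finset.range (M - N), b (k + N) := by
        rw [Finset.sum_Ico_eq_sum_range]
        exact Finset.sum_congr rfl fun k _ => by rw [add_comm]
    _ ≤ ∑' k, b (k + N) :=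
        ((summable_nat_add_iff N).2 hb).sum_le_tsum _ fun k _ => hb0 _

theorem summable_inv_eigenvalue : Summable fun k => (eigenvalue k)⁻¹ := by
  have := summable_eigenvalue_rpow (s := -1) (by norm_num)
  simpa [Real.rpow_neg_one] using this

theorem summable_heatKernel {t : ℝ} (ht : 0 < t) (x y : ℝ) :
    Summable fun k : ℕ =>
      eigenfunction k x * eigenfunction k y * Real.exp (-(eigenvalue k * t)) := by
  have hg : Summable fun k : ℕ => Real.exp (-t) ^ k :=
    summable_geometric_of_lt_one (Real.exp_pos _).le (by rw [Real.exp_lt_one_iff]; linarith)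
  refine Summable.of_norm_bounded hg fun k => ?_
  rw [norm_mul, norm_mul, Real.norm_eq_abs, Real.norm_eq_abs,
    Real.norm_of_nonneg (Real.exp_pos _).le, ← Real.exp_nat_mul]
  have h1 : |eigenfunction k x| * |eigenfunction k y| ≤ 1 :=
    mul_le_one₀ (abs_eigenfunction_le k x) (abs_nonneg _) (abs_eigenfunction_le k y)
  have h2 : Real.exp (-(eigenvalue k * t)) ≤ Real.exp (k * -t) := by
    apply Real.exp_le_exp.2
    unfold eigenvalue
    have : (k : ℝ) ≤ (k + 1) ^ 2 := by
      have : (0 : ℝ) ≤ k := by positivity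
      nlinarith
    nlinarith
  calc _ ≤ 1 * Real.exp (-(eigenvalue k * t)) := by gcongr
    _ ≤ _ := by simpa using h2

theorem tendsto_sum_heatKernel (t s x y : ℝ) :
    Tendsto (fun N => ∑ k ∈ Finset.range N,
      eigenfunction k x * (expKernel (eigenvalue k) t s * eigenfunction k y)) atTop
      (𝓝 (heatKernel (t - s) x y)) := by
  by_cases h : s < t
  · have h0 : 0 < t - s := by linarith
    rw [heatKernel, if_pos h0]
    convert! (summable_heatKernel h0 x y).hasSum.tendsto_sum_nat using 2 with N
    refine Finset.sum_congr rfl fun k _ => ?_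
    simp only [expKernel, Set.indicator, Set.mem_Iio, h, if_true]
    ring
  · have h0 : ¬ 0 < t - s := by linarith
    rw [heatKernel, if_neg h0]
    simp [expKernel, Set.indicator, h]

/-- The L² sum of the orthogonal series agrees with the pointwise kernel because a subsequence of
the partial sums converges almost everywhere. The remainder bound does not depend on `x`, which
later allows integration over space. -/
theorem memLp_heatKernel {t : ℝ} (ht : 0 ≤ t) (x : ℝ) :
    ∃ hf : MemLp (fun z : ℝ × ℝ => heatKernel (t - z.1) x z.2) 2 spaceTimeMeasure,
      ∀ N, ‖hf.toLp - ∑ k ∈ Finset.range N, eigenfunction k x • heatMode k t‖ ^ 2 ≤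
        ∑' k, (eigenvalue (k + N))⁻¹ := by
  obtain ⟨G, hG, hN⟩ := exists_hasSum_of_orthogonal
    (h := fun k => eigenfunction k x • heatMode k t)
    (fun i j hij => by simp [inner_smul_left, inner_smul_right, inner_heatMode_of_ne hij])
    summable_inv_eigenvalue (fun k => by
      rw [norm_smul, mul_pow, Real.norm_eq_abs]
      calc |eigenfunction k x| ^ 2 * ‖heatMode k t‖ ^ 2 ≤ 1 ^ 2 * (eigenvalue k)⁻¹ := by
            gcongr
            · exact abs_eigenfunction_le k x
            · exact norm_sq_heatMode_le k ht
        _ = _ := by ring)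
  obtain ⟨ns, hns, hae⟩ :=
    (tendstoInMeasure_of_tendsto_Lp hG.tendsto_sum_nat).exists_seq_tendsto_ae
  have hcoe : ∀ k, (eigenfunction k x • heatMode k t : Lp ℝ 2 spaceTimeMeasure) =ᵐ[spaceTimeMeasure]
      fun z => eigenfunction k x * (expKernel (eigenvalue k) t z.1 * eigenfunction k z.2) := by
    intro k
    filter_upwards [Lp.coeFn_smul (eigenfunction k x) (heatMode k t),
      coeFn_mode k (memLp_expKernel (eigenvalue_pos k) t)] with z h1 h2
    rw [h1, Pi.smul_apply, smul_eq_mul, heatMode, h2]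
  have hGae : G =ᵐ[spaceTimeMeasure] fun z => heatKernel (t - z.1) x z.2 := by
    have h1 : ∀ᵐ z ∂spaceTimeMeasure, ∀ N, (∑ k ∈ Finset.range N,
        eigenfunction k x • heatMode k t : Lp ℝ 2 spaceTimeMeasure) z = ∑ k ∈ Finset.range N,
        eigenfunction k x * (expKernel (eigenvalue k) t z.1 * eigenfunction k z.2) := by
      rw [ae_all_iff]
      intro N
      filter_upwards [Lp.coeFn_finsetSum (Finset.range N)
        (fun k => eigenfunction k x • heatMode k t), ae_all_iff.2 hcoe] with z h1 h2
      rw [h1, Finset.sum_apply]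
      exact Finset.sum_congr rfl fun k _ => h2 k
    filter_upwards [hae, h1] with z h2 h3
    refine tendsto_nhds_unique h2 ?_
    simp_rw [h3]
    exact (tendsto_sum_heatKernel t z.1 x z.2).comp hns.tendsto_atTop
  have hf : MemLp (fun z : ℝ × ℝ => heatKernel (t - z.1) x z.2) 2 spaceTimeMeasure :=
    (Lp.memLp G).ae_eq hGae
  refine ⟨hf, ?_⟩
  have : hf.toLp = G := by
    refine Lp.ext ?_
    exact (MemLp.coeFn_toLp hf).trans hGae.symm
  rw [this]
  exact hN

/-! ### The coefficients of the solution -/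

section Solution

variable {Ω : Type*} [MeasurableSpace Ω] {P : Measure Ω}
  {W : Lp ℝ 2 spaceTimeMeasure → Ω → ℝ} {u : ℝ → ℝ → Ω → ℝ}

theorem lintegral_sub_sum_sq_le (hW : IsWhiteNoise W P) (hu : IsRandomFieldSolution W P u) {t : ℝ}
    (ht : 0 ≤ t) {x : ℝ} (hx : x ∈ Set.Ioo 0 Real.pi) (N : ℕ) :
    ∫⁻ ω, ENNReal.ofReal ((u t x ω - ∑ k ∈ Finset.range N,
      eigenfunction k x * W (heatMode k t) ω) ^ 2) ∂P ≤
        ENNReal.ofReal (∑' k, (eigenvalue (k + N))⁻¹) := by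
  obtain ⟨hf, hN⟩ := memLp_heatKernel ht x
  have h1 := hu.mild t ht x hx
  rw [wienerIntegral, dif_pos hf] at h1
  calc _ = ∫⁻ ω, ENNReal.ofReal (W (hf.toLp - ∑ k ∈ Finset.range N,
        eigenfunction k x • heatMode k t) ω ^ 2) ∂P := by
        refine lintegral_congr_ae ?_
        filter_upwards [h1, hW.map_sub hf.toLp (∑ k ∈ Finset.range N,
          eigenfunction k x • heatMode k t), hW.map_sum (Finset.range N)
          (fun k => eigenfunction k x) (fun k => heatMode k t)] with ω h1 h2 h3
        rw [h2, Pi.sub_apply, h3, h1]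
    _ = _ := hW.lintegral_sq _
    _ ≤ _ := ENNReal.ofReal_le_ofReal (hN N)

theorem aemeasurable_sub_sum (hW : IsWhiteNoise W P) (hu : IsRandomFieldSolution W P u) {t : ℝ}
    (ht : 0 ≤ t) (N : ℕ) :
    AEMeasurable (fun z : ℝ × Ω => u t z.1 z.2 - ∑ k ∈ Finset.range N,
      eigenfunction k z.1 * W (heatMode k t) z.2) (spaceMeasure.prod P) := by
  refine (hu.measurable t ht).sub (Finset.aemeasurable_fun_sum _ fun k _ => ?_)
  refine AEMeasurable.mul ?_ (hW.aemeasurable _).comp_snd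
  exact (continuous_eigenfunction k).measurable.aemeasurable.comp_fst

/-- The mild equation holds off a null set that depends on `x`. Tonelli turns the estimate at each
fixed `x` into one on paths. -/
theorem lintegral_prod_sub_sum_sq_le [IsProbabilityMeasure P] (hW : IsWhiteNoise W P)
    (hu : IsRandomFieldSolution W P u) {t : ℝ} (ht : 0 ≤ t) (N : ℕ) :
    ∫⁻ ω, ∫⁻ x, ENNReal.ofReal ((u t x ω - ∑ k ∈ Finset.range N,
      eigenfunction k x * W (heatMode k t) ω) ^ 2) ∂spaceMeasure ∂P ≤
        ENNReal.ofReal (∑' k, (eigenvalue (k + N))⁻¹) * spaceMeasure Set.univ := by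
  have hm := ((aemeasurable_sub_sum hW hu ht N).pow_const 2).ennreal_ofReal
  rw [← lintegral_prod_symm _ hm, lintegral_prod _ hm, ← lintegral_const]
  refine lintegral_mono_ae ?_
  rw [spaceMeasure]
  exact (ae_restrict_mem measurableSet_Ioo).mono fun x hx =>
    lintegral_sub_sum_sq_le hW hu ht hx N

theorem ae_memLp_solution [IsProbabilityMeasure P] (hW : IsWhiteNoise W P)
    (hu : IsRandomFieldSolution W P u) {t : ℝ} (ht : 0 ≤ t) : ∀ᵐ ω ∂P, MemLp (fun x => u t x ω) 2 spaceMeasure := by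
  have hm := hu.measurable t ht
  have hsec : ∀ᵐ ω ∂P, AEStronglyMeasurable (fun x => u t x ω) spaceMeasure := by
    have := (hm.aestronglyMeasurable.prod_swap).prodMk_left
    exact this
  have hfin : ∀ᵐ ω ∂P, ∫⁻ x, ENNReal.ofReal ((u t x ω) ^ 2) ∂spaceMeasure < ⊤ := by
    have hb := lintegral_prod_sub_sum_sq_le hW hu ht 0
    simp only [Finset.range_zero, Finset.sum_empty, sub_zero] at hb
    refine ae_lt_top' ?_ (hb.trans_lt (ENNReal.mul_lt_top ENNReal.ofReal_lt_top
      (measure_lt_top _ _))).ne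
    exact ((hm.pow_const 2).ennreal_ofReal).lintegral_prod_left'
  filter_upwards [hsec, hfin] with ω h1 h2
  rw [memLp_two_iff_integrable_sq h1]
  refine ⟨h1.pow 2, ?_⟩
  rw [hasFiniteIntegral_iff_ofReal (Eventually.of_forall fun x => sq_nonneg _)]
  exact h2

theorem coeffs_sub {f g : ℝ → ℝ} (hf : MemLp f 2 spaceMeasure) (hg : MemLp g 2 spaceMeasure)
    (k : ℕ) : coeffs (fun x => f x - g x) k = coeffs f k - coeffs g k := by
  have h1 : Integrable (fun x => f x * eigenfunction k x) spaceMeasure :=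
    hf.integrable_mul (memLp_eigenfunction k 2)
  have h2 : Integrable (fun x => g x * eigenfunction k x) spaceMeasure :=
    hg.integrable_mul (memLp_eigenfunction k 2)
  unfold coeffs
  rw [← integral_sub h1 h2]
  exact integral_congr_ae (Eventually.of_forall fun x => by simp; ring)

theorem memLp_sum_eigenfunction (N : ℕ) (c : ℕ → ℝ) :
    MemLp (fun x => ∑ k ∈ Finset.range N, eigenfunction k x * c k) 2 spaceMeasure :=
  memLp_finsetSum _ fun k _ => (memLp_eigenfunction k 2).mul_const (c k)

theorem coeffs_sum_eigenfunction {N k : ℕ} (hk : k < N) (c : ℕ → ℝ) :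
    coeffs (fun x => ∑ j ∈ Finset.range N, eigenfunction j x * c j) k = c k := by
  unfold coeffs
  simp_rw [Finset.sum_mul]
  rw [integral_finsetSum]
  · have : ∀ j, ∫ x, eigenfunction j x * c j * eigenfunction k x ∂spaceMeasure =
        c j * if j = k then 1 else 0 := by
      intro j
      rw [← integral_eigenfunction_mul, ← integral_const_mul]
      exact integral_congr_ae (Eventually.of_forall fun x => by simp; ring)
    simp_rw [this]
    simp [hk]
  · intro j _
    exact ((memLp_eigenfunction j 2).mul_const (c j)).integrable_mul (memLp_eigenfunction k 2)

/-- Young's inequality |f| ≤ ε + ε⁻¹f² replaces Cauchy–Schwarz: the bound is linear in ∫ f² and can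
be integrated over ω as it stands. No integrability of `f` is required, since a Bochner integral
that does not exist has value 0. -/
theorem ofReal_abs_coeffs_le (f : ℝ → ℝ) (k : ℕ) {ε : ℝ} (hε : 0 < ε) :
    ENNReal.ofReal |coeffs f k| ≤ ENNReal.ofReal ε * spaceMeasure Set.univ +
      ENNReal.ofReal ε⁻¹ * ∫⁻ x, ENNReal.ofReal (f x ^ 2) ∂spaceMeasure := by
  unfold coeffs
  rw [← Real.norm_eq_abs, ofReal_norm, ← lintegral_const, ← lintegral_const_mul'
    _ _ ENNReal.ofReal_ne_top]
  refine (enorm_integral_le_lintegral_enorm _).trans ?_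
  rw [← lintegral_add_left measurable_const]
  refine lintegral_mono fun x => ?_
  rw [← ofReal_norm, ← ENNReal.ofReal_mul (by positivity),
    ← ENNReal.ofReal_add hε.le (by positivity)]
  apply ENNReal.ofReal_le_ofReal
  rw [norm_mul, Real.norm_eq_abs, Real.norm_eq_abs]
  have h1 : |f x| * |eigenfunction k x| ≤ |f x| :=
    mul_le_of_le_one_right (abs_nonneg _) (abs_eigenfunction_le k x)
  refine h1.trans ?_
  have h2 : ε + ε⁻¹ * f x ^ 2 - |f x| = ε⁻¹ * ((ε - |f x| / 2) ^ 2 + 3 / 4 * |f x| ^ 2) := by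
    rw [← sq_abs (f x)]
    field_simp
    ring
  have h3 : 0 ≤ ε⁻¹ * ((ε - |f x| / 2) ^ 2 + 3 / 4 * |f x| ^ 2) := by positivity
  linarith

/-- For N > k, the difference of the two sides is the k-th coefficient of the solution minus its
N-th partial sum. The L¹ bound on it vanishes when first N → ∞ and then ε → 0. -/
theorem ae_coeffs_solution_eq [IsProbabilityMeasure P] (hW : IsWhiteNoise W P)
    (hu : IsRandomFieldSolution W P u) {t : ℝ} (ht : 0 ≤ t) (k : ℕ) :
    (fun ω => coeffs (fun x => u t x ω) k) =ᵐ[P] W (heatMode k t) := by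
  have hmc : AEMeasurable (fun ω => coeffs (fun x => u t x ω) k) P := by
    have h1 : AEStronglyMeasurable (fun z : Ω × ℝ => u t z.2 z.1 * eigenfunction k z.2)
        (P.prod spaceMeasure) :=
      ((hu.measurable t ht).aestronglyMeasurable.prod_swap).mul
        (continuous_eigenfunction k).aestronglyMeasurable.comp_snd
    exact h1.integral_prod_right'.aemeasurable
  have hm : AEMeasurable (fun ω => ENNReal.ofReal
      |coeffs (fun x => u t x ω) k - W (heatMode k t) ω|) P :=
    ((hmc.sub (hW.aemeasurable _)).norm).ennreal_ofReal
  suffices h : ∫⁻ ω, ENNReal.ofReal |coeffs (fun x => u t x ω) k - W (heatMode k t) ω| ∂P = 0 by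
    filter_upwards [(lintegral_eq_zero_iff' hm).1 h] with ω hω
    simpa [sub_eq_zero] using hω
  have hbound : ∀ ε : ℝ, 0 < ε → ∀ N, k < N →
      ∫⁻ ω, ENNReal.ofReal |coeffs (fun x => u t x ω) k - W (heatMode k t) ω| ∂P ≤
      ENNReal.ofReal ε * spaceMeasure Set.univ + ENNReal.ofReal ε⁻¹ *
        (ENNReal.ofReal (∑' k, (eigenvalue (k + N))⁻¹) * spaceMeasure Set.univ) := by
    intro ε hε N hN
    calc _ ≤ ∫⁻ ω, (ENNReal.ofReal ε * spaceMeasure Set.univ + ENNReal.ofReal ε⁻¹ *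
          ∫⁻ x, ENNReal.ofReal ((u t x ω - ∑ k ∈ Finset.range N,
            eigenfunction k x * W (heatMode k t) ω) ^ 2) ∂spaceMeasure) ∂P := by
          refine lintegral_mono_ae ?_
          filter_upwards [ae_memLp_solution hW hu ht] with ω hω
          have := ofReal_abs_coeffs_le (fun x => u t x ω - ∑ k ∈ Finset.range N,
            eigenfunction k x * W (heatMode k t) ω) k hε
          rwa [coeffs_sub hω (memLp_sum_eigenfunction N fun k => W (heatMode k t) ω),
            coeffs_sum_eigenfunction hN fun k => W (heatMode k t) ω] at this
      _ ≤ _ := by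
          rw [lintegral_add_left measurable_const, lintegral_const, measure_univ (μ := P), mul_one,
            lintegral_const_mul' _ _ ENNReal.ofReal_ne_top]
          gcongr
          exact lintegral_prod_sub_sum_sq_le hW hu ht N
  have hlim : ∀ ε : ℝ, 0 < ε →
      ∫⁻ ω, ENNReal.ofReal |coeffs (fun x => u t x ω) k - W (heatMode k t) ω| ∂P ≤
      ENNReal.ofReal ε * spaceMeasure Set.univ := by
    intro ε hε
    have hR := tendsto_sum_nat_add fun k => (eigenvalue k)⁻¹
    have h2 : Tendsto (fun N : ℕ => ENNReal.ofReal ε * spaceMeasure Set.univ +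
        ENNReal.ofReal ε⁻¹ * (ENNReal.ofReal (∑' k, (eigenvalue (k + N))⁻¹) *
          spaceMeasure Set.univ)) atTop (𝓝 (ENNReal.ofReal ε * spaceMeasure Set.univ +
        ENNReal.ofReal ε⁻¹ * (ENNReal.ofReal 0 * spaceMeasure Set.univ))) := by
      refine tendsto_const_nhds.add (ENNReal.Tendsto.const_mul (ENNReal.Tendsto.mul_const
        (ENNReal.tendsto_ofReal hR) ?_) (Or.inr ENNReal.ofReal_ne_top))
      exact Or.inr (measure_ne_top _ _)
    have h3 := ge_of_tendsto h2 ((eventually_gt_atTop k).mono fun N hN => hbound ε hε N hN)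
    simpa using h3
  have h4 : Tendsto (fun ε : ℝ => ENNReal.ofReal ε * spaceMeasure Set.univ) (𝓝[>] 0)
      (𝓝 (ENNReal.ofReal 0 * spaceMeasure Set.univ)) :=
    ENNReal.Tendsto.mul_const ((ENNReal.continuous_ofReal.tendsto 0).mono_left
      nhdsWithin_le_nhds) (Or.inr (measure_ne_top _ _))
  have h5 := ge_of_tendsto h4 (eventually_mem_nhdsWithin.mono hlim)
  simpa using h5

end Solution

end HeatPV

namespace HeatPV

/-! ### Convergence of Riemann-type averages of nonnegative random variables -/

/-- The sequence `G` may depend on η: truncation parameters are fixed in terms of η before n tends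
to infinity. -/
theorem tendsto_zero_of_forall_le {F : ℕ → ENNReal}
    (h : ∀ η : ℝ, 0 < η → ∃ G : ℕ → ENNReal, Tendsto G atTop (𝓝 0) ∧
      ∀ᶠ n in atTop, F n ≤ ENNReal.ofReal η + G n) : Tendsto F atTop (𝓝 0) := by
  have hl : ∀ η : ℝ, 0 < η → limsup F atTop ≤ ENNReal.ofReal η := by
    intro η hη
    obtain ⟨G, hG, hle⟩ := h η hη
    have h1 : Tendsto (fun n => ENNReal.ofReal η + G n) atTop (𝓝 (ENNReal.ofReal η + 0)) :=
      tendsto_const_nhds.add hG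
    rw [add_zero] at h1
    exact (limsup_le_limsup hle).trans h1.limsup_eq.le
  have h0 : limsup F atTop ≤ 0 := by
    have h4 : Tendsto (fun ε : ℝ => ENNReal.ofReal ε) (𝓝[>] 0) (𝓝 (ENNReal.ofReal 0)) :=
      (ENNReal.continuous_ofReal.tendsto 0).mono_left nhdsWithin_le_nhds
    simpa using ge_of_tendsto h4 (eventually_mem_nhdsWithin.mono hl)
  exact tendsto_of_le_liminf_of_limsup_le zero_le h0

/-- Truncation at L: below it the p-th power is Lipschitz with constant p L^{p-1}, above it x^p ≤
L⁻¹x^{p+1}. This passes L¹ closeness on to powers at the cost of moment bounds. -/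
theorem abs_pow_sub_pow_le_add {x y L : ℝ} (hx : 0 ≤ x) (hy : 0 ≤ y) (hL : 0 < L) (p : ℕ) :
    |x ^ p - y ^ p| ≤ p * L ^ (p - 1) * |x - y| + L⁻¹ * (x ^ (p + 1) + y ^ (p + 1)) := by
  have key : ∀ a b : ℝ, 0 ≤ a → 0 ≤ b → b ≤ a →
      |a ^ p - b ^ p| ≤ p * L ^ (p - 1) * |a - b| + L⁻¹ * (a ^ (p + 1) + b ^ (p + 1)) := by
    intro a b ha hb hab
    rcases le_total a L with h | h
    · have h1 := abs_pow_sub_pow_le a b p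
      rw [abs_of_nonneg ha, abs_of_nonneg hb, max_eq_left hab] at h1
      calc _ ≤ |a - b| * p * a ^ (p - 1) := h1
        _ ≤ |a - b| * p * L ^ (p - 1) := by gcongr
        _ = p * L ^ (p - 1) * |a - b| := by ring
        _ ≤ _ := le_add_of_nonneg_right (by positivity)
    · have h2 : |a ^ p - b ^ p| ≤ a ^ p := by
        rw [abs_of_nonneg (sub_nonneg.2 (pow_le_pow_left₀ hb hab p))]
        linarith [pow_nonneg hb p]
      have h3 : a ^ p ≤ L⁻¹ * a ^ (p + 1) := by
        rw [le_inv_mul_iff₀ hL, pow_succ, mul_comm]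
        gcongr
      have h4 : L⁻¹ * a ^ (p + 1) ≤ L⁻¹ * (a ^ (p + 1) + b ^ (p + 1)) := by
        gcongr
        exact le_add_of_nonneg_right (by positivity)
      have h5 : 0 ≤ p * L ^ (p - 1) * |a - b| := by positivity
      linarith
  rcases le_total y x with h | h
  · exact key x y hx hy h
  · have := key y x hy hx h
    rw [abs_sub_comm, abs_sub_comm x y, add_comm (x ^ (p + 1))]
    exact this

/-- The three terms dominate on x ≤ ε, ε ≤ x ≤ L and x ≥ L. L¹ convergence together with a bounded
M-th moment thus gives L^q convergence for every q > 0, including q < 1. -/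
theorem rpow_le_split {x q ε L : ℝ} (hx : 0 ≤ x) (hq : 0 < q) (hε : 0 < ε) (hL : 1 ≤ L) {M : ℕ}
    (hM : q + 1 ≤ M) : x ^ q ≤ ε ^ q + (L ^ q / ε * x + L⁻¹ * x ^ M) := by
  have hL0 : 0 < L := by linarith
  have p1 : 0 ≤ ε ^ q := by positivity
  have p2 : 0 ≤ L ^ q / ε * x := by positivity
  have p3 : 0 ≤ L⁻¹ * x ^ M := by positivity
  rcases le_total x ε with h | h
  · have := Real.rpow_le_rpow hx h hq.le
    linarith
  rcases le_total x L with h' | h'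
  · have h1 := Real.rpow_le_rpow hx h' hq.le
    have h2 : L ^ q ≤ L ^ q / ε * x := by
      rw [div_mul_eq_mul_div, le_div_iff₀ hε]
      gcongr
    linarith
  · have h1 : x ^ q ≤ L⁻¹ * x ^ M := by
      rw [le_inv_mul_iff₀ hL0, ← Real.rpow_natCast x M]
      calc L * x ^ q ≤ x * x ^ q := by gcongr
        _ = x ^ (q + 1) := by rw [Real.rpow_add (by linarith), Real.rpow_one, mul_comm]
        _ ≤ _ := Real.rpow_le_rpow_of_exponent_le (hL.trans h') hM
    linarith

/-- The average `δ ∑_{1 ≤ i ≤ t/δ} A i`. -/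
noncomputable def riemannAvg (δ t : ℝ) (A : ℕ → ℝ) : ℝ := δ * ∑ i ∈ Finset.Icc 1 ⌊t / δ⌋₊, A i

theorem mul_floor_le {δ t : ℝ} (hδ : 0 < δ) (ht : 0 ≤ t) : δ * ⌊t / δ⌋₊ ≤ t := by
  have := Nat.floor_le (div_nonneg ht hδ.le)
  rwa [le_div_iff₀ hδ, mul_comm] at this

theorem abs_mul_floor_sub_le {δ t : ℝ} (hδ : 0 < δ) (ht : 0 ≤ t) : |δ * ⌊t / δ⌋₊ - t| ≤ δ := by
  have h1 := mul_floor_le hδ ht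
  have h2 := Nat.lt_floor_add_one (t / δ)
  rw [div_lt_iff₀ hδ] at h2
  rw [abs_le]
  constructor <;> nlinarith

theorem riemannAvg_mono {δ s t : ℝ} (hδ : 0 < δ) (hst : s ≤ t) {A : ℕ → ℝ} (hA : ∀ i, 0 ≤ A i) :
    riemannAvg δ s A ≤ riemannAvg δ t A := by
  unfold riemannAvg
  gcongr
  exact fun i _ _ => hA i

theorem riemannAvg_nonneg {δ t : ℝ} (hδ : 0 < δ) {A : ℕ → ℝ} (hA : ∀ i, 0 ≤ A i) :
    0 ≤ riemannAvg δ t A :=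
  mul_nonneg hδ.le (Finset.sum_nonneg fun i _ => hA i)

/-- Jensen's inequality over the ⌊t/δ⌋ steps, whose total length is at most t. -/
theorem riemannAvg_pow_le {δ t : ℝ} (hδ : 0 < δ) (ht : 0 ≤ t) {A : ℕ → ℝ} (hA : ∀ i, 0 ≤ A i)
    (m : ℕ) : riemannAvg δ t A ^ (m + 1) ≤ t ^ m * riemannAvg δ t (fun i => A i ^ (m + 1)) := by
  unfold riemannAvg
  have h1 := pow_sum_div_card_le_sum_pow (s := Finset.Icc 1 ⌊t / δ⌋₊) (f := A) (n := m)
    (fun i _ => hA i)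
  rw [Nat.card_Icc, Nat.add_sub_cancel] at h1
  set N := ⌊t / δ⌋₊ with hN
  rcases Nat.eq_zero_or_pos N with h0 | h0
  · simp [h0]
  · have hNp : (0 : ℝ) < N := by exact_mod_cast h0
    rw [div_le_iff₀ (by positivity)] at h1
    calc (δ * ∑ i ∈ Finset.Icc 1 N, A i) ^ (m + 1)
        = δ ^ (m + 1) * (∑ i ∈ Finset.Icc 1 N, A i) ^ (m + 1) := mul_pow _ _ _
      _ ≤ δ ^ (m + 1) * ((∑ i ∈ Finset.Icc 1 N, A i ^ (m + 1)) * (N : ℝ) ^ m) := by gcongr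
      _ = (δ * N) ^ m * (δ * ∑ i ∈ Finset.Icc 1 N, A i ^ (m + 1)) := by ring
      _ ≤ _ := by
        have := mul_floor_le hδ ht
        have h2 : 0 ≤ δ * ∑ i ∈ Finset.Icc 1 N, A i ^ (m + 1) :=
          mul_nonneg hδ.le (Finset.sum_nonneg fun i _ => pow_nonneg (hA i) _)
        gcongr

section Averages

variable {Ω : Type*} [MeasurableSpace Ω] {P : Measure Ω} {δ : ℕ → ℝ}
  {A : ℕ → ℕ → Ω → ℝ}

theorem aemeasurable_riemannAvg (δ t : ℝ) {B : ℕ → Ω → ℝ} (hB : ∀ i, AEMeasurable (B i) P) :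
    AEMeasurable (fun ω => riemannAvg δ t fun i => B i ω) P :=
  (Finset.aemeasurable_fun_sum _ fun i _ => hB i).const_mul δ

theorem lintegral_riemannAvg {δ t : ℝ} (hδ : 0 < δ) {B : ℕ → Ω → ℝ}
    (hB0 : ∀ i ω, 0 ≤ B i ω) (hB : ∀ i, AEMeasurable (B i) P) :
    ∫⁻ ω, ENNReal.ofReal (riemannAvg δ t fun i => B i ω) ∂P =
      ENNReal.ofReal δ * ∑ i ∈ Finset.Icc 1 ⌊t / δ⌋₊, ∫⁻ ω, ENNReal.ofReal (B i ω) ∂P := by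
  unfold riemannAvg
  simp_rw [ENNReal.ofReal_mul hδ.le]
  rw [lintegral_const_mul' _ _ ENNReal.ofReal_ne_top, ← lintegral_finsetSum' _
    fun i _ => (hB i).ennreal_ofReal]
  simp_rw [ENNReal.ofReal_sum_of_nonneg fun i _ => hB0 i _]

theorem lintegral_riemannAvg_le {δ t C : ℝ} (hδ : 0 < δ) (ht : 0 ≤ t) {B : ℕ → Ω → ℝ}
    (hB0 : ∀ i ω, 0 ≤ B i ω) (hB : ∀ i, AEMeasurable (B i) P)
    (hC : ∀ i, 1 ≤ i → ∫⁻ ω, ENNReal.ofReal (B i ω) ∂P ≤ ENNReal.ofReal C) :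
    ∫⁻ ω, ENNReal.ofReal (riemannAvg δ t fun i => B i ω) ∂P ≤
      ENNReal.ofReal t * ENNReal.ofReal C := by
  rw [lintegral_riemannAvg hδ hB0 hB]
  calc _ ≤ ENNReal.ofReal δ * ∑ i ∈ Finset.Icc 1 ⌊t / δ⌋₊, ENNReal.ofReal C := by
        gcongr with i hi
        exact hC i (Finset.mem_Icc.1 hi).1
    _ = ENNReal.ofReal (δ * ⌊t / δ⌋₊) * ENNReal.ofReal C := by
        rw [Finset.sum_const, Nat.card_Icc, Nat.add_sub_cancel, nsmul_eq_mul,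
          ENNReal.ofReal_mul hδ.le, ENNReal.ofReal_natCast, mul_assoc]
    _ ≤ _ := by
        gcongr
        exact mul_floor_le hδ ht

theorem tendsto_lintegral_rpow_riemannAvg [IsProbabilityMeasure P] (hpos : ∀ n, 0 < δ n)
    (hA0 : ∀ n i ω, 0 ≤ A n i ω) (hAm : ∀ n i, AEMeasurable (A n i) P)
    (hmom : ∀ m : ℕ, ∃ C : ℝ, ∀ᶠ n in atTop, ∀ i, 1 ≤ i →
      ∫⁻ ω, ENNReal.ofReal (A n i ω ^ m) ∂P ≤ ENNReal.ofReal C)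
    {K t : ℝ} (ht : 0 ≤ t)
    (h : Tendsto (fun n => ∫⁻ ω, ENNReal.ofReal |riemannAvg (δ n) t (fun i => A n i ω) - K * t| ∂P)
      atTop (𝓝 0)) {q : ℝ} (hq : 0 < q) :
    Tendsto (fun n => ∫⁻ ω, ENNReal.ofReal
      (|riemannAvg (δ n) t (fun i => A n i ω) - K * t| ^ q) ∂P) atTop (𝓝 0) := by
  obtain ⟨m, hm⟩ := exists_nat_ge q
  obtain ⟨C, hC⟩ := hmom (m + 1)
  set B : ℝ := 2 ^ m * (t ^ m * (t * max C 0) + |K * t| ^ (m + 1)) with hB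
  have hB0 : 0 ≤ B := by positivity
  have hbound : ∀ᶠ n in atTop, ∫⁻ ω, ENNReal.ofReal
      (|riemannAvg (δ n) t (fun i => A n i ω) - K * t| ^ (m + 1)) ∂P ≤ ENNReal.ofReal B := by
    filter_upwards [hC] with n hn
    calc _ ≤ ∫⁻ ω, (ENNReal.ofReal (2 ^ m * t ^ m) * ENNReal.ofReal (riemannAvg (δ n) t
          fun i => A n i ω ^ (m + 1)) + ENNReal.ofReal (2 ^ m * |K * t| ^ (m + 1))) ∂P := by
          refine lintegral_mono fun ω => ?_
          have h0 : 0 ≤ riemannAvg (δ n) t fun i => A n i ω :=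
            riemannAvg_nonneg (hpos n) fun i => hA0 n i ω
          have h1 : 0 ≤ riemannAvg (δ n) t fun i => A n i ω ^ (m + 1) :=
            riemannAvg_nonneg (hpos n) fun i => pow_nonneg (hA0 n i ω) _
          rw [← ENNReal.ofReal_mul (by positivity), ← ENNReal.ofReal_add (by positivity)
            (by positivity)]
          apply ENNReal.ofReal_le_ofReal
          calc _ ≤ (riemannAvg (δ n) t (fun i => A n i ω) + |K * t|) ^ (m + 1) := by
                gcongr
                exact (abs_sub _ _).trans_eq (by rw [abs_of_nonneg h0])
            _ ≤ 2 ^ m * (riemannAvg (δ n) t (fun i => A n i ω) ^ (m + 1) + |K * t| ^ (m + 1)) :=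
                add_pow_le h0 (abs_nonneg _) _
            _ ≤ 2 ^ m * (t ^ m * riemannAvg (δ n) t (fun i => A n i ω ^ (m + 1)) +
                  |K * t| ^ (m + 1)) := by
                gcongr
                exact riemannAvg_pow_le (hpos n) ht (fun i => hA0 n i ω) m
            _ = _ := by ring
      _ ≤ ENNReal.ofReal (2 ^ m * t ^ m) * (ENNReal.ofReal t * ENNReal.ofReal (max C 0)) +
            ENNReal.ofReal (2 ^ m * |K * t| ^ (m + 1)) := by
          rw [lintegral_add_right _ measurable_const, lintegral_const, measure_univ, mul_one,
            lintegral_const_mul' _ _ ENNReal.ofReal_ne_top]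
          gcongr
          refine lintegral_riemannAvg_le (hpos n) ht (fun i ω => pow_nonneg (hA0 n i ω) _)
            (fun i => (hAm n i).pow_const _) fun i hi => (hn i hi).trans ?_
          exact ENNReal.ofReal_le_ofReal (le_max_left _ _)
      _ = _ := by
          rw [← ENNReal.ofReal_mul ht, ← ENNReal.ofReal_mul (by positivity),
            ← ENNReal.ofReal_add (by positivity) (by positivity), hB]
          congr 1
          ring
  refine tendsto_zero_of_forall_le fun η hη => ?_
  -- Small values and large values cost η/2 each, uniformly for large n; the middle range is
  -- controlled by the L¹ convergence.
  obtain ⟨ε, hε, hεη⟩ : ∃ ε : ℝ, 0 < ε ∧ ε ^ q ≤ η / 2 :=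
    ⟨(η / 2) ^ q⁻¹, by positivity, by rw [Real.rpow_inv_rpow (by positivity) hq.ne']⟩
  obtain ⟨L, hL, hLη⟩ : ∃ L : ℝ, 1 ≤ L ∧ L⁻¹ * B ≤ η / 2 := by
    refine ⟨max 1 (B / (η / 2)), le_max_left _ _, ?_⟩
    rw [inv_mul_le_iff₀ (by positivity), ← div_le_iff₀ (by positivity)]
    exact le_max_right _ _
  refine ⟨fun n => ENNReal.ofReal (L ^ q / ε) *
    ∫⁻ ω, ENNReal.ofReal |riemannAvg (δ n) t (fun i => A n i ω) - K * t| ∂P, ?_, ?_⟩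
  · have := ENNReal.Tendsto.const_mul h (Or.inr (ENNReal.ofReal_ne_top (r := L ^ q / ε)))
    simpa using this
  filter_upwards [hbound] with n hn
  have hmeas : AEMeasurable (fun ω => |riemannAvg (δ n) t (fun i => A n i ω) - K * t|) P :=
    ((aemeasurable_riemannAvg (δ n) t (hAm n)).sub_const _).norm
  calc _ ≤ ∫⁻ ω, (ENNReal.ofReal (ε ^ q) + (ENNReal.ofReal (L ^ q / ε) * ENNReal.ofReal
        |riemannAvg (δ n) t (fun i => A n i ω) - K * t| + ENNReal.ofReal L⁻¹ *
        ENNReal.ofReal (|riemannAvg (δ n) t (fun i => A n i ω) - K * t| ^ (m + 1)))) ∂P := by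
        refine lintegral_mono fun ω => ?_
        rw [← ENNReal.ofReal_mul (by positivity), ← ENNReal.ofReal_mul (by positivity),
          ← ENNReal.ofReal_add (by positivity) (by positivity),
          ← ENNReal.ofReal_add (by positivity) (by positivity)]
        apply ENNReal.ofReal_le_ofReal
        exact rpow_le_split (abs_nonneg _) hq hε hL (by push_cast; linarith)
    _ = ENNReal.ofReal (ε ^ q) + (ENNReal.ofReal (L ^ q / ε) * ∫⁻ ω, ENNReal.ofReal
        |riemannAvg (δ n) t (fun i => A n i ω) - K * t| ∂P + ENNReal.ofReal L⁻¹ * ∫⁻ ω,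
        ENNReal.ofReal (|riemannAvg (δ n) t (fun i => A n i ω) - K * t| ^ (m + 1)) ∂P) := by
        rw [lintegral_add_left measurable_const, lintegral_const, measure_univ, mul_one,
          lintegral_add_left' (hmeas.ennreal_ofReal.const_mul _),
          lintegral_const_mul' _ _ ENNReal.ofReal_ne_top,
          lintegral_const_mul' _ _ ENNReal.ofReal_ne_top]
    _ ≤ ENNReal.ofReal (η / 2) + (ENNReal.ofReal (L ^ q / ε) * ∫⁻ ω, ENNReal.ofReal
        |riemannAvg (δ n) t (fun i => A n i ω) - K * t| ∂P + ENNReal.ofReal (η / 2)) := by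
        gcongr
        calc _ ≤ ENNReal.ofReal L⁻¹ * ENNReal.ofReal B := by gcongr
          _ = ENNReal.ofReal (L⁻¹ * B) := (ENNReal.ofReal_mul (by positivity)).symm
          _ ≤ _ := ENNReal.ofReal_le_ofReal hLη
    _ = _ := by
        rw [add_comm (_ * _), ← add_assoc, ← ENNReal.ofReal_add (by positivity) (by positivity),
          add_halves]

/-- As in Pólya's argument, monotonicity bounds a positive deviation at t by the one at the next
grid point to the right, and a negative one by that to the left, up to the variation of Kt over one
cell. -/
theorem exists_grid_le {V : ℝ → ℝ} (hV : Monotone V) (K : ℝ) {T : ℝ} (hT : 0 < T) {M : ℕ}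
    (hM : 0 < M) {t : ℝ} (ht : t ∈ Set.Icc 0 T) :
    ∃ j ∈ Finset.range (M + 1), |V t - K * t| ≤
      |V (j * (T / M)) - K * (j * (T / M))| + |K| * (T / M) := by
  have hMp : (0 : ℝ) < M := by exact_mod_cast hM
  set h := T / M with hh
  have hp : 0 < h := by positivity
  have hMh : (M : ℝ) * h = T := by rw [hh]; field_simp
  have hKs : ∀ s, |s| ≤ h → |K * s| ≤ |K| * h := fun s hs => by
    rw [abs_mul]; gcongr
  rcases ht.2.eq_or_lt with rfl | htT
  -- At t = T the right neighbour would leave the grid, but T is itself a grid point.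
  · exact ⟨M, by simp, by rw [hMh]; linarith [mul_nonneg (abs_nonneg K) hp.le]⟩
  set j := ⌊t / h⌋₊ with hj
  have h1 : (j : ℝ) * h ≤ t := by
    rw [mul_comm]; exact mul_floor_le hp ht.1
  have h2 : t < ((j + 1 : ℕ) : ℝ) * h := by
    have := Nat.lt_floor_add_one (t / h)
    rw [div_lt_iff₀ hp] at this
    push_cast
    exact this
  have h2' : t < (j : ℝ) * h + h := by push_cast at h2; linarith
  have hjM : j < M := by
    have : (j : ℝ) * h < M * h := by rw [hMh]; linarith
    exact_mod_cast lt_of_mul_lt_mul_right this hp.le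
  rcases le_total 0 (V t - K * t) with hs | hs
  · refine ⟨j + 1, by simp; omega, ?_⟩
    have h3 := hV h2.le
    have h4 := hKs (((j + 1 : ℕ) : ℝ) * h - t)
      (by rw [abs_of_nonneg (by linarith)]; push_cast; linarith)
    rw [abs_of_nonneg hs]
    have h5 := le_abs_self (V (((j + 1 : ℕ) : ℝ) * h) - K * (((j + 1 : ℕ) : ℝ) * h))
    have h6 := le_abs_self (K * (((j + 1 : ℕ) : ℝ) * h - t))
    linarith
  · refine ⟨j, by simp; omega, ?_⟩
    have h3 := hV h1
    have h4 := hKs (t - j * h) (by rw [abs_of_nonneg (by linarith)]; linarith)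
    rw [abs_of_nonpos hs]
    have h5 := neg_abs_le (V (j * h) - K * (j * h))
    have h6 := le_abs_self (K * (t - j * h))
    linarith

theorem add_rpow_le_two_rpow {a b q : ℝ} (ha : 0 ≤ a) (hb : 0 ≤ b) (hq : 0 < q) :
    (a + b) ^ q ≤ 2 ^ q * (a ^ q + b ^ q) := by
  have h1 : (a + b) ^ q ≤ (2 * max a b) ^ q :=
    Real.rpow_le_rpow (by positivity) (by linarith [le_max_left a b, le_max_right a b]) hq.le
  rw [Real.mul_rpow (by norm_num) (by positivity)] at h1
  refine h1.trans ?_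
  gcongr
  have := Real.rpow_nonneg ha q
  have := Real.rpow_nonneg hb q
  rcases max_choice a b with h | h <;> rw [h] <;> linarith

/-- The uncountable supremum is dominated pointwise by a finite sum over grid times, so its
measurability is never needed. -/
theorem tendsto_lintegral_iSup_riemannAvg [IsProbabilityMeasure P] (hpos : ∀ n, 0 < δ n)
    (hA0 : ∀ n i ω, 0 ≤ A n i ω) (hAm : ∀ n i, AEMeasurable (A n i) P)
    (hmom : ∀ m : ℕ, ∃ C : ℝ, ∀ᶠ n in atTop, ∀ i, 1 ≤ i →
      ∫⁻ ω, ENNReal.ofReal (A n i ω ^ m) ∂P ≤ ENNReal.ofReal C)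
    {K : ℝ} (h : ∀ t, 0 ≤ t → Tendsto (fun n => ∫⁻ ω, ENNReal.ofReal
      |riemannAvg (δ n) t (fun i => A n i ω) - K * t| ∂P) atTop (𝓝 0))
    {q T : ℝ} (hq : 0 < q) (hT : 0 < T) :
    Tendsto (fun n => ∫⁻ ω, ⨆ t ∈ Set.Icc (0 : ℝ) T, ENNReal.ofReal
      (|riemannAvg (δ n) t (fun i => A n i ω) - K * t| ^ q) ∂P) atTop (𝓝 0) := by
  refine tendsto_zero_of_forall_le fun η hη => ?_
  -- This is the q-th power of the discretization error in `exists_grid_le`, after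
  -- `add_rpow_le_two_rpow`; M is fixed before n → ∞.
  have hlim : Tendsto (fun M : ℕ => 2 ^ q * (|K| * (T / M)) ^ q) atTop
      (𝓝 (2 ^ q * (|K| * 0) ^ q)) :=
    (((tendsto_const_div_atTop_nhds_zero_nat T).const_mul |K|).rpow_const
      (Or.inr hq.le)).const_mul _
  rw [mul_zero, Real.zero_rpow hq.ne', mul_zero] at hlim
  obtain ⟨M, hMη, hM⟩ := ((hlim.eventually (ge_mem_nhds hη)).and (eventually_gt_atTop 0)).exists
  refine ⟨fun n => ENNReal.ofReal (2 ^ q) * ∑ j ∈ Finset.range (M + 1), ∫⁻ ω, ENNReal.ofReal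
    (|riemannAvg (δ n) (j * (T / M)) (fun i => A n i ω) - K * (j * (T / M))| ^ q) ∂P, ?_, ?_⟩
  · have h1 := tendsto_finsetSum (Finset.range (M + 1)) fun j _ =>
      tendsto_lintegral_rpow_riemannAvg hpos hA0 hAm hmom (K := K) (t := j * (T / M))
        (by positivity) (h _ (by positivity)) hq
    have h2 := ENNReal.Tendsto.const_mul h1 (Or.inr (ENNReal.ofReal_ne_top (r := 2 ^ q)))
    simpa using h2
  refine Eventually.of_forall fun n => ?_
  dsimp only
  have hmeas : ∀ j : ℕ, AEMeasurable (fun ω => ENNReal.ofReal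
      (|riemannAvg (δ n) (j * (T / M)) (fun i => A n i ω) - K * (j * (T / M))| ^ q)) P := fun j =>
    (((aemeasurable_riemannAvg (δ n) _ (hAm n)).sub_const _).norm.pow_const q).ennreal_ofReal
  rw [← lintegral_finsetSum' _ fun j _ => hmeas j,
    ← lintegral_const_mul' _ _ ENNReal.ofReal_ne_top]
  calc _ ≤ ∫⁻ ω, (ENNReal.ofReal η + ENNReal.ofReal (2 ^ q) * ∑ j ∈ Finset.range (M + 1),
        ENNReal.ofReal (|riemannAvg (δ n) (j * (T / M)) (fun i => A n i ω) -
          K * (j * (T / M))| ^ q)) ∂P := by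
        refine lintegral_mono fun ω => iSup₂_le fun t ht => ?_
        obtain ⟨j, hj, hle⟩ := exists_grid_le (V := fun t => riemannAvg (δ n) t fun i => A n i ω)
          (fun s t hst => riemannAvg_mono (hpos n) hst fun i => hA0 n i ω) K hT hM ht
        have h1 : ENNReal.ofReal (|riemannAvg (δ n) (j * (T / M)) (fun i => A n i ω) -
            K * (j * (T / M))| ^ q) ≤ ∑ j ∈ Finset.range (M + 1), ENNReal.ofReal
              (|riemannAvg (δ n) (j * (T / M)) (fun i => A n i ω) - K * (j * (T / M))| ^ q) :=
          Finset.single_le_sum (f := fun j : ℕ => ENNReal.ofReal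
            (|riemannAvg (δ n) (j * (T / M)) (fun i => A n i ω) - K * (j * (T / M))| ^ q))
            (fun _ _ => zero_le) hj
        calc _ ≤ ENNReal.ofReal (η + 2 ^ q * |riemannAvg (δ n) (j * (T / M)) (fun i => A n i ω) -
              K * (j * (T / M))| ^ q) := by
              apply ENNReal.ofReal_le_ofReal
              refine (Real.rpow_le_rpow (abs_nonneg _) hle hq.le).trans ?_
              refine (add_rpow_le_two_rpow (abs_nonneg _) (by positivity) hq).trans ?_
              rw [mul_add]
              linarith
          _ ≤ _ := by
              rw [ENNReal.ofReal_add hη.le (by positivity), ENNReal.ofReal_mul (by positivity)]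
              gcongr
    _ = _ := by
        rw [lintegral_add_left measurable_const, lintegral_const, measure_univ, mul_one]

/-- Powers may be transferred through an averaged `L¹` approximation. -/
theorem tendsto_lintegral_riemannAvg_abs_pow_sub {B : ℕ → ℕ → Ω → ℝ} (hpos : ∀ n, 0 < δ n)
    (hA0 : ∀ n i ω, 0 ≤ A n i ω) (hAm : ∀ n i, AEMeasurable (A n i) P)
    (hB0 : ∀ n i ω, 0 ≤ B n i ω) (hBm : ∀ n i, AEMeasurable (B n i) P)
    (hmom : ∀ m : ℕ, ∃ C : ℝ, ∀ᶠ n in atTop, ∀ i, 1 ≤ i →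
      ∫⁻ ω, ENNReal.ofReal (A n i ω ^ m) ∂P ≤ ENNReal.ofReal C)
    (hmomB : ∀ m : ℕ, ∃ C : ℝ, ∀ᶠ n in atTop, ∀ i, 1 ≤ i →
      ∫⁻ ω, ENNReal.ofReal (B n i ω ^ m) ∂P ≤ ENNReal.ofReal C) {t : ℝ} (ht : 0 ≤ t)
    (h : Tendsto (fun n => ∫⁻ ω, ENNReal.ofReal
      (riemannAvg (δ n) t (fun i => |A n i ω - B n i ω|)) ∂P) atTop (𝓝 0)) (p : ℕ) :
    Tendsto (fun n => ∫⁻ ω, ENNReal.ofReal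
      (riemannAvg (δ n) t (fun i => |A n i ω ^ p - B n i ω ^ p|)) ∂P) atTop (𝓝 0) := by
  obtain ⟨C, hC⟩ := hmom (p + 1)
  obtain ⟨D, hD⟩ := hmomB (p + 1)
  refine tendsto_zero_of_forall_le fun η hη => ?_
  -- The truncation level makes the part above L, controlled by moments of order p + 1, at most η.
  obtain ⟨L, hL, hLη⟩ : ∃ L : ℝ, 0 < L ∧ L⁻¹ * (t * (max C 0 + max D 0)) ≤ η := by
    refine ⟨max 1 (t * (max C 0 + max D 0) / η), by positivity, ?_⟩
    rw [inv_mul_le_iff₀ (by positivity), ← div_le_iff₀ (by positivity)]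
    exact le_max_right _ _
  refine ⟨fun n => ENNReal.ofReal (p * L ^ (p - 1)) * ∫⁻ ω, ENNReal.ofReal
      (riemannAvg (δ n) t (fun i => |A n i ω - B n i ω|)) ∂P, ?_, ?_⟩
  · have := ENNReal.Tendsto.const_mul h (Or.inr (ENNReal.ofReal_ne_top (r := p * L ^ (p - 1))))
    simpa using this
  filter_upwards [hC, hD] with n hCn hDn
  have hABm : AEMeasurable (fun ω => riemannAvg (δ n) t (fun i => |A n i ω - B n i ω|)) P :=
    aemeasurable_riemannAvg _ _ fun i => ((hAm n i).sub (hBm n i)).norm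
  have hrest : ∫⁻ ω, ENNReal.ofReal (riemannAvg (δ n) t
      (fun i => A n i ω ^ (p + 1) + B n i ω ^ (p + 1))) ∂P ≤
      ENNReal.ofReal t * ENNReal.ofReal (max C 0 + max D 0) := by
    refine lintegral_riemannAvg_le (hpos n) ht
      (fun i ω => add_nonneg (pow_nonneg (hA0 n i ω) _) (pow_nonneg (hB0 n i ω) _))
      (fun i => ((hAm n i).pow_const _).add ((hBm n i).pow_const _)) fun i hi => ?_
    simp_rw [fun ω => ENNReal.ofReal_add (pow_nonneg (hA0 n i ω) (p + 1))
      (pow_nonneg (hB0 n i ω) (p + 1))]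
    rw [lintegral_add_left' ((hAm n i).pow_const _).ennreal_ofReal,
      ENNReal.ofReal_add (by positivity) (by positivity)]
    exact add_le_add ((hCn i hi).trans (ENNReal.ofReal_le_ofReal (le_max_left _ _)))
      ((hDn i hi).trans (ENNReal.ofReal_le_ofReal (le_max_left _ _)))
  calc _ ≤ ∫⁻ ω, (ENNReal.ofReal (p * L ^ (p - 1)) * ENNReal.ofReal
        (riemannAvg (δ n) t (fun i => |A n i ω - B n i ω|)) + ENNReal.ofReal L⁻¹ *
        ENNReal.ofReal (riemannAvg (δ n) t
          (fun i => A n i ω ^ (p + 1) + B n i ω ^ (p + 1)))) ∂P := by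
        refine lintegral_mono fun ω => ?_
        have h1 : 0 ≤ riemannAvg (δ n) t (fun i => |A n i ω - B n i ω|) :=
          riemannAvg_nonneg (hpos n) fun i => abs_nonneg _
        have h2 : 0 ≤ riemannAvg (δ n) t (fun i => A n i ω ^ (p + 1) + B n i ω ^ (p + 1)) :=
          riemannAvg_nonneg (hpos n) fun i =>
            add_nonneg (pow_nonneg (hA0 n i ω) _) (pow_nonneg (hB0 n i ω) _)
        rw [← ENNReal.ofReal_mul (by positivity), ← ENNReal.ofReal_mul (by positivity),
          ← ENNReal.ofReal_add (by positivity) (by positivity)]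
        apply ENNReal.ofReal_le_ofReal
        unfold riemannAvg
        rw [mul_left_comm, mul_left_comm L⁻¹, ← mul_add, Finset.mul_sum _ _ L⁻¹,
          Finset.mul_sum _ _ (p * L ^ (p - 1)), ← Finset.sum_add_distrib]
        have := (hpos n).le
        gcongr with i hi
        exact abs_pow_sub_pow_le_add (hA0 n i ω) (hB0 n i ω) hL p
    _ ≤ ENNReal.ofReal (p * L ^ (p - 1)) * ∫⁻ ω, ENNReal.ofReal
        (riemannAvg (δ n) t (fun i => |A n i ω - B n i ω|)) ∂P + ENNReal.ofReal L⁻¹ *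
        (ENNReal.ofReal t * ENNReal.ofReal (max C 0 + max D 0)) := by
        rw [lintegral_add_left' (hABm.ennreal_ofReal.const_mul _),
          lintegral_const_mul' _ _ ENNReal.ofReal_ne_top,
          lintegral_const_mul' _ _ ENNReal.ofReal_ne_top]
        gcongr
    _ ≤ _ := by
        rw [add_comm]
        gcongr
        rw [← ENNReal.ofReal_mul ht, ← ENNReal.ofReal_mul (by positivity)]
        exact ENNReal.ofReal_le_ofReal hLη

theorem abs_riemannAvg_sub_le {δ t : ℝ} (hδ : 0 < δ) (a b : ℕ → ℝ) :
    |riemannAvg δ t a - riemannAvg δ t b| ≤ riemannAvg δ t fun i => |a i - b i| := by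
  unfold riemannAvg
  rw [← mul_sub, ← Finset.sum_sub_distrib, abs_mul, abs_of_pos hδ]
  gcongr
  exact Finset.abs_sum_le_sum_abs _ _

/-- If `A` is close to `B` on average and the averages of `B` converge in `L¹`, so do those
of `A`. -/
theorem tendsto_lintegral_abs_riemannAvg_sub {B : ℕ → ℕ → Ω → ℝ} (hpos : ∀ n, 0 < δ n)
    (hAm : ∀ n i, AEMeasurable (A n i) P) (hBm : ∀ n i, AEMeasurable (B n i) P) {t c : ℝ}
    (h : Tendsto (fun n => ∫⁻ ω, ENNReal.ofReal
      (riemannAvg (δ n) t (fun i => |A n i ω - B n i ω|)) ∂P) atTop (𝓝 0))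
    (hB : Tendsto (fun n => ∫⁻ ω, ENNReal.ofReal
      |riemannAvg (δ n) t (fun i => B n i ω) - c| ∂P) atTop (𝓝 0)) :
    Tendsto (fun n => ∫⁻ ω, ENNReal.ofReal
      |riemannAvg (δ n) t (fun i => A n i ω) - c| ∂P) atTop (𝓝 0) := by
  have h2 := h.add hB
  rw [add_zero] at h2
  refine tendsto_of_tendsto_of_tendsto_of_le_of_le tendsto_const_nhds h2 (fun _ => zero_le)
    fun n => ?_
  have hm : AEMeasurable (fun ω => ENNReal.ofReal
      (riemannAvg (δ n) t (fun i => |A n i ω - B n i ω|))) P :=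
    (aemeasurable_riemannAvg _ _ fun i => ((hAm n i).sub (hBm n i)).norm).ennreal_ofReal
  dsimp only
  rw [← lintegral_add_left' hm]
  refine lintegral_mono fun ω => ?_
  rw [← ENNReal.ofReal_add (riemannAvg_nonneg (hpos n) fun i => abs_nonneg _) (abs_nonneg _)]
  apply ENNReal.ofReal_le_ofReal
  refine (abs_sub_le _ (riemannAvg (δ n) t fun i => B n i ω) _).trans ?_
  gcongr
  exact abs_riemannAvg_sub_le (hpos n) _ _

end Averages

end HeatPV

namespace HeatPV

/-! ### Weighted sums of squares of an isonormal process -/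

/-- The random series `∑ₖ wₖ W(dₖ)²`. -/
noncomputable def quadForm {Ω : Type*} (W : Lp ℝ 2 spaceTimeMeasure → Ω → ℝ) (w : ℕ → ℝ)
    (d : ℕ → Lp ℝ 2 spaceTimeMeasure) (ω : Ω) : ℝ := ∑' k, w k * W (d k) ω ^ 2

theorem gaussianMoment_one : gaussianMoment 1 = 1 := by
  have := gaussianMoment_succ 0
  simpa [gaussianMoment_zero] using this

theorem gaussianMoment_two : gaussianMoment 2 = 3 := by
  have := gaussianMoment_succ 1
  rw [gaussianMoment_one] at this
  rw [this]; norm_num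

section Quad

variable {Ω : Type*} [MeasurableSpace Ω] {P : Measure Ω}
  {W : Lp ℝ 2 spaceTimeMeasure → Ω → ℝ} {w : ℕ → ℝ} {d e : ℕ → Lp ℝ 2 spaceTimeMeasure}

theorem quadForm_nonneg {Ω : Type*} {W : Lp ℝ 2 spaceTimeMeasure → Ω → ℝ}
    (hw : ∀ k, 0 ≤ w k) (ω : Ω) : 0 ≤ quadForm W w d ω :=
  tsum_nonneg fun k => mul_nonneg (hw k) (sq_nonneg _)

theorem IsWhiteNoise.lintegral_mul_sq (hW : IsWhiteNoise W P) (hw : ∀ k, 0 ≤ w k) (k : ℕ) :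
    ∫⁻ ω, ENNReal.ofReal (w k * W (d k) ω ^ 2) ∂P = ENNReal.ofReal (w k * ‖d k‖ ^ 2) := by
  simp_rw [ENNReal.ofReal_mul (hw k)]
  rw [lintegral_const_mul' _ _ ENNReal.ofReal_ne_top, hW.lintegral_sq]

theorem IsWhiteNoise.aemeasurable_mul_sq (hW : IsWhiteNoise W P) (k : ℕ) :
    AEMeasurable (fun ω => w k * W (d k) ω ^ 2) P :=
  ((hW.aemeasurable _).pow_const 2).const_mul _

theorem IsWhiteNoise.lintegral_tsum (hW : IsWhiteNoise W P) (hw : ∀ k, 0 ≤ w k)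
    (hs : Summable fun k => w k * ‖d k‖ ^ 2) :
    ∫⁻ ω, ∑' k, ENNReal.ofReal (w k * W (d k) ω ^ 2) ∂P =
      ENNReal.ofReal (∑' k, w k * ‖d k‖ ^ 2) := by
  rw [MeasureTheory.lintegral_tsum fun k => (hW.aemeasurable_mul_sq k).ennreal_ofReal,
    ENNReal.ofReal_tsum_of_nonneg (fun k => mul_nonneg (hw k) (sq_nonneg _)) hs]
  simp_rw [hW.lintegral_mul_sq hw]

theorem IsWhiteNoise.ae_summable (hW : IsWhiteNoise W P) (hw : ∀ k, 0 ≤ w k)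
    (hs : Summable fun k => w k * ‖d k‖ ^ 2) :
    ∀ᵐ ω ∂P, Summable fun k => w k * W (d k) ω ^ 2 := by
  have h := ae_lt_top' (AEMeasurable.tsum fun k =>
    (hW.aemeasurable_mul_sq (w := w) (d := d) k).ennreal_ofReal)
    ((hW.lintegral_tsum hw hs).trans_ne ENNReal.ofReal_ne_top)
  filter_upwards [h] with ω hω
  have := ENNReal.summable_toReal hω.ne
  simpa only [ENNReal.toReal_ofReal (mul_nonneg (hw _) (sq_nonneg _))] using this

theorem IsWhiteNoise.aemeasurable_quadForm (hW : IsWhiteNoise W P) (hw : ∀ k, 0 ≤ w k)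
    (hs : Summable fun k => w k * ‖d k‖ ^ 2) : AEMeasurable (quadForm W w d) P :=
  aemeasurable_of_tendsto_metrizable_ae atTop
    (fun N => Finset.aemeasurable_fun_sum (Finset.range N) fun k _ => hW.aemeasurable_mul_sq k)
    ((hW.ae_summable hw hs).mono fun _ hω => hω.hasSum.tendsto_sum_nat)

/-- Minkowski's inequality in L^m, term by term; neither orthogonality nor independence is used. -/
theorem IsWhiteNoise.lintegral_sum_pow_le (hW : IsWhiteNoise W P) (hw : ∀ k, 0 ≤ w k) {m : ℕ}
    (hm : 1 ≤ m) (N : ℕ) :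
    (∫⁻ ω, ENNReal.ofReal (∑ k ∈ Finset.range N, w k * W (d k) ω ^ 2) ^ (m : ℝ) ∂P) ^ (1 / (m : ℝ))
      ≤ ENNReal.ofReal ((∑ k ∈ Finset.range N, w k * ‖d k‖ ^ 2) *
        gaussianMoment m ^ (1 / (m : ℝ))) := by
  have hm' : (1 : ℝ) ≤ m := by exact_mod_cast hm
  have hm0 : (0 : ℝ) < m := by linarith
  induction N with
  | zero => simp [hm0, show m ≠ 0 by omega]
  | succ N ih =>
    have hterm : (∫⁻ ω, ENNReal.ofReal (w N * W (d N) ω ^ 2) ^ (m : ℝ) ∂P) ^ (1 / (m : ℝ)) =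
        ENNReal.ofReal (w N * ‖d N‖ ^ 2 * gaussianMoment m ^ (1 / (m : ℝ))) := by
      simp_rw [ENNReal.ofReal_mul (hw N), ENNReal.rpow_natCast, mul_pow]
      rw [lintegral_const_mul' _ _ (ENNReal.pow_ne_top ENNReal.ofReal_ne_top), hW.lintegral_pow,
        ← ENNReal.ofReal_pow (hw N), ← ENNReal.ofReal_mul (pow_nonneg (hw N) _), ← mul_assoc,
        ← mul_pow, ENNReal.ofReal_rpow_of_nonneg (mul_nonneg (pow_nonneg
          (mul_nonneg (hw N) (sq_nonneg _)) _) (gaussianMoment_nonneg m)) (by positivity),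
        Real.mul_rpow (pow_nonneg (mul_nonneg (hw N) (sq_nonneg _)) _) (gaussianMoment_nonneg m),
        one_div, Real.pow_rpow_inv_natCast (mul_nonneg (hw N) (sq_nonneg _)) (by omega)]
    have hnn : ∀ ω, 0 ≤ ∑ k ∈ Finset.range N, w k * W (d k) ω ^ 2 := fun ω =>
      Finset.sum_nonneg fun k _ => mul_nonneg (hw k) (sq_nonneg _)
    have hadd := ENNReal.lintegral_Lp_add_le (μ := P)
      (f := fun ω => ENNReal.ofReal (∑ k ∈ Finset.range N, w k * W (d k) ω ^ 2))
      (g := fun ω => ENNReal.ofReal (w N * W (d N) ω ^ 2))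
      (Finset.aemeasurable_fun_sum (Finset.range N)
        fun k _ => hW.aemeasurable_mul_sq k).ennreal_ofReal
      (hW.aemeasurable_mul_sq N).ennreal_ofReal hm'
    rw [hterm] at hadd
    simp only [Pi.add_apply] at hadd
    simp_rw [Finset.sum_range_succ, ENNReal.ofReal_add (hnn _)
      (mul_nonneg (hw N) (sq_nonneg (W (d N) _)))]
    refine hadd.trans ((add_le_add_left ih _).trans_eq ?_)
    rw [← ENNReal.ofReal_add]
    · congr 1
      ring
    · exact mul_nonneg (Finset.sum_nonneg fun k _ => mul_nonneg (hw k) (sq_nonneg _))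
        (Real.rpow_nonneg (gaussianMoment_nonneg m) _)
    · exact mul_nonneg (mul_nonneg (hw N) (sq_nonneg _))
        (Real.rpow_nonneg (gaussianMoment_nonneg m) _)

/-- Every moment is bounded through the mean alone, which makes the moment bounds uniform in the
time step and, eventually, in the mesh. -/
theorem IsWhiteNoise.lintegral_quadForm_pow_le [IsProbabilityMeasure P] (hW : IsWhiteNoise W P)
    (hw : ∀ k, 0 ≤ w k) (hs : Summable fun k => w k * ‖d k‖ ^ 2) (m : ℕ) :
    ∫⁻ ω, ENNReal.ofReal (quadForm W w d ω ^ m) ∂P ≤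
      ENNReal.ofReal ((∑' k, w k * ‖d k‖ ^ 2) ^ m * gaussianMoment m) := by
  rcases Nat.eq_zero_or_pos m with rfl | hm
  · simp [gaussianMoment_zero]
  have hm0 : (0 : ℝ) < m := by exact_mod_cast hm
  have hnn : ∀ k ω, 0 ≤ w k * W (d k) ω ^ 2 := fun k ω => mul_nonneg (hw k) (sq_nonneg _)
  have hlim : Tendsto (fun N => ∫⁻ ω, ENNReal.ofReal
      (∑ k ∈ Finset.range N, w k * W (d k) ω ^ 2) ^ (m : ℝ) ∂P) atTop
      (𝓝 (∫⁻ ω, ENNReal.ofReal (quadForm W w d ω) ^ (m : ℝ) ∂P)) := by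
    refine lintegral_tendsto_of_tendsto_of_monotone (fun N => ?_) ?_ ?_
    · exact ((Finset.aemeasurable_fun_sum (Finset.range N)
        fun k _ => hW.aemeasurable_mul_sq k).ennreal_ofReal).pow_const _
    · refine Eventually.of_forall fun ω N M hNM => ?_
      dsimp only
      gcongr
      exact fun k _ _ => hnn k ω
    · filter_upwards [hW.ae_summable hw hs] with ω hω
      exact ((ENNReal.continuous_rpow_const.comp ENNReal.continuous_ofReal).tendsto _).comp
        hω.hasSum.tendsto_sum_nat
  have hle : ∀ N, ∫⁻ ω, ENNReal.ofReal (∑ k ∈ Finset.range N, w k * W (d k) ω ^ 2) ^ (m : ℝ) ∂P ≤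
      ENNReal.ofReal ((∑' k, w k * ‖d k‖ ^ 2) ^ m * gaussianMoment m) := by
    intro N
    have h1 := (hW.lintegral_sum_pow_le (d := d) hw hm N).trans (ENNReal.ofReal_le_ofReal
      (mul_le_mul_of_nonneg_right (hs.sum_le_tsum (Finset.range N)
        fun k _ => mul_nonneg (hw k) (sq_nonneg _)) (Real.rpow_nonneg (gaussianMoment_nonneg m) _)))
    rw [one_div, ENNReal.rpow_inv_le_iff hm0, ENNReal.rpow_natCast, ← ENNReal.ofReal_pow
      (mul_nonneg (tsum_nonneg fun k => mul_nonneg (hw k) (sq_nonneg _))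
        (Real.rpow_nonneg (gaussianMoment_nonneg m) _)), mul_pow,
      Real.rpow_inv_natCast_pow (gaussianMoment_nonneg m) (by omega)] at h1
    exact h1
  have := le_of_tendsto' hlim hle
  simp_rw [ENNReal.rpow_natCast] at this
  simpa only [ENNReal.ofReal_pow (quadForm_nonneg hw _)] using this

theorem IsWhiteNoise.variance_mul_sq (hW : IsWhiteNoise W P) (k : ℕ) :
    Var[fun ω => w k * W (d k) ω ^ 2; P] = 2 * (w k * ‖d k‖ ^ 2) ^ 2 := by
  have := hW.gaussian.isProbabilityMeasure
  have hm : MemLp (fun ω => W (d k) ω ^ 2) 2 P := by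
    rw [memLp_two_iff_integrable_sq ((hW.aemeasurable _).pow_const 2).aestronglyMeasurable]
    simpa only [← pow_mul] using hW.integrable_pow (d k) (2 * 2)
  rw [variance_const_mul, variance_eq_sub hm, hW.integral_sq]
  have h2 := hW.integral_pow (d k) 2
  rw [gaussianMoment_two] at h2
  have h3 : ∫ ω, ((fun ω => W (d k) ω ^ 2) ^ 2) ω ∂P = ∫ ω, W (d k) ω ^ (2 * 2) ∂P :=
    integral_congr_ae (Eventually.of_forall fun ω => by simp [← pow_mul])
  rw [h3, h2]
  ring

theorem lintegral_abs_sub_integral_le [IsProbabilityMeasure P] {Y : Ω → ℝ} (hY : MemLp Y 2 P) :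
    ∫⁻ ω, ENNReal.ofReal |Y ω - ∫ ω, Y ω ∂P| ∂P ≤ ENNReal.ofReal (Real.sqrt Var[Y; P]) := by
  set Z : Ω → ℝ := fun ω => |Y ω - ∫ ω, Y ω ∂P| with hZ
  have hZm : MemLp Z 2 P := (hY.sub (memLp_const _)).norm
  have hZ2 : (∫ ω, Z ω ∂P) ^ 2 ≤ Var[Y; P] := by
    have h1 := variance_nonneg Z P
    rw [variance_eq_sub hZm] at h1
    have h2 : ∫ ω, (Z ^ 2) ω ∂P = Var[Y; P] := by
      rw [variance_eq_integral hY.1.aemeasurable]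
      exact integral_congr_ae (Eventually.of_forall fun ω => by simp [hZ])
    linarith
  have h3 : ∫⁻ ω, ENNReal.ofReal (Z ω) ∂P = ENNReal.ofReal (∫ ω, Z ω ∂P) :=
    (ofReal_integral_eq_lintegral_ofReal (hZm.integrable (by norm_num))
      (Eventually.of_forall fun ω => abs_nonneg _)).symm
  rw [h3]
  exact ENNReal.ofReal_le_ofReal (Real.le_sqrt_of_sq_le hZ2)

theorem IsWhiteNoise.lintegral_abs_sum_sub_le (hW : IsWhiteNoise W P)
    (horth : ∀ i j, i ≠ j → inner ℝ (d i) (d j) = (0 : ℝ)) (N : ℕ) :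
    ∫⁻ ω, ENNReal.ofReal |∑ k ∈ Finset.range N, w k * W (d k) ω ^ 2 -
      ∑ k ∈ Finset.range N, w k * ‖d k‖ ^ 2| ∂P ≤
      ENNReal.ofReal (Real.sqrt (2 * ∑ k ∈ Finset.range N, (w k * ‖d k‖ ^ 2) ^ 2)) := by
  have hP := hW.gaussian.isProbabilityMeasure
  set X : ℕ → Ω → ℝ := fun k ω => w k * W (d k) ω ^ 2 with hX
  have hmem : ∀ k, MemLp (X k) 2 P := by
    intro k
    rw [memLp_two_iff_integrable_sq (hW.aemeasurable_mul_sq k).aestronglyMeasurable]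
    simp only [mul_pow, ← pow_mul]
    exact (hW.integrable_pow (d k) (2 * 2)).const_mul _
  have hind := hW.iIndepFun_of_orthogonal d horth
  have hvar : Var[∑ k ∈ Finset.range N, X k; P] =
      2 * ∑ k ∈ Finset.range N, (w k * ‖d k‖ ^ 2) ^ 2 := by
    rw [IndepFun.variance_sum (fun k _ => hmem k), Finset.mul_sum]
    · exact Finset.sum_congr rfl fun k _ => hW.variance_mul_sq k
    · intro i _ j _ hij
      exact (hind.indepFun hij).comp (φ := fun x => w i * x ^ 2) (ψ := fun x => w j * x ^ 2)
        (by fun_prop) (by fun_prop)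
  set Y : Ω → ℝ := ∑ k ∈ Finset.range N, X k with hY
  have hYm : MemLp Y 2 P := memLp_finsetSum' _ fun k _ => hmem k
  have hYint : ∫ ω, Y ω ∂P = ∑ k ∈ Finset.range N, w k * ‖d k‖ ^ 2 := by
    simp only [hY, Finset.sum_apply]
    rw [integral_finsetSum _ fun k _ => (hmem k).integrable (by norm_num)]
    refine Finset.sum_congr rfl fun k _ => ?_
    rw [integral_const_mul, hW.integral_sq]
  have h := lintegral_abs_sub_integral_le hYm
  rw [hYint, hvar] at h
  simpa only [hY, Finset.sum_apply, hX] using h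

/-- The variance of the partial sums is 2∑a_k² ≤ 2B∑a_k with a_k = w_k‖d_k‖², so the sum
concentrates when its largest term is negligible. Fatou carries the bound from partial sums to the
series. -/
theorem IsWhiteNoise.lintegral_abs_quadForm_sub_le (hW : IsWhiteNoise W P) (hw : ∀ k, 0 ≤ w k)
    (horth : ∀ i j, i ≠ j → inner ℝ (d i) (d j) = (0 : ℝ))
    (hs : Summable fun k => w k * ‖d k‖ ^ 2) {B : ℝ} (hB : ∀ k, w k * ‖d k‖ ^ 2 ≤ B) :
    ∫⁻ ω, ENNReal.ofReal |quadForm W w d ω - ∑' k, w k * ‖d k‖ ^ 2| ∂P ≤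
      ENNReal.ofReal (Real.sqrt (2 * (B * ∑' k, w k * ‖d k‖ ^ 2))) := by
  have ha : ∀ k, 0 ≤ w k * ‖d k‖ ^ 2 := fun k => mul_nonneg (hw k) (sq_nonneg _)
  set F : ℕ → Ω → ENNReal := fun N ω => ENNReal.ofReal |∑ k ∈ Finset.range N, w k * W (d k) ω ^ 2 -
      ∑ k ∈ Finset.range N, w k * ‖d k‖ ^ 2| with hF
  have hFm : ∀ N, AEMeasurable (F N) P := fun N =>
    ((Finset.aemeasurable_fun_sum (Finset.range N) fun k _ =>
      hW.aemeasurable_mul_sq k).sub_const _).norm.ennreal_ofReal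
  have hlim : ∀ᵐ ω ∂P, Tendsto (fun N => F N ω) atTop
      (𝓝 (ENNReal.ofReal |quadForm W w d ω - ∑' k, w k * ‖d k‖ ^ 2|)) := by
    filter_upwards [hW.ae_summable hw hs] with ω hω
    exact ENNReal.tendsto_ofReal
      ((hω.hasSum.tendsto_sum_nat.sub hs.hasSum.tendsto_sum_nat).abs)
  calc _ = ∫⁻ ω, liminf (fun N => F N ω) atTop ∂P := by
        refine lintegral_congr_ae ?_
        filter_upwards [hlim] with ω hω
        exact hω.liminf_eq.symm
    _ ≤ liminf (fun N => ∫⁻ ω, F N ω ∂P) atTop := lintegral_liminf_le' hFm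
    _ ≤ liminf (fun _ : ℕ => ENNReal.ofReal (Real.sqrt (2 * (B * ∑' k, w k * ‖d k‖ ^ 2)))) atTop :=
        by
        refine liminf_le_liminf (Eventually.of_forall fun N => ?_)
        refine (hW.lintegral_abs_sum_sub_le horth N).trans (ENNReal.ofReal_le_ofReal ?_)
        apply Real.sqrt_le_sqrt
        gcongr
        calc ∑ k ∈ Finset.range N, (w k * ‖d k‖ ^ 2) ^ 2
            ≤ ∑ k ∈ Finset.range N, B * (w k * ‖d k‖ ^ 2) := by
              refine Finset.sum_le_sum fun k _ => ?_
              rw [sq]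
              exact mul_le_mul_of_nonneg_right (hB k) (ha k)
          _ ≤ _ := by
              rw [← Finset.mul_sum]
              have hB0 : 0 ≤ B := (ha 0).trans (hB 0)
              gcongr
              exact hs.sum_le_tsum _ fun k _ => ha k
    _ = _ := liminf_const _

/-- Young's inequality applied to the cross term of a² - b² = (a - b)² + 2(a - b)b. -/
theorem abs_sq_sub_sq_le (a b : ℝ) {ε : ℝ} (hε : 0 < ε) :
    |a ^ 2 - b ^ 2| ≤ (1 + ε⁻¹) * (a - b) ^ 2 + ε * b ^ 2 := by
  have h1 : (1 + ε⁻¹) * (a - b) ^ 2 + ε * b ^ 2 - ((a - b) ^ 2 + 2 * ((a - b) * b)) =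
      ε⁻¹ * ((a - b) - ε * b) ^ 2 := by
    field_simp
    ring
  have h2 : (1 + ε⁻¹) * (a - b) ^ 2 + ε * b ^ 2 - ((a - b) ^ 2 - 2 * ((a - b) * b)) =
      ε⁻¹ * ((a - b) + ε * b) ^ 2 := by
    field_simp
    ring
  have h3 : 0 ≤ ε⁻¹ * ((a - b) - ε * b) ^ 2 := by positivity
  have h4 : 0 ≤ ε⁻¹ * ((a - b) + ε * b) ^ 2 := by positivity
  rw [abs_le]
  constructor <;> nlinarith [sq_nonneg (a - b)]

theorem IsWhiteNoise.lintegral_abs_quadForm_sub_quadForm_le (hW : IsWhiteNoise W P)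
    (hw : ∀ k, 0 ≤ w k) (hd : Summable fun k => w k * ‖d k‖ ^ 2)
    (he : Summable fun k => w k * ‖e k‖ ^ 2) (hde : Summable fun k => w k * ‖d k - e k‖ ^ 2)
    {ε : ℝ} (hε : 0 < ε) :
    ∫⁻ ω, ENNReal.ofReal |quadForm W w d ω - quadForm W w e ω| ∂P ≤
      ENNReal.ofReal ((1 + ε⁻¹) * ∑' k, w k * ‖d k - e k‖ ^ 2 + ε * ∑' k, w k * ‖e k‖ ^ 2) := by
  have h1 : ∀ᵐ ω ∂P, ENNReal.ofReal |quadForm W w d ω - quadForm W w e ω| ≤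
      ENNReal.ofReal (1 + ε⁻¹) * (∑' k, ENNReal.ofReal (w k * W (d k - e k) ω ^ 2)) +
        ENNReal.ofReal ε * ∑' k, ENNReal.ofReal (w k * W (e k) ω ^ 2) := by
    filter_upwards [hW.ae_summable hw hd, hW.ae_summable hw he,
      hW.ae_summable (d := fun k => d k - e k) hw hde,
      ae_all_iff.2 fun k => hW.map_sub (d k) (e k)] with ω s1 s2 s3 hsub
    have nn : ∀ (f : ℕ → Lp ℝ 2 spaceTimeMeasure) (k : ℕ), 0 ≤ w k * W (f k) ω ^ 2 := fun f k =>
      mul_nonneg (hw k) (sq_nonneg _)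
    rw [← ENNReal.ofReal_tsum_of_nonneg (nn fun k => d k - e k) s3,
      ← ENNReal.ofReal_tsum_of_nonneg (nn e) s2, ← ENNReal.ofReal_mul (by positivity),
      ← ENNReal.ofReal_mul hε.le, ← ENNReal.ofReal_add
        (mul_nonneg (by positivity) (tsum_nonneg (nn fun k => d k - e k)))
        (mul_nonneg hε.le (tsum_nonneg (nn e))), ← tsum_mul_left, ← tsum_mul_left,
      ← (s3.mul_left _).tsum_add (s2.mul_left _)]
    apply ENNReal.ofReal_le_ofReal
    unfold quadForm
    rw [← s1.tsum_sub s2, ← Real.norm_eq_abs]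
    refine tsum_of_norm_bounded ((s3.mul_left (1 + ε⁻¹)).add (s2.mul_left ε)).hasSum fun k => ?_
    rw [← mul_sub, norm_mul, Real.norm_of_nonneg (hw k), Real.norm_eq_abs, hsub k, Pi.sub_apply]
    calc _ ≤ w k * ((1 + ε⁻¹) * (W (d k) ω - W (e k) ω) ^ 2 + ε * W (e k) ω ^ 2) :=
          mul_le_mul_of_nonneg_left (abs_sq_sub_sq_le _ _ hε) (hw k)
      _ = _ := by ring
  have hm : AEMeasurable (fun ω => ∑' k, ENNReal.ofReal (w k * W (d k - e k) ω ^ 2)) P :=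
    AEMeasurable.tsum fun k =>
      (hW.aemeasurable_mul_sq (w := w) (d := fun k => d k - e k) k).ennreal_ofReal
  refine (lintegral_mono_ae h1).trans_eq ?_
  have nn : ∀ (f : ℕ → Lp ℝ 2 spaceTimeMeasure), 0 ≤ ∑' k, w k * ‖f k‖ ^ 2 := fun f =>
    tsum_nonneg fun k => mul_nonneg (hw k) (sq_nonneg _)
  rw [lintegral_add_left' (hm.const_mul _), lintegral_const_mul' _ _ ENNReal.ofReal_ne_top,
    lintegral_const_mul' _ _ ENNReal.ofReal_ne_top, hW.lintegral_tsum hw he,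
    hW.lintegral_tsum (d := fun k => d k - e k) hw hde, ← ENNReal.ofReal_mul (by positivity),
    ← ENNReal.ofReal_mul hε.le, ← ENNReal.ofReal_add
      (mul_nonneg (by positivity) (nn fun k => d k - e k)) (mul_nonneg hε.le (nn e))]

end Quad

end HeatPV

namespace HeatPV

/-! ### Asymptotics of the mean energy of an increment -/

/-- The stationary bound `(1 - exp(-λₖδ)) / λₖ` for the variance of an increment over a time
interval of length `δ` of the `k`-th coefficient. -/
noncomputable def incrVar (k : ℕ) (δ : ℝ) : ℝ :=
  (1 - Real.exp (-(eigenvalue k * δ))) / eigenvalue k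

/-- The `H_r`-energy of a stationary increment over a time interval of length `δ`. -/
noncomputable def energy (r δ : ℝ) : ℝ := ∑' k, eigenvalue k ^ r * incrVar k δ

theorem incrVar_nonneg (k : ℕ) {δ : ℝ} (hδ : 0 ≤ δ) : 0 ≤ incrVar k δ := by
  have h := eigenvalue_pos k
  refine div_nonneg (sub_nonneg.2 (Real.exp_le_one_iff.2 ?_)) h.le
  nlinarith

theorem incrVar_le_inv (k : ℕ) (δ : ℝ) : incrVar k δ ≤ (eigenvalue k)⁻¹ := by
  rw [incrVar, div_eq_mul_inv]
  have h := inv_pos.2 (eigenvalue_pos k)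
  have := Real.exp_pos (-(eigenvalue k * δ))
  nlinarith

theorem incrVar_le (k : ℕ) (δ : ℝ) : incrVar k δ ≤ δ := by
  rw [incrVar, div_le_iff₀ (eigenvalue_pos k)]
  have := Real.one_sub_le_exp_neg (eigenvalue k * δ)
  linarith

/-- From e^{-x} ≤ 1/(1+x) ≤ 1 - x + x² with x = λ_kδ. -/
theorem le_incrVar (k : ℕ) {δ : ℝ} (hδ : 0 ≤ δ) : δ - eigenvalue k * δ ^ 2 ≤ incrVar k δ := by
  have hl := eigenvalue_pos k
  rw [incrVar, le_div_iff₀ hl]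
  set x := eigenvalue k * δ with hx
  have hx0 : 0 ≤ x := by positivity
  have h1 : Real.exp (-x) * (1 + x) ≤ 1 := by
    have := Real.add_one_le_exp x
    calc Real.exp (-x) * (1 + x) ≤ Real.exp (-x) * Real.exp x := by
          gcongr
          linarith
      _ = 1 := by rw [← Real.exp_add]; simp
  have h2 : Real.exp (-x) ≤ 1 - x + x ^ 2 := by
    nlinarith [Real.exp_pos (-x), pow_nonneg hx0 3]
  have e : (δ - eigenvalue k * δ ^ 2) * eigenvalue k = x - x ^ 2 := by rw [hx]; ring
  rw [e]
  linarith

theorem eigenvalue_rpow_pos (r : ℝ) (k : ℕ) : 0 < eigenvalue k ^ r :=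
  Real.rpow_pos_of_pos (eigenvalue_pos k) r

theorem mul_incrVar_le (r : ℝ) (k : ℕ) (δ : ℝ) :
    eigenvalue k ^ r * incrVar k δ ≤ eigenvalue k ^ (r - 1) := by
  rw [Real.rpow_sub_one (eigenvalue_pos k).ne', div_eq_mul_inv]
  exact mul_le_mul_of_nonneg_left (incrVar_le_inv k δ) (eigenvalue_rpow_pos r k).le

/-- The condition r < 1/2 is exactly the summability of λ_k^{r-1}. -/
theorem summable_energy {r δ : ℝ} (hr : r < 1 / 2) (hδ : 0 ≤ δ) :
    Summable fun k => eigenvalue k ^ r * incrVar k δ :=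
  Summable.of_nonneg_of_le
    (fun k => mul_nonneg (eigenvalue_rpow_pos r k).le (incrVar_nonneg k hδ))
    (fun k => mul_incrVar_le r k δ) (summable_eigenvalue_rpow (by linarith))

theorem energy_nonneg (r : ℝ) {δ : ℝ} (hδ : 0 ≤ δ) : 0 ≤ energy r δ :=
  tsum_nonneg fun k => mul_nonneg (eigenvalue_rpow_pos r k).le (incrVar_nonneg k hδ)

theorem tau_sq_of_lt {r δ : ℝ} (hr : r < -1 / 2) (hδ : 0 < δ) : tau r δ ^ 2 = δ := by
  rw [tau, if_pos hr, ← Real.sqrt_eq_rpow, Real.sq_sqrt hδ.le]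

theorem tau_sq_of_eq {δ : ℝ} (hδ : 0 < δ) : tau (-1 / 2) δ ^ 2 = δ * |Real.log δ| := by
  rw [tau, if_neg (lt_irrefl _), if_pos rfl, ← Real.sqrt_eq_rpow, Real.sq_sqrt (by positivity)]

theorem tau_sq_of_gt {r δ : ℝ} (hr : -1 / 2 < r) (hδ : 0 < δ) :
    tau r δ ^ 2 = δ ^ (1 / 2 - r) := by
  rw [tau, if_neg hr.not_gt, if_neg hr.ne', ← Real.rpow_natCast, ← Real.rpow_mul hδ.le]
  congr 1
  push_cast
  ring

theorem tau_pos (r : ℝ) {δ : ℝ} (hδ : 0 < δ) (hδ1 : δ < 1) : 0 < tau r δ := by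
  have : 0 < |Real.log δ| := abs_pos.2 (Real.log_neg hδ hδ1).ne
  unfold tau
  split_ifs <;> positivity

/-- The threshold 1/4 keeps log δ negative and makes δ^{-1/2} > 2, as `energy_neg_half_bounds`
requires. -/
theorem eventually_small : ∀ᶠ δ : ℝ in 𝓝[>] 0, 0 < δ ∧ δ < 1 / 4 := by
  filter_upwards [Ioo_mem_nhdsGT (show (0 : ℝ) < 1 / 4 by norm_num)] with δ hδ
  exact hδ

/-! ### Energy limit for r < -1/2 -/

theorem tendsto_incrVar_div (k : ℕ) :
    Tendsto (fun δ => incrVar k δ / δ) (𝓝[>] 0) (𝓝 1) := by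
  have hl := (eigenvalue_pos k).ne'
  have h1 : HasDerivAt (fun δ : ℝ => incrVar k δ) 1 0 := by
    have h2 : HasDerivAt (fun δ : ℝ => -(eigenvalue k * δ)) (-eigenvalue k) 0 := by
      simpa using! ((hasDerivAt_id (0 : ℝ)).const_mul (eigenvalue k)).neg
    have h3 := ((h2.exp).const_sub 1).div_const (eigenvalue k)
    refine h3.congr_deriv ?_
    simp [hl]
  have h4 := (hasDerivAt_iff_tendsto_slope_zero.1 h1).mono_left
    (nhdsWithin_mono 0 (fun x (hx : (0 : ℝ) < x) => hx.ne'))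
  refine h4.congr fun δ => ?_
  simp [incrVar, div_eq_inv_mul]

theorem tendsto_energy_of_lt {r : ℝ} (hr : r < -1 / 2) :
    Tendsto (fun δ => energy r δ / tau r δ ^ 2) (𝓝[>] 0) (𝓝 (∑' k, eigenvalue k ^ r)) := by
  have h : Tendsto (fun δ => ∑' k, eigenvalue k ^ r * (incrVar k δ / δ)) (𝓝[>] 0)
      (𝓝 (∑' k, eigenvalue k ^ r)) := by
    refine tendsto_tsum_of_dominated_convergence (summable_eigenvalue_rpow hr) (fun k => ?_) ?_
    · simpa using (tendsto_incrVar_div k).const_mul (eigenvalue k ^ r)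
    · filter_upwards [eventually_small] with δ hδ k
      rw [Real.norm_of_nonneg (mul_nonneg (eigenvalue_rpow_pos r k).le
        (div_nonneg (incrVar_nonneg k hδ.1.le) hδ.1.le))]
      refine mul_le_of_le_one_right (eigenvalue_rpow_pos r k).le ?_
      rw [div_le_one hδ.1]
      exact incrVar_le k δ
  refine h.congr' ?_
  filter_upwards [eventually_small] with δ hδ
  rw [tau_sq_of_lt hr hδ.1, energy, ← tsum_div_const]
  exact tsum_congr fun k => by ring

/-! ### Logarithmic asymptotics at r = -1/2 -/

theorem tendsto_abs_log : Tendsto (fun δ : ℝ => |Real.log δ|) (𝓝[>] 0) atTop :=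
  tendsto_abs_atBot_atTop.comp Real.tendsto_log_nhdsGT_zero

/-- Telescoping: for y ≥ N, (y+1)⁻³ ≤ N⁻¹(y⁻¹ - (y+1)⁻¹). The resulting order N⁻² is O(δ) at the
cut-off N ≈ δ^{-1/2}. -/
theorem sum_inv_eigenvalue_le {N : ℕ} (hN : 0 < N) (M : ℕ) :
    ∑ j ∈ Finset.range M, (((j + N : ℕ) : ℝ) + 1)⁻¹ ^ 3 ≤
      (N : ℝ)⁻¹ * ((N : ℝ)⁻¹ - ((M : ℝ) + N)⁻¹) := by
  have hNp : (0 : ℝ) < N := by exact_mod_cast hN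
  induction M with
  | zero => simp
  | succ M ih =>
    rw [Finset.sum_range_succ]
    refine (add_le_add_left ih _).trans ?_
    push_cast
    set y : ℝ := (M : ℝ) + N with hy
    have hNy : (N : ℝ) ≤ y := by rw [hy]; linarith [show (0 : ℝ) ≤ M by positivity]
    have hyp : 0 < y := hNp.trans_le hNy
    have h1 : (y + 1)⁻¹ ^ 3 ≤ (N : ℝ)⁻¹ * (y⁻¹ - (y + 1)⁻¹) := by
      have e : y⁻¹ - (y + 1)⁻¹ = (y + 1)⁻¹ * y⁻¹ := by field_simp; ring
      rw [e, pow_succ, sq, mul_assoc, mul_comm (N : ℝ)⁻¹, mul_assoc]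
      gcongr <;> linarith
    rw [show (M : ℝ) + 1 + N = y + 1 by rw [hy]; ring]
    linarith

theorem eigenvalue_rpow_neg_half (k : ℕ) : eigenvalue k ^ (-1 / 2 : ℝ) = ((k : ℝ) + 1)⁻¹ := by
  rw [eigenvalue_rpow, show (2 : ℝ) * (-1 / 2) = -1 by norm_num, Real.rpow_neg_one]

/-- The sum is cut at N = ⌊δ^{-1/2}⌋, where λ_kδ crosses 1. Below N the variances are close to δ and
the weights 1/(k+1) add up to a harmonic number, log N ≈ ½|log δ|; the tail costs at most 4δ. -/
theorem energy_neg_half_bounds {δ : ℝ} (hδ : 0 < δ) (hδ1 : δ < 1 / 4) :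
    |energy (-1 / 2) δ - 1 / 2 * (δ * |Real.log δ|)| ≤ 5 * δ := by
  have hL : |Real.log δ| = -Real.log δ := abs_of_neg (Real.log_neg hδ (by linarith))
  set s : ℝ := (Real.sqrt δ)⁻¹ with hs
  have hsq : Real.sqrt δ ^ 2 = δ := Real.sq_sqrt hδ.le
  have hsqp : 0 < Real.sqrt δ := Real.sqrt_pos.2 hδ
  have hs0 : 0 < s := by positivity
  have hsδ : s ^ 2 * δ = 1 := by
    rw [hs, inv_pow, hsq, inv_mul_cancel₀ hδ.ne']
  have hs2 : 2 < s := by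
    by_contra! h
    have h2 : s ^ 2 ≤ 2 ^ 2 := by gcongr
    nlinarith
  have hlogs : Real.log s = 1 / 2 * |Real.log δ| := by
    rw [hs, Real.log_inv, Real.log_sqrt hδ.le, hL]; ring
  set N := ⌊s⌋₊ with hN
  have hNs : (N : ℝ) ≤ s := Nat.floor_le hs0.le
  have hsN : s < N + 1 := Nat.lt_floor_add_one s
  have hN1 : s / 2 ≤ N := by linarith
  have hNp : (0 : ℝ) < N := by linarith
  have hNp' : 0 < N := by exact_mod_cast hNp
  have hsum := summable_energy (r := -1 / 2) (by norm_num) hδ.le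
  have hsplit := hsum.sum_add_tsum_nat_add N
  have hnn : ∀ k, 0 ≤ eigenvalue k ^ (-1 / 2 : ℝ) * incrVar k δ := fun k =>
    mul_nonneg (eigenvalue_rpow_pos _ k).le (incrVar_nonneg k hδ.le)
  have htail0 : 0 ≤ ∑' k, eigenvalue (k + N) ^ (-1 / 2 : ℝ) * incrVar (k + N) δ :=
    tsum_nonneg fun k => hnn _
  have htail : ∑' k, eigenvalue (k + N) ^ (-1 / 2 : ℝ) * incrVar (k + N) δ ≤ 4 * δ := by
    refine Real.tsum_le_of_sum_range_le (fun k => hnn _) fun M => ?_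
    calc ∑ j ∈ Finset.range M, eigenvalue (j + N) ^ (-1 / 2 : ℝ) * incrVar (j + N) δ
        ≤ ∑ j ∈ Finset.range M, (((j + N : ℕ) : ℝ) + 1)⁻¹ ^ 3 := by
          refine Finset.sum_le_sum fun j _ => ?_
          rw [eigenvalue_rpow_neg_half, pow_succ']
          gcongr
          exact (incrVar_le_inv _ _).trans_eq (by rw [eigenvalue, inv_pow])
      _ ≤ (N : ℝ)⁻¹ * ((N : ℝ)⁻¹ - ((M : ℝ) + N)⁻¹) := sum_inv_eigenvalue_le hNp' M
      _ ≤ (N : ℝ)⁻¹ * (N : ℝ)⁻¹ := by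
          gcongr
          have : (0 : ℝ) ≤ ((M : ℝ) + N)⁻¹ := by positivity
          linarith
      _ ≤ (s / 2)⁻¹ * (s / 2)⁻¹ := by gcongr
      _ = 4 * δ := by
          have : δ = (s ^ 2)⁻¹ := 
            eq_inv_of_mul_eq_one_left (by rw [mul_comm]; exact hsδ)
          rw [this]
          field_simp
          norm_num
  have hharm : ((harmonic N : ℚ) : ℝ) = ∑ i ∈ Finset.range N, ((i : ℝ) + 1)⁻¹ := by
    simp [harmonic]
  have hup : ∑ k ∈ Finset.range N, eigenvalue k ^ (-1 / 2 : ℝ) * incrVar k δ ≤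
      δ * (1 + 1 / 2 * |Real.log δ|) := by
    calc _ ≤ ∑ k ∈ Finset.range N, ((k : ℝ) + 1)⁻¹ * δ := by
          refine Finset.sum_le_sum fun k _ => ?_
          rw [eigenvalue_rpow_neg_half]
          gcongr
          exact incrVar_le k δ
      _ = δ * ((harmonic N : ℚ) : ℝ) := by rw [← Finset.sum_mul, hharm, mul_comm]
      _ ≤ δ * (1 + Real.log N) := by
          gcongr
          exact harmonic_le_one_add_log N
      _ ≤ δ * (1 + Real.log s) := by gcongr
      _ = _ := by rw [hlogs]
  have hlow : δ * (1 / 2 * |Real.log δ|) - δ ≤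
      ∑ k ∈ Finset.range N, eigenvalue k ^ (-1 / 2 : ℝ) * incrVar k δ := by
    -- The loss δ = δ²s² pays for the second-order terms of `le_incrVar`: each of the N modes loses
    -- δ²(k+1) ≤ δ²N.
    calc δ * (1 / 2 * |Real.log δ|) - δ = δ * Real.log s - δ ^ 2 * s ^ 2 := by
          rw [hlogs]
          linear_combination (-δ) * (-hsδ)
      _ ≤ δ * ((harmonic N : ℚ) : ℝ) - δ ^ 2 * ((N : ℝ) * N) := by
          have h1 : Real.log s ≤ ((harmonic N : ℚ) : ℝ) := by
            refine le_trans ?_ (log_add_one_le_harmonic N)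
            gcongr
            push_cast
            exact hsN.le
          have h2 : (N : ℝ) * N ≤ s ^ 2 := by rw [sq]; gcongr
          have h3 : δ * Real.log s ≤ δ * ((harmonic N : ℚ) : ℝ) := by gcongr
          have h4 : δ ^ 2 * ((N : ℝ) * N) ≤ δ ^ 2 * s ^ 2 := by gcongr
          linarith
      _ ≤ ∑ k ∈ Finset.range N, (((k : ℝ) + 1)⁻¹ * δ - δ ^ 2 * N) := by
          rw [Finset.sum_sub_distrib, ← Finset.sum_mul, hharm, Finset.sum_const, Finset.card_range,
            nsmul_eq_mul]
          exact le_of_eq (by ring)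
      _ ≤ _ := by
          refine Finset.sum_le_sum fun k hk => ?_
          have hkN : (k : ℝ) + 1 ≤ N := by exact_mod_cast Finset.mem_range.1 hk
          have h1 := le_incrVar k hδ.le
          rw [eigenvalue_rpow_neg_half]
          calc ((k : ℝ) + 1)⁻¹ * δ - δ ^ 2 * N ≤ ((k : ℝ) + 1)⁻¹ * δ - δ ^ 2 * ((k : ℝ) + 1) := by
                gcongr
            _ = ((k : ℝ) + 1)⁻¹ * (δ - eigenvalue k * δ ^ 2) := by
                rw [eigenvalue]
                have : (k : ℝ) + 1 ≠ 0 := by positivity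
                field_simp
            _ ≤ _ := by gcongr
  rw [energy, ← hsplit, abs_le]
  constructor <;> nlinarith

theorem tendsto_energy_neg_half :
    Tendsto (fun δ => energy (-1 / 2) δ / tau (-1 / 2) δ ^ 2) (𝓝[>] 0) (𝓝 (1 / 2)) := by
  rw [tendsto_iff_norm_sub_tendsto_zero]
  have h0 : Tendsto (fun δ : ℝ => 5 / |Real.log δ|) (𝓝[>] 0) (𝓝 0) :=
    tendsto_abs_log.const_div_atTop 5
  refine squeeze_zero' (Eventually.of_forall fun _ => norm_nonneg _) ?_ h0
  filter_upwards [eventually_small] with δ hδ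
  have h1 := energy_neg_half_bounds hδ.1 hδ.2
  have hL : 0 < |Real.log δ| := abs_pos.2 (Real.log_neg hδ.1 (by linarith [hδ.2])).ne
  have hp : 0 < δ * |Real.log δ| := mul_pos hδ.1 hL
  rw [tau_sq_of_eq hδ.1, Real.norm_eq_abs,
    show energy (-1 / 2) δ / (δ * |Real.log δ|) - 1 / 2 =
      (energy (-1 / 2) δ - 1 / 2 * (δ * |Real.log δ|)) / (δ * |Real.log δ|) by
        rw [sub_div, mul_div_assoc, div_self hp.ne', mul_one], abs_div, abs_of_pos hp,
        div_le_div_iff₀ hp hL]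
  calc _ ≤ 5 * δ * |Real.log δ| := by gcongr
    _ = _ := by ring

/-- For `-1/2 ≤ r < 1/2`, no single mode carries a nonnegligible part of the energy. -/
theorem exists_bound_mul_incrVar {r : ℝ} (hr : -1 / 2 ≤ r) (hr' : r < 1 / 2) :
    ∃ B : ℝ → ℝ, (∀ δ, 0 < δ → ∀ k, eigenvalue k ^ r * incrVar k δ ≤ B δ) ∧
      Tendsto (fun δ => B δ / tau r δ ^ 2) (𝓝[>] 0) (𝓝 0) := by
  have hpow : ∀ s : ℝ, 0 < s → Tendsto (fun δ : ℝ => δ ^ s) (𝓝[>] 0) (𝓝 0) := by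
    intro s hs
    have := (Real.continuousAt_rpow_const 0 s (Or.inr hs.le)).tendsto
    rw [Real.zero_rpow hs.ne'] at this
    exact this.mono_left nhdsWithin_le_nhds
  rcases le_or_gt r 0 with h0 | h0
  -- For r ≤ 0 the weights are at most 1, and δ = o(τ²) as soon as r ≥ -1/2.
  · refine ⟨fun δ => δ, fun δ hδ k => ?_, ?_⟩
    · calc eigenvalue k ^ r * incrVar k δ ≤ 1 * δ := by
            refine mul_le_mul (Real.rpow_le_one_of_one_le_of_nonpos (one_le_eigenvalue k) h0)
              (incrVar_le k δ) (incrVar_nonneg k hδ.le) zero_le_one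
        _ = δ := one_mul δ
    · rcases hr.eq_or_lt with rfl | hr
      · have h1 : Tendsto (fun δ : ℝ => 1 / |Real.log δ|) (𝓝[>] 0) (𝓝 0) :=
          tendsto_abs_log.const_div_atTop 1
        refine h1.congr' ?_
        filter_upwards [eventually_small] with δ hδ
        have := hδ.1.ne'
        rw [tau_sq_of_eq hδ.1]
        field_simp
      · refine (hpow (1 / 2 + r) (by linarith)).congr' ?_
        filter_upwards [eventually_small] with δ hδ
        rw [tau_sq_of_gt hr hδ.1]
        nth_rw 2 [← Real.rpow_one δ]
        rw [← Real.rpow_sub hδ.1]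
        congr 1
        ring
  -- For r > 0 the inequality 1 - e^{-x} ≤ x^{1-r} at x = λ_kδ cancels λ_k^{r-1}; the bound is
  -- smaller than τ² by the factor δ^{1/2}.
  · refine ⟨fun δ => δ ^ (1 - r), fun δ hδ k => ?_, ?_⟩
    · have hl := eigenvalue_pos k
      set x := eigenvalue k * δ with hx
      have hx0 : 0 < x := by positivity
      have h1 : 1 - Real.exp (-x) ≤ x ^ (1 - r) := by
        rcases le_total x 1 with h | h
        · calc 1 - Real.exp (-x) ≤ x := by linarith [Real.one_sub_le_exp_neg x]
            _ = x ^ (1 : ℝ) := (Real.rpow_one x).symm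
            _ ≤ x ^ (1 - r) := Real.rpow_le_rpow_of_exponent_ge hx0 h (by linarith)
        · calc 1 - Real.exp (-x) ≤ 1 := by linarith [Real.exp_pos (-x)]
            _ ≤ x ^ (1 - r) := Real.one_le_rpow h (by linarith)
      calc eigenvalue k ^ r * incrVar k δ = eigenvalue k ^ (r - 1) * (1 - Real.exp (-x)) := by
            rw [Real.rpow_sub_one hl.ne', incrVar]
            ring
        _ ≤ eigenvalue k ^ (r - 1) * x ^ (1 - r) := by
            gcongr
        _ = δ ^ (1 - r) := by
            rw [hx, Real.mul_rpow hl.le hδ.le, ← mul_assoc, ← Real.rpow_add hl]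
            simp
    · refine (hpow (1 / 2) (by norm_num)).congr' ?_
      filter_upwards [eventually_small] with δ hδ
      rw [tau_sq_of_gt (by linarith) hδ.1, ← Real.rpow_sub hδ.1]
      congr 1
      ring

end HeatPV

namespace HeatPV

/-! ### The Riemann sum regime -/

/-- The profile `y ↦ y^{2r-2} (1 - exp(-y²))`. -/
noncomputable def profile (r y : ℝ) : ℝ := y ^ (2 * r - 2) * (1 - Real.exp (-y ^ 2))

/-- An integrable majorant of the step functions approximating `profile r`. -/
noncomputable def profileBound (r x : ℝ) : ℝ :=
  if x ≤ 1 then x ^ (2 * r) + 2 else x ^ (2 * r - 2)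

theorem profile_nonneg (r : ℝ) {y : ℝ} (hy : 0 ≤ y) : 0 ≤ profile r y := by
  refine mul_nonneg (Real.rpow_nonneg hy _) (sub_nonneg.2 (Real.exp_le_one_iff.2 ?_))
  nlinarith [sq_nonneg y]

/-- Here y is the right endpoint of the mesh cell of x, for a mesh at most 1. Near 0 the profile
behaves like y^{2r}, which is increasing for r > 0; there y ≤ 2 and 2^{2r} ≤ 2, which explains the
constant in `profileBound`. -/
theorem profile_le_bound {r x y : ℝ} (hr : r < 1 / 2) (hx : 0 < x) (hxy : x ≤ y)
    (hy : y ≤ x + 1) : profile r y ≤ profileBound r x := by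
  have hy0 : 0 < y := hx.trans_le hxy
  unfold profile profileBound
  split_ifs with h
  · have h1 : y ^ (2 * r - 2) * (1 - Real.exp (-y ^ 2)) ≤ y ^ (2 * r) := by
      calc _ ≤ y ^ (2 * r - 2) * y ^ 2 := by
            gcongr
            linarith [Real.one_sub_le_exp_neg (y ^ 2)]
        _ = y ^ (2 * r) := by
            rw [← Real.rpow_natCast y 2, ← Real.rpow_add hy0]
            congr 1
            push_cast
            ring
    refine h1.trans ?_
    have hx2 : 0 ≤ x ^ (2 * r) := Real.rpow_nonneg hx.le _
    rcases le_total r 0 with h0 | h0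
    · have := Real.rpow_le_rpow_of_nonpos hx hxy (show 2 * r ≤ 0 by linarith)
      linarith
    · have h2 : y ^ (2 * r) ≤ 2 ^ (2 * r) :=
        Real.rpow_le_rpow hy0.le (by linarith) (by linarith)
      have h3 : (2 : ℝ) ^ (2 * r) ≤ 2 ^ (1 : ℝ) :=
        Real.rpow_le_rpow_of_exponent_le (by norm_num) (by linarith)
      rw [Real.rpow_one] at h3
      linarith
  · calc _ ≤ y ^ (2 * r - 2) * 1 := by
          gcongr
          linarith [Real.exp_pos (-y ^ 2)]
      _ = y ^ (2 * r - 2) := mul_one _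
      _ ≤ _ := Real.rpow_le_rpow_of_nonpos hx hxy (by linarith)

theorem integrableOn_profileBound {r : ℝ} (hr : -1 / 2 < r) (hr' : r < 1 / 2) :
    IntegrableOn (profileBound r) (Set.Ioi 0) := by
  rw [← Set.Ioc_union_Ioi_eq_Ioi zero_le_one]
  refine IntegrableOn.union ?_ ?_
  · have h1 : IntegrableOn (fun x : ℝ => x ^ (2 * r) + 2) (Set.Ioc 0 1) :=
      ((intervalIntegrable_iff_integrableOn_Ioc_of_le zero_le_one).1
        (intervalIntegral.intervalIntegrable_rpow' (by linarith))).add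
          (integrableOn_const (by simp))
    exact h1.congr_fun (fun x hx => by simp [profileBound, hx.2]) measurableSet_Ioc
  · have h2 : IntegrableOn (fun x : ℝ => x ^ (2 * r - 2)) (Set.Ioi 1) :=
      integrableOn_Ioi_rpow_of_lt (by linarith) one_pos
    exact h2.congr_fun (fun x (hx : 1 < x) => by simp [profileBound, not_le.2 hx])
      measurableSet_Ioi

theorem measurable_profile (r : ℝ) : Measurable (profile r) := by
  unfold profile
  fun_prop

theorem continuousAt_profile (r : ℝ) {x : ℝ} (hx : 0 < x) : ContinuousAt (profile r) x := by
  unfold profile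
  exact (Real.continuousAt_rpow_const x _ (Or.inl hx.ne')).mul (by fun_prop)

theorem integrableOn_profile {r : ℝ} (hr : -1 / 2 < r) (hr' : r < 1 / 2) :
    IntegrableOn (profile r) (Set.Ioi 0) := by
  refine Integrable.mono' (integrableOn_profileBound hr hr')
    (measurable_profile r).aestronglyMeasurable ?_
  refine (ae_restrict_mem measurableSet_Ioi).mono fun x (hx : 0 < x) => ?_
  rw [Real.norm_of_nonneg (profile_nonneg r hx.le)]
  exact profile_le_bound hr' hx le_rfl (by linarith)

/-- Integration by parts against x^{2r-1}/(2r-1). The boundary terms are O(x^{2r+1}) at 0 and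
O(x^{2r-1}) at infinity, so both bounds on r are used; a Gamma integral remains. -/
theorem integral_profile {r : ℝ} (hr : -1 / 2 < r) (hr' : r < 1 / 2) :
    ∫ x in Set.Ioi 0, profile r x = Real.Gamma (r + 1 / 2) / (2 * (1 / 2 - r)) := by
  have hc : 2 * r - 1 ≠ 0 := by linarith
  have hu : ∀ x ∈ Set.Ioi (0 : ℝ), HasDerivAt (fun x : ℝ => 1 - Real.exp (-x ^ 2))
      (2 * x * Real.exp (-x ^ 2)) x := by
    intro x _
    have h1 : HasDerivAt (fun x : ℝ => -x ^ 2) (-(2 * x)) x := by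
      simpa using! (hasDerivAt_pow 2 x).neg
    refine (h1.exp.const_sub 1).congr_deriv ?_
    ring
  have hv : ∀ x ∈ Set.Ioi (0 : ℝ), HasDerivAt (fun x : ℝ => x ^ (2 * r - 1) / (2 * r - 1))
      (x ^ (2 * r - 2)) x := by
    intro x hx
    have h1 := (Real.hasDerivAt_rpow_const (x := x) (p := 2 * r - 1)
      (Or.inl (ne_of_gt hx))).div_const (2 * r - 1)
    refine h1.congr_deriv ?_
    rw [mul_div_assoc, mul_div_cancel₀ _ hc]
    congr 1
    ring
  have hprod : ∀ x ∈ Set.Ioi (0 : ℝ), 2 * x * Real.exp (-x ^ 2) * (x ^ (2 * r - 1) / (2 * r - 1)) =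
      2 / (2 * r - 1) * (x ^ (2 * r) * Real.exp (-1 * x ^ (2 : ℝ))) := by
    intro x (hx : 0 < x)
    have e : x ^ (2 * r) = x * x ^ (2 * r - 1) := by
      nth_rw 2 [← Real.rpow_one x]
      rw [← Real.rpow_add hx]
      congr 1
      ring
    rw [e, show (2 : ℝ) = ((2 : ℕ) : ℝ) by norm_num, Real.rpow_natCast]
    push_cast
    rw [neg_one_mul]
    ring
  have hint2 : IntegrableOn ((fun x : ℝ => 2 * x * Real.exp (-x ^ 2)) *
      fun x => x ^ (2 * r - 1) / (2 * r - 1)) (Set.Ioi 0) := by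
    have := (integrableOn_rpow_mul_exp_neg_mul_rpow (p := 2) (s := 2 * r) (b := 1)
      (by linarith) (by norm_num) one_pos).const_mul (2 / (2 * r - 1))
    exact IntegrableOn.congr_fun this (fun x hx => (hprod x hx).symm) measurableSet_Ioi
  have hint1 : IntegrableOn ((fun x : ℝ => 1 - Real.exp (-x ^ 2)) * fun x => x ^ (2 * r - 2))
      (Set.Ioi 0) :=
    (integrableOn_profile hr hr').congr_fun (fun x _ => by simp [profile, mul_comm])
      measurableSet_Ioi
  have hlim0 : Tendsto ((fun x : ℝ => 1 - Real.exp (-x ^ 2)) *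
      fun x => x ^ (2 * r - 1) / (2 * r - 1)) (𝓝[>] 0) (𝓝 0) := by
    have h1 : Tendsto (fun x : ℝ => x ^ (2 * r + 1) * |2 * r - 1|⁻¹) (𝓝[>] 0) (𝓝 0) := by
      have h2 := (Real.continuousAt_rpow_const 0 (2 * r + 1) (Or.inr (by linarith))).tendsto
      rw [Real.zero_rpow (by linarith)] at h2
      simpa using (h2.mono_left nhdsWithin_le_nhds).mul_const |2 * r - 1|⁻¹
    refine squeeze_zero_norm' ?_ h1
    filter_upwards [self_mem_nhdsWithin] with x (hx : 0 < x)
    have h3 : 0 ≤ 1 - Real.exp (-x ^ 2) :=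
      sub_nonneg.2 (Real.exp_le_one_iff.2 (by nlinarith [sq_nonneg x]))
    rw [Pi.mul_apply, norm_mul, norm_div, Real.norm_of_nonneg h3,
      Real.norm_of_nonneg (Real.rpow_nonneg hx.le _), Real.norm_eq_abs, ← mul_div_assoc,
      div_eq_mul_inv]
    gcongr
    calc (1 - Real.exp (-x ^ 2)) * x ^ (2 * r - 1) ≤ x ^ 2 * x ^ (2 * r - 1) := by
          gcongr
          linarith [Real.one_sub_le_exp_neg (x ^ 2)]
      _ = x ^ (2 * r + 1) := by
          rw [← Real.rpow_natCast x 2, ← Real.rpow_add hx]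
          congr 1
          push_cast
          ring
  have hlim1 : Tendsto ((fun x : ℝ => 1 - Real.exp (-x ^ 2)) *
      fun x => x ^ (2 * r - 1) / (2 * r - 1)) atTop (𝓝 0) := by
    have h1 : Tendsto (fun x : ℝ => x ^ (-(1 - 2 * r)) * |2 * r - 1|⁻¹) atTop (𝓝 0) := by
      simpa using (tendsto_rpow_neg_atTop (y := 1 - 2 * r) (by linarith)).mul_const |2 * r - 1|⁻¹
    refine squeeze_zero_norm' ?_ h1
    filter_upwards [eventually_gt_atTop 0] with x hx
    have h3 : 0 ≤ 1 - Real.exp (-x ^ 2) :=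
      sub_nonneg.2 (Real.exp_le_one_iff.2 (by nlinarith [sq_nonneg x]))
    rw [Pi.mul_apply, norm_mul, norm_div, Real.norm_of_nonneg h3,
      Real.norm_of_nonneg (Real.rpow_nonneg hx.le _), Real.norm_eq_abs, ← mul_div_assoc,
      div_eq_mul_inv, show -(1 - 2 * r) = 2 * r - 1 by ring]
    gcongr
    refine mul_le_of_le_one_left (Real.rpow_nonneg hx.le _) ?_
    linarith [Real.exp_pos (-x ^ 2)]
  have key := integral_Ioi_mul_deriv_eq_deriv_mul hu hv hint1 hint2 hlim0 hlim1
  calc ∫ x in Set.Ioi 0, profile r x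
      = ∫ x in Set.Ioi (0 : ℝ), (1 - Real.exp (-x ^ 2)) * x ^ (2 * r - 2) :=
        integral_congr_ae (Eventually.of_forall fun x => by simp [profile, mul_comm])
    _ = 0 - 0 - ∫ x in Set.Ioi (0 : ℝ),
          2 / (2 * r - 1) * (x ^ (2 * r) * Real.exp (-1 * x ^ (2 : ℝ))) := by
        rw [key, setIntegral_congr_fun measurableSet_Ioi hprod]
    _ = Real.Gamma (r + 1 / 2) / (2 * (1 / 2 - r)) := by
        rw [integral_const_mul, integral_rpow_mul_exp_neg_mul_rpow (by norm_num) (by linarith)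
          one_pos, Real.one_rpow, show (2 * r + 1) / 2 = r + 1 / 2 by ring]
        have h2 : 1 / 2 - r ≠ 0 := by linarith
        rw [show 2 * r - 1 = -(2 * (1 / 2 - r)) by ring, div_neg]
        ring

/-- Writing the Riemann sum as the integral of a step function opens it to dominated convergence on
the unbounded, possibly singular, half-line. The ceiling matches cells closed on the right. -/
theorem hasSum_profile_eq_integral {r h : ℝ} (hr' : r < 1 / 2) (hh : 0 < h) :
    ∑' k : ℕ, h * profile r ((k + 1) * h) =
      ∫ x in Set.Ioi 0, profile r (⌈x / h⌉₊ * h) := by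
  set F : ℕ → ℝ → ℝ := fun k =>
    (Set.Ioc (k * h) ((k + 1) * h)).indicator fun _ => profile r ((k + 1) * h) with hF
  have hpos : ∀ k : ℕ, 0 ≤ profile r ((k + 1) * h) := fun k => profile_nonneg r (by positivity)
  have hsub : ∀ k : ℕ, Set.Ioc (k * h) ((k + 1) * h) ∩ Set.Ioi 0 = Set.Ioc (k * h) ((k + 1) * h) :=
    fun k => Set.inter_eq_left.2 fun x hx =>
      lt_of_le_of_lt (by positivity : (0 : ℝ) ≤ k * h) hx.1
  have hFint : ∀ k, ∫ x in Set.Ioi 0, F k x = h * profile r ((k + 1) * h) := by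
    intro k
    rw [hF, integral_indicator measurableSet_Ioc, Measure.restrict_restrict measurableSet_Ioc,
      hsub, setIntegral_const, measureReal_def, Real.volume_Ioc, ENNReal.toReal_ofReal (by linarith),
      smul_eq_mul]
    ring
  have hFi : ∀ k, Integrable (F k) (volume.restrict (Set.Ioi 0)) := by
    intro k
    refine (integrable_indicator_iff measurableSet_Ioc).2 (integrableOn_const ?_)
    rw [Measure.restrict_apply measurableSet_Ioc, hsub]
    simp
  have hFn : ∀ k, ∫ x in Set.Ioi 0, ‖F k x‖ = h * profile r ((k + 1) * h) := by
    intro k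
    rw [← hFint k]
    refine integral_congr_ae (Eventually.of_forall fun x => ?_)
    exact Real.norm_of_nonneg (Set.indicator_nonneg (fun _ _ => hpos k) x)
  have hsum : Summable fun k : ℕ => h * profile r ((k + 1) * h) := by
    refine Summable.mul_left h ?_
    have h1 : Summable fun k : ℕ => h ^ (2 * r - 2) * ((k : ℝ) + 1) ^ (2 * r - 2) := by
      refine Summable.mul_left _ ?_
      have := (summable_nat_add_iff 1).2 (Real.summable_nat_rpow.2
        (show 2 * r - 2 < -1 by linarith))
      simpa using this
    refine Summable.of_nonneg_of_le hpos (fun k => ?_) h1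
    rw [profile, Real.mul_rpow (by positivity) hh.le, mul_comm (h ^ _)]
    refine mul_le_of_le_one_right (by positivity) ?_
    linarith [Real.exp_pos (-(((k : ℝ) + 1) * h) ^ 2)]
  have key := hasSum_integral_of_summable_integral_norm hFi (by simpa only [hFn] using hsum)
  simp only [hFint] at key
  rw [key.tsum_eq]
  refine setIntegral_congr_fun measurableSet_Ioi fun x (hx : 0 < x) => ?_
  have hc : 0 < ⌈x / h⌉₊ := Nat.ceil_pos.2 (by positivity)
  obtain ⟨j, hj⟩ := Nat.exists_eq_add_one_of_ne_zero hc.ne'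
  have hjmem : x ∈ Set.Ioc (j * h) ((j + 1) * h) := by
    have h1 := (Nat.ceil_eq_iff (Nat.succ_ne_zero j)).1 hj
    constructor
    · have := h1.1
      rw [Nat.succ_sub_one, lt_div_iff₀ hh] at this
      exact this
    · have := h1.2
      rw [div_le_iff₀ hh] at this
      exact_mod_cast this
  rw [tsum_eq_single j, hj]
  · simp only [hF]
    rw [Set.indicator_of_mem hjmem]
    push_cast
    rfl
  · intro k hk
    refine Set.indicator_of_notMem (fun hmem => hk ?_) _
    have a1 : (k : ℝ) * h < ((j + 1 : ℕ) : ℝ) * h := by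
      push_cast; exact hmem.1.trans_le hjmem.2
    have a2 : (j : ℝ) * h < ((k + 1 : ℕ) : ℝ) * h := by
      push_cast; exact hjmem.1.trans_le hmem.2
    have b1 := lt_of_mul_lt_mul_right a1 hh.le
    have b2 := lt_of_mul_lt_mul_right a2 hh.le
    have c1 : k < j + 1 := by exact_mod_cast b1
    have c2 : j < k + 1 := by exact_mod_cast b2
    omega

theorem le_ceil_mul {x h : ℝ} (hx : 0 < x) (hh : 0 < h) :
    x ≤ ⌈x / h⌉₊ * h ∧ ⌈x / h⌉₊ * h ≤ x + h := by
  have h1 := Nat.le_ceil (x / h)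
  have h2 := (Nat.ceil_lt_add_one (a := x / h) (by positivity)).le
  rw [div_le_iff₀ hh] at h1
  refine ⟨h1, ?_⟩
  calc _ ≤ (x / h + 1) * h := by gcongr
    _ = x + h := by field_simp

theorem tendsto_tsum_profile {r : ℝ} (hr : -1 / 2 < r) (hr' : r < 1 / 2) :
    Tendsto (fun h : ℝ => ∑' k : ℕ, h * profile r ((k + 1) * h)) (𝓝[>] 0)
      (𝓝 (Real.Gamma (r + 1 / 2) / (2 * (1 / 2 - r)))) := by
  rw [← integral_profile hr hr']
  have h1 : Tendsto (fun h : ℝ => ∫ x in Set.Ioi 0, profile r (⌈x / h⌉₊ * h)) (𝓝[>] 0)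
      (𝓝 (∫ x in Set.Ioi 0, profile r x)) := by
    refine tendsto_integral_filter_of_dominated_convergence (profileBound r) ?_ ?_
      (integrableOn_profileBound hr hr') ?_
    · refine Eventually.of_forall fun h => Measurable.aestronglyMeasurable ?_
      refine (measurable_profile r).comp (Measurable.mul_const ?_ h)
      exact (measurable_from_top (f := fun n : ℕ => (n : ℝ))).comp
        (Nat.measurable_ceil.comp (measurable_id.div_const h))
    · filter_upwards [eventually_small] with h hh
      refine (ae_restrict_mem measurableSet_Ioi).mono fun x (hx : 0 < x) => ?_
      have h2 := le_ceil_mul hx hh.1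
      rw [Real.norm_of_nonneg (profile_nonneg r (hx.le.trans h2.1))]
      exact profile_le_bound hr' hx h2.1 (by linarith [hh.2])
    · refine (ae_restrict_mem measurableSet_Ioi).mono fun x (hx : 0 < x) => ?_
      refine (continuousAt_profile r hx).tendsto.comp ?_
      have h3 : Tendsto (fun h : ℝ => x + h) (𝓝[>] 0) (𝓝 x) := by
        have : Tendsto (fun h : ℝ => x + h) (𝓝 0) (𝓝 (x + 0)) := by
          apply Continuous.tendsto; fun_prop
        rw [add_zero] at this
        exact this.mono_left nhdsWithin_le_nhds
      refine tendsto_of_tendsto_of_tendsto_of_le_of_le' tendsto_const_nhds h3 ?_ ?_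
      · filter_upwards [self_mem_nhdsWithin] with h (hh : 0 < h) using (le_ceil_mul hx hh).1
      · filter_upwards [self_mem_nhdsWithin] with h (hh : 0 < h) using (le_ceil_mul hx hh).2
  refine h1.congr' ?_
  filter_upwards [self_mem_nhdsWithin] with h (hh : 0 < h)
  exact (hasSum_profile_eq_integral hr' hh).symm

/-- With h = √δ one has λ_kδ = ((k+1)h)² and τ² = h^{1-2r}, so the normalized energy is the Riemann
sum of mesh h. -/
theorem tendsto_energy_of_gt {r : ℝ} (hr : -1 / 2 < r) (hr' : r < 1 / 2) :
    Tendsto (fun δ => energy r δ / tau r δ ^ 2) (𝓝[>] 0)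
      (𝓝 (Real.Gamma (r + 1 / 2) / (2 * (1 / 2 - r)))) := by
  have hsqrt : Tendsto Real.sqrt (𝓝[>] 0) (𝓝[>] 0) := by
    refine tendsto_nhdsWithin_iff.2 ⟨?_, ?_⟩
    · have := Real.continuous_sqrt.tendsto 0
      rw [Real.sqrt_zero] at this
      exact this.mono_left nhdsWithin_le_nhds
    · filter_upwards [self_mem_nhdsWithin] with δ hδ using Real.sqrt_pos.2 hδ
  refine ((tendsto_tsum_profile hr hr').comp hsqrt).congr' ?_
  filter_upwards [self_mem_nhdsWithin] with δ (hδ : 0 < δ)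
  rw [tau_sq_of_gt hr hδ, energy, ← tsum_div_const]
  refine tsum_congr fun k => ?_
  set h := Real.sqrt δ with hh
  have hh0 : 0 < h := Real.sqrt_pos.2 hδ
  have hsq : δ = h ^ 2 := (Real.sq_sqrt hδ.le).symm
  have e1 : δ ^ (1 / 2 - r) = h * (h ^ (2 * r - 2) * h ^ 2)⁻¹ := by
    rw [hsq, ← Real.rpow_natCast h 2, ← Real.rpow_mul hh0.le, ← Real.rpow_add hh0,
      ← Real.rpow_neg hh0.le, ← Real.rpow_one_add' hh0.le (by push_cast; linarith)]
    congr 1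
    push_cast
    ring
  have e2 : eigenvalue k ^ r = ((k : ℝ) + 1) ^ (2 * r - 2) * eigenvalue k := by
    rw [show 2 * r - 2 = 2 * (r - 1) by ring, ← eigenvalue_rpow,
      Real.rpow_sub_one (eigenvalue_pos k).ne', div_mul_cancel₀ _ (eigenvalue_pos k).ne']
  have e3 : eigenvalue k * δ = (((k : ℝ) + 1) * h) ^ 2 := by
    rw [eigenvalue, hsq, mul_pow]
  rw [incrVar, e1, e2, e3, profile, Real.mul_rpow (by positivity) hh0.le]
  have hl := (eigenvalue_pos k).ne'
  have hp : h ^ (2 * r - 2) ≠ 0 := (Real.rpow_pos_of_pos hh0 _).ne'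
  field_simp

end HeatPV

namespace HeatPV

/-! ### Complete Bell polynomials -/

theorem _root_.Nat.Partition.sum_mul_count {n : ℕ} (π : Nat.Partition n) :
    ∑ a ∈ Finset.Icc 1 n, a * π.parts.count a = n := by
  have h : π.parts.toFinset ⊆ Finset.Icc 1 n := by
    intro a ha
    rw [Multiset.mem_toFinset] at ha
    exact Finset.mem_Icc.2 ⟨π.parts_pos ha, π.le_of_mem_parts ha⟩
  conv_rhs => rw [← π.parts_sum, Finset.sum_multiset_count]
  rw [Finset.sum_subset h]
  · exact Finset.sum_congr rfl fun a _ => by rw [smul_eq_mul, mul_comm]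
  · intro a _ ha
    rw [Multiset.mem_toFinset] at ha
    simp [Multiset.count_eq_zero_of_notMem ha]

/-- The weight `∏ⱼ yⱼ^{mⱼ} / mⱼ!` of a multiset with multiplicities `mⱼ`. -/
noncomputable def partWeight (y : ℕ → ℝ) (M : ℕ) (s : Multiset ℕ) : ℝ :=
  ∏ j ∈ Finset.Icc 1 M, y j ^ s.count j / ((s.count j).factorial : ℝ)

theorem partWeight_eq_of_le (y : ℕ → ℝ) {n M : ℕ} (h : n ≤ M) (π : Nat.Partition n) :
    partWeight y M π.parts = partWeight y n π.parts := by
  unfold partWeight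
  refine (Finset.prod_subset (Finset.Icc_subset_Icc le_rfl h) fun j _ hj => ?_).symm
  have : j ∉ π.parts := fun hmem =>
    hj (Finset.mem_Icc.2 ⟨π.parts_pos hmem, π.le_of_mem_parts hmem⟩)
  simp [Multiset.count_eq_zero_of_notMem this]

theorem count_mul_partWeight (y : ℕ → ℝ) {a M : ℕ} (ha : a ∈ Finset.Icc 1 M) {s : Multiset ℕ}
    (has : a ∈ s) : (s.count a : ℝ) * partWeight y M s = y a * partWeight y M (s.erase a) := by
  unfold partWeight
  rw [← Finset.mul_prod_erase _ _ ha, ← Finset.mul_prod_erase _ _ ha]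
  have h1 : ∏ j ∈ (Finset.Icc 1 M).erase a, y j ^ (s.erase a).count j /
      (((s.erase a).count j).factorial : ℝ) =
      ∏ j ∈ (Finset.Icc 1 M).erase a, y j ^ s.count j / ((s.count j).factorial : ℝ) :=
    Finset.prod_congr rfl fun j hj => by
      rw [Multiset.count_erase_of_ne (Finset.ne_of_mem_erase hj)]
  rw [h1, Multiset.count_erase_self, ← mul_assoc, ← mul_assoc]
  congr 1
  obtain ⟨m, hm⟩ := Nat.exists_eq_add_one_of_ne_zero (Multiset.count_pos.2 has).ne'
  rw [hm, Nat.add_sub_cancel, Nat.factorial_succ]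
  have h2 : (m.factorial : ℝ) ≠ 0 := by positivity
  push_cast
  field_simp
  ring

/-- The sum of the weights of all partitions of `n`. -/
noncomputable def partSum (y : ℕ → ℝ) (n : ℕ) : ℝ :=
  ∑ π : Nat.Partition n, partWeight y n π.parts

/-- Erasing one part `a` is a bijection from the partitions of n containing `a` to the partitions of
n - a, and the multiplicity absorbs one factor of the factorial. -/
theorem sum_count_mul_partWeight (y : ℕ → ℝ) {a n : ℕ} (ha : 1 ≤ a) (han : a ≤ n) :
    ∑ π : Nat.Partition n, (π.parts.count a : ℝ) * partWeight y n π.parts =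
      y a * partSum y (n - a) := by
  classical
  have h1 : ∑ π : Nat.Partition n, (π.parts.count a : ℝ) * partWeight y n π.parts =
      ∑ π : {π : Nat.Partition n // a ∈ π.parts},
        (π.1.parts.count a : ℝ) * partWeight y n π.1.parts := by
    rw [← Finset.sum_subtype (Finset.univ.filter fun π : Nat.Partition n => a ∈ π.parts)
      (by simp) (fun π => (π.parts.count a : ℝ) * partWeight y n π.parts)]
    refine (Finset.sum_filter_of_ne fun π _ hne => ?_).symm
    by_contra hmem
    simp [Multiset.count_eq_zero_of_notMem hmem] at hne
  rw [h1, partSum, Finset.mul_sum,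
    ← (Nat.Partition.partitionWithPartEquiv ha han).sum_comp]
  refine Finset.sum_congr rfl fun π _ => ?_
  rw [count_mul_partWeight y (Finset.mem_Icc.2 ⟨ha, han⟩) π.2,
    ← partWeight_eq_of_le y (Nat.sub_le n a), Nat.Partition.partitionWithPartEquiv_apply_parts]

/-- Counting n = ∑ a m_a inside each partition gives the coefficient form of F' = G'F for F = exp G,
G = ∑ y_a z^a. -/
theorem mul_partSum (y : ℕ → ℝ) (n : ℕ) :
    (n : ℝ) * partSum y n = ∑ a ∈ Finset.Icc 1 n, a * (y a * partSum y (n - a)) := by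
  have h : ∀ π : Nat.Partition n, (n : ℝ) * partWeight y n π.parts =
      ∑ a ∈ Finset.Icc 1 n, a * ((π.parts.count a : ℝ) * partWeight y n π.parts) := by
    intro π
    have hn : (n : ℝ) = ∑ a ∈ Finset.Icc 1 n, (a : ℝ) * π.parts.count a := by
      exact_mod_cast π.sum_mul_count.symm
    rw [hn, Finset.sum_mul]
    exact Finset.sum_congr rfl fun a _ => by ring
  rw [partSum, Finset.mul_sum, Finset.sum_congr rfl fun π _ => h π, Finset.sum_comm]
  refine Finset.sum_congr rfl fun a ha => ?_
  rw [← Finset.mul_sum, sum_count_mul_partWeight y (Finset.mem_Icc.1 ha).1 (Finset.mem_Icc.1 ha).2]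

theorem completeBell_eq (p : ℕ) (x : ℕ → ℝ) :
    completeBell p x = p.factorial * partSum (fun j => x j / j.factorial) p := by
  rw [completeBell, partSum, Finset.mul_sum]
  rfl

theorem succ_mul_partSum_succ (x : ℕ → ℝ) (p : ℕ) :
    ((p : ℝ) + 1) * partSum (fun j => x j / j.factorial) (p + 1) =
      ∑ j ∈ Finset.range (p + 1), x (j + 1) / j.factorial *
        partSum (fun j => x j / j.factorial) (p - j) := by
  have h := mul_partSum (fun j => x j / j.factorial) (p + 1)
  push_cast at h
  rw [h, ← Finset.Ico_add_one_right_eq_Icc, Finset.sum_Ico_eq_sum_range, Nat.add_sub_cancel]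
  refine Finset.sum_congr rfl fun j _ => ?_
  rw [add_comm 1 j, Nat.add_sub_add_right, Nat.factorial_succ]
  have h2 : (j.factorial : ℝ) ≠ 0 := by positivity
  push_cast
  field_simp

theorem partSum_zero (y : ℕ → ℝ) : partSum y 0 = 1 := by
  simp [partSum, partWeight]

/-- The complete Bell polynomials are determined by their recursion. -/
theorem eq_completeBell_of_recursion {x c : ℕ → ℝ} (h0 : c 0 = 1)
    (hc : ∀ p : ℕ, ((p : ℝ) + 1) * c (p + 1) =
      ∑ j ∈ Finset.range (p + 1), x (j + 1) / j.factorial * c (p - j)) (p : ℕ) :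
    p.factorial * c p = completeBell p x := by
  rw [completeBell_eq]
  congr 1
  induction p using Nat.strong_induction_on with
  | _ p ih =>
    cases p with
    | zero => rw [h0, partSum_zero]
    | succ p =>
      have h1 : ((p : ℝ) + 1) ≠ 0 := by positivity
      refine mul_left_cancel₀ h1 ?_
      rw [hc, succ_mul_partSum_succ]
      exact Finset.sum_congr rfl fun j _ => by rw [ih (p - j) (by omega)]

/-- Both sides obey the same recursion. This moves the factor 2^p of the limiting constant into the
cumulants. -/
theorem pow_mul_completeBell (a : ℝ) (x : ℕ → ℝ) (p : ℕ) :
    a ^ p * completeBell p x = completeBell p fun l => a ^ l * x l := by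
  rw [← eq_completeBell_of_recursion (x := fun l => a ^ l * x l)
    (c := fun p => a ^ p * partSum (fun j => x j / j.factorial) p) (by simp [partSum_zero])
    (fun p => ?_), completeBell_eq]
  · ring
  · rw [mul_left_comm, succ_mul_partSum_succ, Finset.mul_sum]
    refine Finset.sum_congr rfl fun j hj => ?_
    have e : a ^ (p + 1) = a ^ (j + 1) * a ^ (p - j) := by
      rw [← pow_add]
      congr 1
      have := Finset.mem_range.1 hj
      omega
    rw [e]
    ring

theorem completeBell_congr {x y : ℕ → ℝ} {p : ℕ} (h : ∀ j, 1 ≤ j → x j = y j) :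
    completeBell p x = completeBell p y := by
  unfold completeBell
  refine Finset.sum_congr rfl fun π _ => ?_
  congr 1
  exact Finset.prod_congr rfl fun j hj => by rw [h j (Finset.mem_Icc.1 hj).1]

theorem tendsto_completeBell {ι : Type*} {l : Filter ι} {f : ι → ℕ → ℝ} {x : ℕ → ℝ} (p : ℕ)
    (h : ∀ j, 1 ≤ j → Tendsto (fun n => f n j) l (𝓝 (x j))) :
    Tendsto (fun n => completeBell p (f n)) l (𝓝 (completeBell p x)) := by
  unfold completeBell
  refine tendsto_finsetSum _ fun π _ => Tendsto.const_mul _ (tendsto_finsetProd _ fun j hj => ?_)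
  exact (((h j (Finset.mem_Icc.1 hj).1).div_const _).pow _).div_const _

/-! ### Moments of weighted sums of squared Gaussians -/

/-- The exponential generating series of the moments of `v N²`, for a standard Gaussian `N`. -/
noncomputable def singleSeries (v : ℝ) : PowerSeries ℝ :=
  PowerSeries.mk fun a => v ^ a * gaussianMoment a / a.factorial

/-- The derivative of the logarithm of `singleSeries v`. -/
noncomputable def singleCumulant (v : ℝ) : PowerSeries ℝ :=
  PowerSeries.mk fun j => 2 ^ j * v ^ (j + 1)

/-- The series is that of (1 - 2vz)^{-1/2}, with logarithmic derivative v/(1 - 2vz). -/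
theorem derivative_singleSeries (v : ℝ) :
    PowerSeries.derivative ℝ (singleSeries v) = singleCumulant v * singleSeries v := by
  ext a
  rw [PowerSeries.coeff_derivative, PowerSeries.coeff_mul,
    Finset.Nat.sum_antidiagonal_eq_sum_range_succ_mk]
  simp only [singleSeries, singleCumulant, PowerSeries.coeff_mk]
  have hrec : ∀ a : ℕ, v ^ (a + 1) * gaussianMoment (a + 1) / ((a + 1).factorial : ℝ) * (a + 1) =
      v * (2 * a + 1) * (v ^ a * gaussianMoment a / a.factorial) := by
    intro a
    rw [gaussianMoment_succ, Nat.factorial_succ]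
    have h2 : (a.factorial : ℝ) ≠ 0 := by positivity
    push_cast
    field_simp
    ring
  induction a with
  | zero =>
    simp [gaussianMoment_zero, gaussianMoment_one]
  | succ a ih =>
    rw [Finset.sum_range_succ']
    -- Apart from its term of index 0, the convolution at a + 1 is 2v times the convolution at a, to
    -- which the induction hypothesis applies.
    have e : ∀ j ∈ Finset.range (a + 1), (2 : ℝ) ^ (j + 1) * v ^ (j + 1 + 1) *
        (v ^ (a + 1 - (j + 1)) * gaussianMoment (a + 1 - (j + 1)) /
          ((a + 1 - (j + 1)).factorial : ℝ)) = 2 * v * (2 ^ j * v ^ (j + 1) *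
            (v ^ (a - j) * gaussianMoment (a - j) / ((a - j).factorial : ℝ))) := by
      intro j _
      rw [Nat.add_sub_add_right]
      ring
    rw [Finset.sum_congr rfl e, ← Finset.mul_sum, ← Nat.succ_eq_add_one a, ← ih, Nat.succ_eq_add_one,
      Nat.sub_zero, hrec (a + 1)]
    push_cast
    ring

section Moments

variable {Ω : Type*} [MeasurableSpace Ω] {P : Measure Ω}
  {W : Lp ℝ 2 spaceTimeMeasure → Ω → ℝ} {w : ℕ → ℝ} {d : ℕ → Lp ℝ 2 spaceTimeMeasure}

/-- Independence makes the exponential moment series multiplicative. Working with formal power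
series avoids any question of exponential integrability. -/
theorem IsWhiteNoise.integrable_sum_and_moments (hW : IsWhiteNoise W P)
    (horth : ∀ i j, i ≠ j → inner ℝ (d i) (d j) = (0 : ℝ)) (N : ℕ) :
    (∀ p : ℕ, Integrable (fun ω => (∑ k ∈ Finset.range N, w k * W (d k) ω ^ 2) ^ p) P) ∧
    (PowerSeries.mk fun p =>
      (∫ ω, (∑ k ∈ Finset.range N, w k * W (d k) ω ^ 2) ^ p ∂P) / p.factorial) =
      ∏ k ∈ Finset.range N, singleSeries (w k * ‖d k‖ ^ 2) := by
  have hP := hW.gaussian.isProbabilityMeasure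
  have hind := hW.iIndepFun_of_orthogonal d horth
  induction N with
  | zero =>
    constructor
    · intro p
      simp
    · ext p
      rcases Nat.eq_zero_or_pos p with rfl | hp
      · simp
      · simp [PowerSeries.coeff_one, hp.ne']
  | succ N ih =>
    obtain ⟨ih1, ih2⟩ := ih
    set Z : Ω → ℝ := fun ω => ∑ k ∈ Finset.range N, w k * W (d k) ω ^ 2 with hZ
    set Y : Ω → ℝ := fun ω => w N * W (d N) ω ^ 2 with hY
    have hYint : ∀ p : ℕ, Integrable (fun ω => Y ω ^ p) P := by
      intro p
      simp only [hY, mul_pow, ← pow_mul]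
      exact (hW.integrable_pow (d N) (2 * p)).const_mul _
    have hYmom : ∀ p : ℕ, ∫ ω, Y ω ^ p ∂P = (w N * ‖d N‖ ^ 2) ^ p * gaussianMoment p := by
      intro p
      simp only [hY, mul_pow (w N) _ p, ← pow_mul (W _ _)]
      rw [integral_const_mul, hW.integral_pow, mul_assoc]
    have hZY : IndepFun Z Y P := by
      have h1 := hind.comp (fun k x => w k * x ^ 2) (fun k => by fun_prop)
      have h2 := h1.indepFun_finsetSum_of_notMem₀
        (fun k => (hW.aemeasurable_mul_sq (w := w) (d := d) k)) (s := Finset.range N) (i := N)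
        (by simp)
      have h3 : Z = ∑ j ∈ Finset.range N, (fun x => w j * x ^ 2) ∘ W (d j) := by
        ext ω
        simp [hZ]
      rw [h3]
      exact h2
    have hpow : ∀ i j : ℕ, IndepFun (fun ω => Z ω ^ i) (fun ω => Y ω ^ j) P := fun i j =>
      hZY.comp (φ := fun x => x ^ i) (ψ := fun x => x ^ j) (by fun_prop) (by fun_prop)
    have hmulint : ∀ i j : ℕ, Integrable (fun ω => Z ω ^ i * Y ω ^ j) P := fun i j =>
      (hpow i j).integrable_mul (ih1 i) (hYint j)
    have hexp : ∀ p : ℕ, (fun ω => (∑ k ∈ Finset.range (N + 1), w k * W (d k) ω ^ 2) ^ p) =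
        fun ω => ∑ m ∈ Finset.range (p + 1), Z ω ^ m * Y ω ^ (p - m) * (p.choose m : ℝ) := by
      intro p
      ext ω
      rw [Finset.sum_range_succ]
      exact add_pow _ _ _
    constructor
    · intro p
      rw [hexp]
      exact integrable_finsetSum _ fun m _ => (hmulint m (p - m)).mul_const _
    · rw [Finset.prod_range_succ, ← ih2]
      ext p
      rw [PowerSeries.coeff_mk, PowerSeries.coeff_mul,
        Finset.Nat.sum_antidiagonal_eq_sum_range_succ_mk, hexp,
        integral_finsetSum _ fun m _ => (hmulint m (p - m)).mul_const _, Finset.sum_div]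
      refine Finset.sum_congr rfl fun m hm => ?_
      have hmp : m ≤ p := Nat.lt_succ_iff.1 (Finset.mem_range.1 hm)
      rw [integral_mul_const, (hpow m (p - m)).integral_fun_mul_eq_mul_integral
        (ih1 m).1 (hYint (p - m)).1, hYmom, singleSeries, PowerSeries.coeff_mk, PowerSeries.coeff_mk,
        Nat.cast_choose ℝ hmp]
      have h1 : (p.factorial : ℝ) ≠ 0 := by positivity
      have h2 : (m.factorial : ℝ) ≠ 0 := by positivity
      have h3 : ((p - m).factorial : ℝ) ≠ 0 := by positivity
      field_simp
      simp only [hZ]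
      ring

theorem derivative_prod_singleSeries (v : ℕ → ℝ) (N : ℕ) :
    PowerSeries.derivative ℝ (∏ k ∈ Finset.range N, singleSeries (v k)) =
      (∑ k ∈ Finset.range N, singleCumulant (v k)) * ∏ k ∈ Finset.range N, singleSeries (v k) := by
  induction N with
  | zero => simp
  | succ N ih =>
    rw [Finset.prod_range_succ, Finset.sum_range_succ, Derivation.leibniz, ih,
      derivative_singleSeries, smul_eq_mul, smul_eq_mul]
    ring

/-- Logarithmic derivatives add up over the factors, and comparing coefficients gives precisely the
recursion of the complete Bell polynomials. -/
theorem IsWhiteNoise.integral_sum_pow (hW : IsWhiteNoise W P)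
    (horth : ∀ i j, i ≠ j → inner ℝ (d i) (d j) = (0 : ℝ)) (N p : ℕ) :
    ∫ ω, (∑ k ∈ Finset.range N, w k * W (d k) ω ^ 2) ^ p ∂P =
      completeBell p fun l => 2 ^ (l - 1) * (l - 1).factorial *
        ∑ k ∈ Finset.range N, (w k * ‖d k‖ ^ 2) ^ l := by
  have hP := hW.gaussian.isProbabilityMeasure
  obtain ⟨-, hser⟩ := hW.integrable_sum_and_moments (w := w) horth N
  have hder := derivative_prod_singleSeries (fun k => w k * ‖d k‖ ^ 2) N
  rw [← hser] at hder
  rw [← eq_completeBell_of_recursion (c := fun p =>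
    (∫ ω, (∑ k ∈ Finset.range N, w k * W (d k) ω ^ 2) ^ p ∂P) / p.factorial) (by simp) (fun p => ?_)]
  · have h1 : (p.factorial : ℝ) ≠ 0 := by positivity
    field_simp
  · have h := congrArg (PowerSeries.coeff p) hder
    rw [PowerSeries.coeff_derivative, PowerSeries.coeff_mul,
      Finset.Nat.sum_antidiagonal_eq_sum_range_succ_mk] at h
    have hc : ∀ j, PowerSeries.coeff j (∑ k ∈ Finset.range N, singleCumulant (w k * ‖d k‖ ^ 2)) =
        2 ^ j * ∑ k ∈ Finset.range N, (w k * ‖d k‖ ^ 2) ^ (j + 1) := fun j => by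
      rw [_root_.map_sum, Finset.mul_sum]
      exact Finset.sum_congr rfl fun k _ => by rw [singleCumulant, PowerSeries.coeff_mk]
    simp only [PowerSeries.coeff_mk, hc] at h
    rw [mul_comm, h]
    refine Finset.sum_congr rfl fun j _ => ?_
    have h1 : (j.factorial : ℝ) ≠ 0 := by positivity
    rw [Nat.add_sub_cancel]
    field_simp

theorem IsWhiteNoise.lintegral_quadForm_pow (hW : IsWhiteNoise W P) (hw : ∀ k, 0 ≤ w k)
    (horth : ∀ i j, i ≠ j → inner ℝ (d i) (d j) = (0 : ℝ))
    (hs : ∀ l, 1 ≤ l → Summable fun k => (w k * ‖d k‖ ^ 2) ^ l) (p : ℕ) :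
    ∫⁻ ω, ENNReal.ofReal (quadForm W w d ω ^ p) ∂P =
      ENNReal.ofReal (completeBell p fun l => 2 ^ (l - 1) * (l - 1).factorial *
        ∑' k, (w k * ‖d k‖ ^ 2) ^ l) := by
  have hs1 : Summable fun k => w k * ‖d k‖ ^ 2 := by simpa using hs 1 le_rfl
  have hnn : ∀ N ω, 0 ≤ ∑ k ∈ Finset.range N, w k * W (d k) ω ^ 2 := fun N ω =>
    Finset.sum_nonneg fun k _ => mul_nonneg (hw k) (sq_nonneg _)
  have hlim : Tendsto (fun N => ∫⁻ ω, ENNReal.ofReal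
      ((∑ k ∈ Finset.range N, w k * W (d k) ω ^ 2) ^ p) ∂P) atTop
      (𝓝 (∫⁻ ω, ENNReal.ofReal (quadForm W w d ω ^ p) ∂P)) := by
    refine lintegral_tendsto_of_tendsto_of_monotone (fun N => ?_) ?_ ?_
    · exact ((Finset.aemeasurable_fun_sum (Finset.range N)
        fun k _ => hW.aemeasurable_mul_sq k).pow_const _).ennreal_ofReal
    · refine Eventually.of_forall fun ω N M hNM => ?_
      dsimp only
      have := hnn N ω
      gcongr
      exact fun k _ _ => mul_nonneg (hw k) (sq_nonneg _)
    · filter_upwards [hW.ae_summable hw hs1] with ω hω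
      exact ENNReal.tendsto_ofReal (hω.hasSum.tendsto_sum_nat.pow p)
  refine tendsto_nhds_unique hlim ?_
  have h1 : ∀ N, ∫⁻ ω, ENNReal.ofReal ((∑ k ∈ Finset.range N, w k * W (d k) ω ^ 2) ^ p) ∂P =
      ENNReal.ofReal (completeBell p fun l => 2 ^ (l - 1) * (l - 1).factorial *
        ∑ k ∈ Finset.range N, (w k * ‖d k‖ ^ 2) ^ l) := by
    intro N
    rw [← hW.integral_sum_pow horth, ofReal_integral_eq_lintegral_ofReal
      ((hW.integrable_sum_and_moments horth N).1 p)
      (Eventually.of_forall fun ω => pow_nonneg (hnn N ω) p)]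
  simp_rw [h1]
  refine ENNReal.tendsto_ofReal (tendsto_completeBell p fun l hl => ?_)
  exact ((hs l hl).hasSum.tendsto_sum_nat).const_mul _

end Moments

end HeatPV

namespace HeatPV

/-! ### Grid increments of the solution -/

variable {Ω : Type*} [MeasurableSpace Ω] {P : Measure Ω}
  {W : Lp ℝ 2 spaceTimeMeasure → Ω → ℝ}

/-- The left endpoint of the `i`-th time step, `i ≥ 1`, of the grid with mesh size `δ`. -/
noncomputable def gridPoint (δ : ℝ) (i : ℕ) : ℝ := ((i - 1 : ℕ) : ℝ) * δ

/-- Truncated subtraction makes this true at i = 0 as well, so the norm estimates need no condition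
on i. -/
theorem gridPoint_nonneg {δ : ℝ} (hδ : 0 ≤ δ) (i : ℕ) : 0 ≤ gridPoint δ i :=
  mul_nonneg (Nat.cast_nonneg _) hδ

theorem gridPoint_eq (δ : ℝ) {i : ℕ} (hi : 1 ≤ i) : gridPoint δ i = ((i : ℝ) - 1) * δ := by
  rw [gridPoint, Nat.cast_sub hi, Nat.cast_one]

theorem gridPoint_add (δ : ℝ) {i : ℕ} (hi : 1 ≤ i) : gridPoint δ i + δ = (i : ℝ) * δ := by
  rw [gridPoint_eq δ hi]; ring

/-- The weights `λ_k ^ r / τ(r)²` of the squared normalized `H_r`-norm. -/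
noncomputable def weight (r δ : ℝ) (k : ℕ) : ℝ := eigenvalue k ^ r / tau r δ ^ 2

theorem weight_nonneg (r δ : ℝ) (k : ℕ) : 0 ≤ weight r δ k :=
  div_nonneg (eigenvalue_rpow_pos r k).le (sq_nonneg _)

/-- The element of `L²` whose Wiener integral is the `k`-th coefficient of the `i`-th increment of
the solution. -/
noncomputable def heatStep (δ : ℝ) (i k : ℕ) : Lp ℝ 2 spaceTimeMeasure :=
  heatIncr k (gridPoint δ i) (gridPoint δ i + δ)

/-- The element of `L²` whose Wiener integral is the `k`-th coefficient of the `i`-th increment of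
the noise. -/
noncomputable def noiseStep (δ : ℝ) (i k : ℕ) : Lp ℝ 2 spaceTimeMeasure :=
  noiseMode k (gridPoint δ i) (gridPoint δ i + δ)

theorem norm_sq_heatStep_le {δ : ℝ} (hδ : 0 ≤ δ) (i k : ℕ) :
    ‖heatStep δ i k‖ ^ 2 ≤ incrVar k δ := by
  have h := norm_sq_heatIncr_le k (gridPoint_nonneg hδ i) (le_add_of_nonneg_right hδ)
  rwa [add_sub_cancel_left] at h

theorem norm_sq_noiseStep {δ : ℝ} (hδ : 0 ≤ δ) (i k : ℕ) : ‖noiseStep δ i k‖ ^ 2 = δ := by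
  have h := norm_sq_noiseMode k (gridPoint_nonneg hδ i) (le_add_of_nonneg_right hδ)
  rwa [add_sub_cancel_left] at h

theorem norm_sq_heatStep_sub_noiseStep_le {δ : ℝ} (hδ : 0 ≤ δ) (i k : ℕ) :
    ‖heatStep δ i k - noiseStep δ i k‖ ^ 2 ≤ δ - incrVar k δ := by
  have h := norm_sq_heatIncr_sub_noiseMode_le k (gridPoint_nonneg hδ i)
    (le_add_of_nonneg_right hδ)
  rwa [add_sub_cancel_left] at h

/-- The defect from stationarity at step i is geometric, of ratio E² with E = e^{-λ_kδ}, and its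
prefactor (1 - E)/2 bounds the sum independently of the number of steps. Multiplied by the mesh, it
disappears from the averages. -/
theorem sum_incrVar_sub_norm_sq_heatStep_le {δ : ℝ} (hδ : 0 ≤ δ) (k N : ℕ) :
    ∑ i ∈ Finset.Icc 1 N, (incrVar k δ - ‖heatStep δ i k‖ ^ 2) ≤ incrVar k δ := by
  have hl := eigenvalue_pos k
  set E : ℝ := Real.exp (-(eigenvalue k * δ)) with hE
  have hE0 : 0 ≤ E := (Real.exp_pos _).le
  have hE1 : E ≤ 1 := Real.exp_le_one_iff.2 (by have := mul_nonneg hl.le hδ; linarith)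
  have hterm : ∀ i, incrVar k δ - ‖heatStep δ i k‖ ^ 2 =
      incrVar k δ * ((1 - E) / 2 * (E ^ 2) ^ (i - 1)) := by
    intro i
    have h1 : Real.exp (-(2 * eigenvalue k * gridPoint δ i)) = (E ^ 2) ^ (i - 1) := by
      rw [hE, ← pow_mul, ← Real.exp_nat_mul]
      congr 1
      rw [gridPoint]
      push_cast
      ring
    rw [heatStep, norm_sq_heatIncr k (gridPoint_nonneg hδ i) (le_add_of_nonneg_right hδ),
      add_sub_cancel_left, h1, ← hE, incrVar, ← hE]
    field_simp
    ring
  have hgeom : (1 - E) * ∑ j ∈ Finset.range N, (E ^ 2) ^ j ≤ 1 := by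
    calc (1 - E) * ∑ j ∈ Finset.range N, (E ^ 2) ^ j
        ≤ (1 - E) * ∑ j ∈ Finset.range N, E ^ j := by
          refine mul_le_mul_of_nonneg_left (Finset.sum_le_sum fun j _ => ?_) (by linarith)
          exact pow_le_pow_left₀ (sq_nonneg _) (by nlinarith) _
      _ = 1 - E ^ N := by rw [mul_comm, geom_sum_mul_neg]
      _ ≤ 1 := by linarith [pow_nonneg hE0 N]
  have hsum : ∑ i ∈ Finset.Icc 1 N, (E ^ 2) ^ (i - 1) = ∑ j ∈ Finset.range N, (E ^ 2) ^ j := by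
    induction N with
    | zero => simp
    | succ N ih =>
      rw [Finset.sum_Icc_succ_top (by omega), Finset.sum_range_succ, Nat.add_sub_cancel, ih ?_]
      -- The bound `hgeom` depends on N and is carried through the induction, so the hypothesis
      -- needs it for the shorter sum.
      exact (mul_le_mul_of_nonneg_left (Finset.sum_le_sum_of_subset_of_nonneg
        (Finset.range_subset_range.2 N.le_succ) fun j _ _ => by positivity) (by linarith)).trans hgeom
  simp_rw [hterm]
  rw [← Finset.mul_sum, ← Finset.mul_sum, hsum]
  have h0 := incrVar_nonneg k hδ
  nlinarith

theorem weight_mul_incrVar (r δ : ℝ) (k : ℕ) :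
    weight r δ k * incrVar k δ = eigenvalue k ^ r * incrVar k δ / tau r δ ^ 2 := by
  rw [weight]; ring

theorem summable_weight_mul_incrVar {r δ : ℝ} (hr : r < 1 / 2) (hδ : 0 ≤ δ) :
    Summable fun k => weight r δ k * incrVar k δ := by
  simp_rw [weight_mul_incrVar]
  exact (summable_energy hr hδ).div_const _

theorem tsum_weight_mul_incrVar (r δ : ℝ) :
    ∑' k, weight r δ k * incrVar k δ = energy r δ / tau r δ ^ 2 := by
  simp_rw [weight_mul_incrVar]
  exact tsum_div_const

theorem summable_heatStep {r δ : ℝ} (hr : r < 1 / 2) (hδ : 0 ≤ δ) (i : ℕ) :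
    Summable fun k => weight r δ k * ‖heatStep δ i k‖ ^ 2 :=
  Summable.of_nonneg_of_le (fun k => mul_nonneg (weight_nonneg r δ k) (sq_nonneg _))
    (fun k => mul_le_mul_of_nonneg_left (norm_sq_heatStep_le hδ i k) (weight_nonneg r δ k))
    (summable_weight_mul_incrVar hr hδ)

theorem tsum_heatStep_le {r δ : ℝ} (hr : r < 1 / 2) (hδ : 0 ≤ δ) (i : ℕ) :
    ∑' k, weight r δ k * ‖heatStep δ i k‖ ^ 2 ≤ energy r δ / tau r δ ^ 2 := by
  rw [← tsum_weight_mul_incrVar]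
  exact (summable_heatStep hr hδ i).tsum_le_tsum
    (fun k => mul_le_mul_of_nonneg_left (norm_sq_heatStep_le hδ i k) (weight_nonneg r δ k))
    (summable_weight_mul_incrVar hr hδ)

theorem sum_energy_sub_tsum_heatStep_le {r δ : ℝ} (hr : r < 1 / 2) (hδ : 0 ≤ δ) (N : ℕ) :
    ∑ i ∈ Finset.Icc 1 N, (energy r δ / tau r δ ^ 2 -
      ∑' k, weight r δ k * ‖heatStep δ i k‖ ^ 2) ≤ energy r δ / tau r δ ^ 2 := by
  have hs := summable_weight_mul_incrVar hr hδ
  have hd : ∀ i, Summable fun k => weight r δ k * (incrVar k δ - ‖heatStep δ i k‖ ^ 2) := fun i =>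
    by simpa only [mul_sub] using hs.sub (summable_heatStep hr hδ i)
  have h1 : ∀ i, energy r δ / tau r δ ^ 2 - ∑' k, weight r δ k * ‖heatStep δ i k‖ ^ 2 =
      ∑' k, weight r δ k * (incrVar k δ - ‖heatStep δ i k‖ ^ 2) := fun i => by
    rw [← tsum_weight_mul_incrVar, ← hs.tsum_sub (summable_heatStep hr hδ i)]
    simp_rw [mul_sub]
  simp_rw [h1]
  rw [← Summable.tsum_finsetSum fun i _ => hd i, ← tsum_weight_mul_incrVar]
  refine Summable.tsum_le_tsum (fun k => ?_) (summable_sum fun i _ => hd i) hs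
  rw [← Finset.mul_sum]
  exact mul_le_mul_of_nonneg_left (sum_incrVar_sub_norm_sq_heatStep_le hδ k N)
    (weight_nonneg r δ k)

/-- The squared `H_r`-norm of the `i`-th increment of the solution, normalized by `τ(r)²`. -/
noncomputable def stepEnergy {Ω : Type*} (W : Lp ℝ 2 spaceTimeMeasure → Ω → ℝ) (r δ : ℝ) (i : ℕ)
    (ω : Ω) : ℝ :=
  quadForm W (weight r δ) (heatStep δ i) ω

theorem stepEnergy_nonneg {Ω : Type*} {W : Lp ℝ 2 spaceTimeMeasure → Ω → ℝ} (r δ : ℝ) (i : ℕ)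
    (ω : Ω) : 0 ≤ stepEnergy W r δ i ω :=
  quadForm_nonneg (weight_nonneg r δ) ω

theorem IsWhiteNoise.aemeasurable_stepEnergy (hW : IsWhiteNoise W P) {r δ : ℝ} (hr : r < 1 / 2)
    (hδ : 0 ≤ δ) (i : ℕ) : AEMeasurable (stepEnergy W r δ i) P :=
  hW.aemeasurable_quadForm (weight_nonneg r δ) (summable_heatStep hr hδ i)

theorem tendsto_nhdsGT_of_pos {Δ : ℕ → ℝ} (hpos : ∀ n, 0 < Δ n) (hlim : Tendsto Δ atTop (𝓝 0)) :
    Tendsto Δ atTop (𝓝[>] 0) :=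
  tendsto_nhdsWithin_iff.2 ⟨hlim, Eventually.of_forall hpos⟩

theorem IsWhiteNoise.exists_lintegral_stepEnergy_pow_le [IsProbabilityMeasure P]
    (hW : IsWhiteNoise W P) {r c : ℝ} (hr : r < 1 / 2) {Δ : ℕ → ℝ} (hpos : ∀ n, 0 < Δ n)
    (hc : Tendsto (fun n => energy r (Δ n) / tau r (Δ n) ^ 2) atTop (𝓝 c)) (m : ℕ) :
    ∃ C : ℝ, ∀ᶠ n in atTop, ∀ i, 1 ≤ i →
      ∫⁻ ω, ENNReal.ofReal (stepEnergy W r (Δ n) i ω ^ m) ∂P ≤ ENNReal.ofReal C := by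
  refine ⟨(c + 1) ^ m * gaussianMoment m, ?_⟩
  filter_upwards [hc.eventually (ge_mem_nhds (lt_add_one c))] with n hn i _
  refine (hW.lintegral_quadForm_pow_le (weight_nonneg r _)
    (summable_heatStep hr (hpos n).le i) m).trans (ENNReal.ofReal_le_ofReal ?_)
  refine mul_le_mul_of_nonneg_right (pow_le_pow_left₀ ?_ ?_ m) (gaussianMoment_nonneg m)
  · exact tsum_nonneg fun k => mul_nonneg (weight_nonneg r _ k) (sq_nonneg _)
  · exact (tsum_heatStep_le hr (hpos n).le i).trans hn

theorem lintegral_riemannAvg_le_riemannAvg {δ t : ℝ} (hδ : 0 < δ) {B : ℕ → Ω → ℝ} {b : ℕ → ℝ}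
    (hB0 : ∀ i ω, 0 ≤ B i ω) (hB : ∀ i, AEMeasurable (B i) P) (hb0 : ∀ i, 0 ≤ b i)
    (hb : ∀ i, ∫⁻ ω, ENNReal.ofReal (B i ω) ∂P ≤ ENNReal.ofReal (b i)) :
    ∫⁻ ω, ENNReal.ofReal (riemannAvg δ t fun i => B i ω) ∂P ≤
      ENNReal.ofReal (riemannAvg δ t b) := by
  rw [lintegral_riemannAvg hδ hB0 hB, riemannAvg, ENNReal.ofReal_mul hδ.le,
    ENNReal.ofReal_sum_of_nonneg fun i _ => hb0 i]
  gcongr with i _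
  exact hb i

theorem abs_riemannAvg_const_sub_le {δ t c : ℝ} (hδ : 0 < δ) (ht : 0 ≤ t) (hc : 0 ≤ c) :
    |riemannAvg δ t (fun _ => c) - c * t| ≤ c * δ := by
  have h : riemannAvg δ t (fun _ => c) - c * t = c * (δ * ⌊t / δ⌋₊ - t) := by
    rw [riemannAvg, Finset.sum_const, Nat.card_Icc, Nat.add_sub_cancel, nsmul_eq_mul]
    ring
  rw [h, abs_mul, abs_of_nonneg hc]
  exact mul_le_mul_of_nonneg_left (abs_mul_floor_sub_le hδ ht) hc

theorem riemannAvg_const_le {δ t c : ℝ} (hδ : 0 < δ) (ht : 0 ≤ t) (hc : 0 ≤ c) :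
    riemannAvg δ t (fun _ => c) ≤ c * t := by
  rw [riemannAvg, Finset.sum_const, Nat.card_Icc, Nat.add_sub_cancel, nsmul_eq_mul]
  nlinarith [mul_floor_le hδ ht]

/-- The three errors are the fluctuation of the step energy, the distance of the stationary mean
from c, and the defect from stationarity. -/
theorem IsWhiteNoise.lintegral_abs_stepEnergy_sub_le (hW : IsWhiteNoise W P) {r δ B : ℝ}
    (hr : r < 1 / 2) (hδ : 0 < δ) (hB : ∀ k, eigenvalue k ^ r * incrVar k δ ≤ B) (c : ℝ) (i : ℕ) :
    ∫⁻ ω, ENNReal.ofReal |stepEnergy W r δ i ω - c| ∂P ≤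
      ENNReal.ofReal (Real.sqrt (2 * (B / tau r δ ^ 2 * (energy r δ / tau r δ ^ 2))) +
        |energy r δ / tau r δ ^ 2 - c| +
        (energy r δ / tau r δ ^ 2 - ∑' k, weight r δ k * ‖heatStep δ i k‖ ^ 2)) := by
  have hP := hW.gaussian.isProbabilityMeasure
  set e := energy r δ / tau r δ ^ 2 with he
  set m := ∑' k, weight r δ k * ‖heatStep δ i k‖ ^ 2 with hm
  have hme : m ≤ e := tsum_heatStep_le hr hδ.le i
  have hB0 : 0 ≤ B :=
    (mul_nonneg (eigenvalue_rpow_pos r 0).le (incrVar_nonneg 0 hδ.le)).trans (hB 0)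
  have h1 : ∫⁻ ω, ENNReal.ofReal |stepEnergy W r δ i ω - m| ∂P ≤
      ENNReal.ofReal (Real.sqrt (2 * (B / tau r δ ^ 2 * e))) := by
    refine (hW.lintegral_abs_quadForm_sub_le (weight_nonneg r δ)
      (fun k l hkl => inner_heatIncr_of_ne hkl _ _ _ _) (summable_heatStep hr hδ.le i)
      (B := B / tau r δ ^ 2) fun k => ?_).trans (ENNReal.ofReal_le_ofReal ?_)
    · calc weight r δ k * ‖heatStep δ i k‖ ^ 2 ≤ weight r δ k * incrVar k δ :=
          mul_le_mul_of_nonneg_left (norm_sq_heatStep_le hδ.le i k) (weight_nonneg r δ k)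
        _ ≤ B / tau r δ ^ 2 := by
          rw [weight_mul_incrVar]
          exact div_le_div_of_nonneg_right (hB k) (sq_nonneg _)
    · gcongr
      exact hme
  calc _ ≤ ∫⁻ ω, (ENNReal.ofReal |stepEnergy W r δ i ω - m| +
        ENNReal.ofReal (|e - c| + (e - m))) ∂P := by
        refine lintegral_mono fun ω => ?_
        rw [← ENNReal.ofReal_add (abs_nonneg _) (by positivity)]
        refine ENNReal.ofReal_le_ofReal ?_
        have h2 := abs_sub_le (stepEnergy W r δ i ω) m c
        have h3 := abs_sub_le m e c
        rw [abs_sub_comm m e, abs_of_nonneg (sub_nonneg.2 hme)] at h3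
        linarith
    _ ≤ ENNReal.ofReal (Real.sqrt (2 * (B / tau r δ ^ 2 * e))) +
        ENNReal.ofReal (|e - c| + (e - m)) := by
        rw [lintegral_add_right _ measurable_const, lintegral_const, measure_univ, mul_one]
        gcongr
    _ = _ := by
        rw [← ENNReal.ofReal_add (Real.sqrt_nonneg _) (by have := sub_nonneg.2 hme; positivity),
          add_assoc]

/-- Law of large numbers for the step energies if the contribution of each mode is negligible. -/
theorem IsWhiteNoise.tendsto_riemannAvg_stepEnergy_of_ge [IsProbabilityMeasure P]
    (hW : IsWhiteNoise W P) {r c : ℝ} (hr : -1 / 2 ≤ r) (hr' : r < 1 / 2) {Δ : ℕ → ℝ}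
    (hpos : ∀ n, 0 < Δ n) (hlim : Tendsto Δ atTop (𝓝 0))
    (hc : Tendsto (fun n => energy r (Δ n) / tau r (Δ n) ^ 2) atTop (𝓝 c)) (p : ℕ) {t : ℝ}
    (ht : 0 ≤ t) :
    Tendsto (fun n => ∫⁻ ω, ENNReal.ofReal
      |riemannAvg (Δ n) t (fun i => stepEnergy W r (Δ n) i ω ^ p) - c ^ p * t| ∂P)
      atTop (𝓝 0) := by
  have hc0 : 0 ≤ c := ge_of_tendsto' hc fun n => div_nonneg (energy_nonneg r (hpos n).le)
    (sq_nonneg _)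
  have hAm : ∀ n i, AEMeasurable (stepEnergy W r (Δ n) i) P := fun n i =>
    hW.aemeasurable_stepEnergy hr' (hpos n).le i
  obtain ⟨B, hB, hBlim⟩ := exists_bound_mul_incrVar hr hr'
  replace hBlim := hBlim.comp (tendsto_nhdsGT_of_pos hpos hlim)
  have hclose : Tendsto (fun n => ∫⁻ ω, ENNReal.ofReal
      (riemannAvg (Δ n) t (fun i => |stepEnergy W r (Δ n) i ω - c|)) ∂P) atTop (𝓝 0) := by
    -- The last summand collects the defects from stationarity: over all steps they total at most
    -- one normalized energy, and the average multiplies this by the mesh.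
    have hbound : Tendsto (fun n => (Real.sqrt (2 * (B (Δ n) / tau r (Δ n) ^ 2 *
        (energy r (Δ n) / tau r (Δ n) ^ 2))) + |energy r (Δ n) / tau r (Δ n) ^ 2 - c|) * t +
        Δ n * (energy r (Δ n) / tau r (Δ n) ^ 2)) atTop (𝓝 0) := by
      have h1 := ((((hBlim.mul hc).const_mul 2).sqrt.add (hc.sub_const c).abs).mul_const t).add
        (hlim.mul hc)
      simpa using h1
    have hbound' := ENNReal.tendsto_ofReal hbound
    rw [ENNReal.ofReal_zero] at hbound'
    refine tendsto_of_tendsto_of_tendsto_of_le_of_le tendsto_const_nhds hbound'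
      (fun _ => zero_le) fun n => ?_
    dsimp only
    refine (lintegral_riemannAvg_le_riemannAvg (hpos n) (fun i ω => abs_nonneg _)
      (fun i => ((hAm n i).sub_const c).norm) (fun i => ?_) (fun i =>
      hW.lintegral_abs_stepEnergy_sub_le hr' (hpos n) (hB _ (hpos n)) c i)).trans
      (ENNReal.ofReal_le_ofReal ?_)
    · have := sub_nonneg.2 (tsum_heatStep_le hr' (hpos n).le i)
      positivity
    · set s := Real.sqrt (2 * (B (Δ n) / tau r (Δ n) ^ 2 *
        (energy r (Δ n) / tau r (Δ n) ^ 2))) + |energy r (Δ n) / tau r (Δ n) ^ 2 - c|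
      have hs : 0 ≤ s := by positivity
      have h1 := riemannAvg_const_le (hpos n) ht hs
      have h2 := mul_le_mul_of_nonneg_left
        (sum_energy_sub_tsum_heatStep_le hr' (hpos n).le ⌊t / Δ n⌋₊) (hpos n).le
      simp only [riemannAvg] at h1 ⊢
      rw [Finset.sum_add_distrib, mul_add]
      linarith
  -- The comparison is with a constant, so correlations between time steps play no role.
  have hpow := tendsto_lintegral_riemannAvg_abs_pow_sub (P := P) (B := fun _ _ _ => c) hpos
    (fun n i ω => stepEnergy_nonneg r (Δ n) i ω) hAm (fun _ _ _ => hc0)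
    (fun _ _ => aemeasurable_const) (hW.exists_lintegral_stepEnergy_pow_le hr' hpos hc)
    (fun m => ⟨c ^ m, Eventually.of_forall fun n i _ => by simp⟩) ht hclose p
  refine tendsto_lintegral_abs_riemannAvg_sub hpos (fun n i => (hAm n i).pow_const p)
    (fun _ _ => aemeasurable_const) hpow ?_
  have h0 := ENNReal.tendsto_ofReal (hlim.const_mul (c ^ p))
  rw [mul_zero, ENNReal.ofReal_zero] at h0
  refine tendsto_of_tendsto_of_tendsto_of_le_of_le tendsto_const_nhds h0 (fun _ => zero_le)
    fun n => ?_
  dsimp only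
  rw [lintegral_const, measure_univ, mul_one]
  exact ENNReal.ofReal_le_ofReal (abs_riemannAvg_const_sub_le (hpos n) ht (pow_nonneg hc0 p))

end HeatPV

namespace HeatPV

/-! ### Comparison with the noise -/

variable {Ω : Type*} [MeasurableSpace Ω] {P : Measure Ω}
  {W : Lp ℝ 2 spaceTimeMeasure → Ω → ℝ}

/-- The analogue of `stepEnergy` with the noise increments in place of those of the solution. -/
noncomputable def noiseEnergy {Ω : Type*} (W : Lp ℝ 2 spaceTimeMeasure → Ω → ℝ) (r δ : ℝ) (i : ℕ)
    (ω : Ω) : ℝ :=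
  quadForm W (weight r δ) (noiseStep δ i) ω

theorem noiseEnergy_nonneg {Ω : Type*} {W : Lp ℝ 2 spaceTimeMeasure → Ω → ℝ} (r δ : ℝ) (i : ℕ)
    (ω : Ω) : 0 ≤ noiseEnergy W r δ i ω :=
  quadForm_nonneg (weight_nonneg r δ) ω

theorem weight_mul_norm_sq_noiseStep {r δ : ℝ} (hr : r < -1 / 2) (hδ : 0 < δ) (i k : ℕ) :
    weight r δ k * ‖noiseStep δ i k‖ ^ 2 = eigenvalue k ^ r := by
  rw [norm_sq_noiseStep hδ.le, weight, tau_sq_of_lt hr hδ, div_mul_cancel₀ _ hδ.ne']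

theorem summable_noiseStep {r δ : ℝ} (hr : r < -1 / 2) (hδ : 0 < δ) (i : ℕ) :
    Summable fun k => weight r δ k * ‖noiseStep δ i k‖ ^ 2 := by
  simpa only [weight_mul_norm_sq_noiseStep hr hδ] using summable_eigenvalue_rpow hr

theorem IsWhiteNoise.aemeasurable_noiseEnergy (hW : IsWhiteNoise W P) {r δ : ℝ} (hr : r < -1 / 2)
    (hδ : 0 < δ) (i : ℕ) : AEMeasurable (noiseEnergy W r δ i) P :=
  hW.aemeasurable_quadForm (weight_nonneg r δ) (summable_noiseStep hr hδ i)

theorem IsWhiteNoise.lintegral_noiseEnergy_pow_le [IsProbabilityMeasure P]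
    (hW : IsWhiteNoise W P) {r δ : ℝ} (hr : r < -1 / 2) (hδ : 0 < δ) (i m : ℕ) :
    ∫⁻ ω, ENNReal.ofReal (noiseEnergy W r δ i ω ^ m) ∂P ≤
      ENNReal.ofReal ((∑' k, eigenvalue k ^ r) ^ m * gaussianMoment m) := by
  have h := hW.lintegral_quadForm_pow_le (weight_nonneg r δ) (summable_noiseStep hr hδ i) m
  simp only [weight_mul_norm_sq_noiseStep hr hδ] at h
  exact h

theorem tsum_eigenvalue_rpow_mul {r : ℝ} (hr : r < -1 / 2) {l : ℕ} (hl : 1 ≤ l) :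
    ∑' k, (eigenvalue k ^ r) ^ l = (riemannZeta ((-2 * (l : ℝ) * r : ℝ) : ℂ)).re := by
  have hl' : (1 : ℝ) ≤ l := by exact_mod_cast hl
  rw [zeta_eq_tsum_one_div_nat_add_one_cpow (by rw [Complex.ofReal_re]; nlinarith)]
  have h : ∀ k : ℕ, (1 : ℂ) / ((k : ℂ) + 1) ^ ((-2 * (l : ℝ) * r : ℝ) : ℂ) =
      (((eigenvalue k ^ r) ^ l : ℝ) : ℂ) := by
    intro k
    have hk : (0 : ℝ) ≤ (k : ℝ) + 1 := by positivity
    rw [← Nat.cast_add_one, ← Complex.ofReal_natCast, ← Complex.ofReal_cpow (by positivity),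
      ← Complex.ofReal_one, ← Complex.ofReal_div, eigenvalue_rpow, ← Real.rpow_natCast,
      ← Real.rpow_mul hk, one_div, ← Real.rpow_neg (by positivity)]
    push_cast
    ring_nf
  simp_rw [h]
  rw [← Complex.ofReal_tsum, Complex.ofReal_re]

theorem limitConst_of_lt {r : ℝ} (hr : r < -1 / 2) (p : ℕ) :
    limitConst r p = completeBell p fun l => 2 ^ (l - 1) * (l - 1).factorial *
      ∑' k, (eigenvalue k ^ r) ^ l := by
  rw [limitConst, if_pos hr, pow_mul_completeBell]
  refine completeBell_congr fun l hl => ?_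
  rw [tsum_eigenvalue_rpow_mul hr hl]
  obtain ⟨j, rfl⟩ : ∃ j, l = j + 1 := ⟨l - 1, by omega⟩
  rw [Nat.add_sub_cancel, pow_succ]
  ring

theorem limitConst_nonneg_of_lt {r : ℝ} (hr : r < -1 / 2) (p : ℕ) : 0 ≤ limitConst r p := by
  rw [limitConst_of_lt hr]
  refine Finset.sum_nonneg fun π _ => mul_nonneg (Nat.cast_nonneg _)
    (Finset.prod_nonneg fun j _ => ?_)
  have : 0 ≤ ∑' k, (eigenvalue k ^ r) ^ j :=
    tsum_nonneg fun k => pow_nonneg (eigenvalue_rpow_pos r k).le j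
  positivity

theorem IsWhiteNoise.lintegral_noiseEnergy_pow (hW : IsWhiteNoise W P) {r δ : ℝ}
    (hr : r < -1 / 2) (hδ : 0 < δ) (i p : ℕ) :
    ∫⁻ ω, ENNReal.ofReal (noiseEnergy W r δ i ω ^ p) ∂P = ENNReal.ofReal (limitConst r p) := by
  have hsum : ∀ l, 1 ≤ l →
      Summable fun k => (weight r δ k * ‖noiseStep δ i k‖ ^ 2) ^ l := by
    intro l hl
    have hl' : (1 : ℝ) ≤ l := by exact_mod_cast hl
    simp only [weight_mul_norm_sq_noiseStep hr hδ]
    have h : ∀ k, (eigenvalue k ^ r) ^ l = eigenvalue k ^ (r * l) := fun k => by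
      rw [Real.rpow_mul (eigenvalue_pos k).le, Real.rpow_natCast]
    simp_rw [h]
    exact summable_eigenvalue_rpow (by nlinarith)
  have h := hW.lintegral_quadForm_pow (d := noiseStep δ i) (weight_nonneg r δ)
    (fun k l hkl => inner_noiseMode_of_ne hkl _ _ _ _) hsum p
  simp only [weight_mul_norm_sq_noiseStep hr hδ] at h
  rw [limitConst_of_lt hr]
  exact h

theorem IsWhiteNoise.integrable_noiseEnergy_pow [IsProbabilityMeasure P] (hW : IsWhiteNoise W P)
    {r δ : ℝ} (hr : r < -1 / 2) (hδ : 0 < δ) (i p : ℕ) :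
    Integrable (fun ω => noiseEnergy W r δ i ω ^ p) P := by
  refine ⟨((hW.aemeasurable_noiseEnergy hr hδ i).pow_const p).aestronglyMeasurable, ?_⟩
  rw [hasFiniteIntegral_iff_ofReal
    (Eventually.of_forall fun ω => pow_nonneg (noiseEnergy_nonneg r δ i ω) p)]
  exact (hW.lintegral_noiseEnergy_pow_le hr hδ i p).trans_lt ENNReal.ofReal_lt_top

theorem IsWhiteNoise.integral_noiseEnergy_pow [IsProbabilityMeasure P] (hW : IsWhiteNoise W P)
    {r δ : ℝ} (hr : r < -1 / 2) (hδ : 0 < δ) (i p : ℕ) :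
    ∫ ω, noiseEnergy W r δ i ω ^ p ∂P = limitConst r p := by
  have h0 : ∀ ω, 0 ≤ noiseEnergy W r δ i ω ^ p :=
    fun ω => pow_nonneg (noiseEnergy_nonneg r δ i ω) p
  rw [integral_eq_lintegral_of_nonneg_ae (Eventually.of_forall h0)
    (hW.integrable_noiseEnergy_pow hr hδ i p).1, hW.lintegral_noiseEnergy_pow hr hδ,
    ENNReal.toReal_ofReal (limitConst_nonneg_of_lt hr p)]

theorem disjoint_grid {δ : ℝ} (hδ : 0 < δ) {i j : ℕ} (hi : 1 ≤ i) (hij : i < j) :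
    Disjoint (Set.Ioc (gridPoint δ i) (gridPoint δ i + δ))
      (Set.Ioc (gridPoint δ j) (gridPoint δ j + δ)) := by
  rw [Set.Ioc_disjoint_Ioc]
  refine (min_le_left _ _).trans (le_trans ?_ (le_max_right _ _))
  rw [gridPoint_add δ hi, gridPoint_eq δ (hi.trans hij.le)]
  have : (i : ℝ) + 1 ≤ j := by exact_mod_cast hij
  nlinarith

/-- Disjoint time intervals make the two sequences of noise modes orthogonal blocks. Replacing the
solution by the noise for r < -1/2 is meant to gain exactly this independence. -/
theorem IsWhiteNoise.indepFun_noiseEnergy (hW : IsWhiteNoise W P) (r : ℝ) {δ : ℝ} (hδ : 0 < δ)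
    {i j : ℕ} (hi : 1 ≤ i) (hj : 1 ≤ j) (hij : i ≠ j) :
    IndepFun (noiseEnergy W r δ i) (noiseEnergy W r δ j) P := by
  have hdisj : Disjoint (Set.Ioc (gridPoint δ i) (gridPoint δ i + δ))
      (Set.Ioc (gridPoint δ j) (gridPoint δ j + δ)) := by
    rcases lt_or_gt_of_ne hij with h | h
    · exact disjoint_grid hδ hi h
    · exact (disjoint_grid hδ hj h).symm
  have hind := hW.iIndepFun (T := Bool)
    (fun b k => noiseStep δ (if b then i else j) k) (fun a b hab k l => by
      cases a <;> cases b <;> simp only [ne_eq, not_true_eq_false] at hab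
      · exact inner_noiseMode_of_disjoint k l hdisj.symm
      · exact inner_noiseMode_of_disjoint k l hdisj)
  have hm : Measurable fun f : ℕ → ℝ => ∑' k, weight r δ k * f k ^ 2 :=
    Measurable.tsum fun k => ((measurable_pi_apply k).pow_const 2).const_mul _
  exact (hind.indepFun (i := true) (j := false) (by simp)).comp hm hm

/-- Law of large numbers for the powers of the noise energies. -/
theorem IsWhiteNoise.tendsto_riemannAvg_noiseEnergy [IsProbabilityMeasure P]
    (hW : IsWhiteNoise W P) {r : ℝ} (hr : r < -1 / 2) {Δ : ℕ → ℝ} (hpos : ∀ n, 0 < Δ n)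
    (hlim : Tendsto Δ atTop (𝓝 0)) (p : ℕ) {t : ℝ} (ht : 0 ≤ t) :
    Tendsto (fun n => ∫⁻ ω, ENNReal.ofReal
      |riemannAvg (Δ n) t (fun i => noiseEnergy W r (Δ n) i ω ^ p) - limitConst r p * t| ∂P)
      atTop (𝓝 0) := by
  set K := limitConst r p with hK
  have hK0 : 0 ≤ K := limitConst_nonneg_of_lt hr p
  -- M is the second moment of the p-th power of a noise energy, hence a bound for its variance.
  set M := limitConst r (p * 2) with hM
  have hbound : Tendsto (fun n => Real.sqrt (Δ n * (M * t)) + K * Δ n) atTop (𝓝 0) := by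
    simpa using (hlim.mul_const (M * t)).sqrt.add (hlim.const_mul K)
  have hbound' := ENNReal.tendsto_ofReal hbound
  rw [ENNReal.ofReal_zero] at hbound'
  refine tendsto_of_tendsto_of_tendsto_of_le_of_le tendsto_const_nhds hbound'
    (fun _ => zero_le) fun n => ?_
  have hδ := hpos n
  set δ := Δ n
  set X : ℕ → Ω → ℝ := fun i ω => noiseEnergy W r δ i ω ^ p with hX
  have hXmem : ∀ i, MemLp (X i) 2 P := fun i => by
    rw [memLp_two_iff_integrable_sq (hW.integrable_noiseEnergy_pow hr hδ i p).1]
    simp only [← pow_mul]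
    exact hW.integrable_noiseEnergy_pow hr hδ i (p * 2)
  set s := Finset.Icc 1 ⌊t / δ⌋₊
  set Y : Ω → ℝ := fun ω => riemannAvg δ t (fun i => X i ω) with hY
  have hYeq : Y = fun ω => δ * (∑ i ∈ s, X i) ω := by
    funext ω
    simp only [hY, riemannAvg, Finset.sum_apply, s]
  have hYmem : MemLp Y 2 P := by
    rw [hYeq]
    exact (memLp_finsetSum' s fun i _ => hXmem i).const_mul δ
  have hYint : ∫ ω, Y ω ∂P = riemannAvg δ t fun _ => K := by
    simp only [hY, riemannAvg]
    rw [integral_const_mul, integral_finsetSum _ fun i _ => (hXmem i).integrable (by norm_num)]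
    simp only [hX, hW.integral_noiseEnergy_pow hr hδ, hK]
  have hvar : Var[Y; P] ≤ δ * (M * t) := by
    rw [hYeq, variance_const_mul, IndepFun.variance_sum (fun i _ => hXmem i)]
    · have h1 : ∀ i ∈ s, Var[X i; P] ≤ M := fun i _ => by
        refine (variance_le_expectation_sq (hXmem i).1).trans (le_of_eq ?_)
        simp only [hX, Pi.pow_apply, ← pow_mul]
        exact hW.integral_noiseEnergy_pow hr hδ i (p * 2)
      have h2 := Finset.sum_le_sum h1
      have h3 := riemannAvg_const_le hδ ht (limitConst_nonneg_of_lt hr (p * 2))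
      calc δ ^ 2 * ∑ i ∈ s, Var[X i; P] ≤ δ ^ 2 * ∑ i ∈ s, M := by gcongr
        _ = δ * riemannAvg δ t fun _ => M := by rw [riemannAvg]; ring
        _ ≤ _ := by gcongr
    · intro i hi j hj hij
      exact (hW.indepFun_noiseEnergy r hδ (Finset.mem_Icc.1 hi).1 (Finset.mem_Icc.1 hj).1 hij).comp
        (φ := fun x => x ^ p) (ψ := fun x => x ^ p) (by fun_prop) (by fun_prop)
  have hmain := lintegral_abs_sub_integral_le hYmem
  calc _ ≤ ∫⁻ ω, (ENNReal.ofReal |Y ω - ∫ ω, Y ω ∂P| + ENNReal.ofReal (K * δ)) ∂P := by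
        refine lintegral_mono fun ω => ?_
        rw [← ENNReal.ofReal_add (abs_nonneg _) (by positivity)]
        refine ENNReal.ofReal_le_ofReal ?_
        have h1 := abs_riemannAvg_const_sub_le hδ ht hK0
        rw [← hYint] at h1
        have h2 := abs_sub_le (Y ω) (∫ ω, Y ω ∂P) (K * t)
        exact h2.trans (by linarith)
    _ ≤ ENNReal.ofReal (Real.sqrt (δ * (M * t))) + ENNReal.ofReal (K * δ) := by
        rw [lintegral_add_right _ measurable_const, lintegral_const, measure_univ, mul_one]
        gcongr
        exact hmain.trans (ENNReal.ofReal_le_ofReal (Real.sqrt_le_sqrt hvar))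
    _ = _ := (ENNReal.ofReal_add (Real.sqrt_nonneg _) (by positivity)).symm

/-- Mode by mode the squared distance of the increments is at most δ - `incrVar k δ`; its weighted
sum is the gap between ∑ λ_k^r and the normalized energy, which closes by `tendsto_energy_of_lt`. -/
theorem IsWhiteNoise.lintegral_abs_stepEnergy_sub_noiseEnergy_le (hW : IsWhiteNoise W P)
    {r δ ε : ℝ} (hr : r < -1 / 2) (hδ : 0 < δ) (hε : 0 < ε) (i : ℕ) :
    ∫⁻ ω, ENNReal.ofReal |stepEnergy W r δ i ω - noiseEnergy W r δ i ω| ∂P ≤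
      ENNReal.ofReal ((1 + ε⁻¹) * (∑' k, eigenvalue k ^ r - energy r δ / tau r δ ^ 2) +
        ε * ∑' k, eigenvalue k ^ r) := by
  have hr' : r < 1 / 2 := hr.trans (by norm_num)
  have hsum := (summable_eigenvalue_rpow hr).sub (summable_weight_mul_incrVar hr' hδ.le)
  have hle : ∀ k, weight r δ k * ‖heatStep δ i k - noiseStep δ i k‖ ^ 2 ≤
      eigenvalue k ^ r - weight r δ k * incrVar k δ := fun k => by
    have h := mul_le_mul_of_nonneg_left (norm_sq_heatStep_sub_noiseStep_le hδ.le i k)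
      (weight_nonneg r δ k)
    have h2 := weight_mul_norm_sq_noiseStep hr hδ i k
    rw [norm_sq_noiseStep hδ.le] at h2
    rwa [mul_sub, h2] at h
  have hs : Summable fun k => weight r δ k * ‖heatStep δ i k - noiseStep δ i k‖ ^ 2 :=
    Summable.of_nonneg_of_le (fun k => mul_nonneg (weight_nonneg r δ k) (sq_nonneg _)) hle hsum
  refine (hW.lintegral_abs_quadForm_sub_quadForm_le (weight_nonneg r δ)
    (summable_heatStep hr' hδ.le i) (summable_noiseStep hr hδ i) hs hε).trans
    (ENNReal.ofReal_le_ofReal ?_)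
  simp only [weight_mul_norm_sq_noiseStep hr hδ]
  have h := hs.tsum_le_tsum hle hsum
  rw [(summable_eigenvalue_rpow hr).tsum_sub (summable_weight_mul_incrVar hr' hδ.le),
    tsum_weight_mul_incrVar] at h
  gcongr

/-- Law of large numbers for the step energies if they are close to the noise energies. -/
theorem IsWhiteNoise.tendsto_riemannAvg_stepEnergy_of_lt [IsProbabilityMeasure P]
    (hW : IsWhiteNoise W P) {r : ℝ} (hr : r < -1 / 2) {Δ : ℕ → ℝ} (hpos : ∀ n, 0 < Δ n)
    (hlim : Tendsto Δ atTop (𝓝 0)) (p : ℕ) {t : ℝ} (ht : 0 ≤ t) :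
    Tendsto (fun n => ∫⁻ ω, ENNReal.ofReal
      |riemannAvg (Δ n) t (fun i => stepEnergy W r (Δ n) i ω ^ p) - limitConst r p * t| ∂P)
      atTop (𝓝 0) := by
  have hr' : r < 1 / 2 := hr.trans (by norm_num)
  have hc : Tendsto (fun n => energy r (Δ n) / tau r (Δ n) ^ 2) atTop
      (𝓝 (∑' k, eigenvalue k ^ r)) :=
    (tendsto_energy_of_lt hr).comp (tendsto_nhdsGT_of_pos hpos hlim)
  have hAm : ∀ n i, AEMeasurable (stepEnergy W r (Δ n) i) P := fun n i =>
    hW.aemeasurable_stepEnergy hr' (hpos n).le i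
  have hBm : ∀ n i, AEMeasurable (noiseEnergy W r (Δ n) i) P := fun n i =>
    hW.aemeasurable_noiseEnergy hr (hpos n) i
  set S := ∑' k, eigenvalue k ^ r with hS
  have hS0 : 0 ≤ S := tsum_nonneg fun k => (eigenvalue_rpow_pos r k).le
  have hclose : Tendsto (fun n => ∫⁻ ω, ENNReal.ofReal (riemannAvg (Δ n) t
      (fun i => |stepEnergy W r (Δ n) i ω - noiseEnergy W r (Δ n) i ω|)) ∂P) atTop (𝓝 0) := by
    refine tendsto_zero_of_forall_le fun η hη => ?_
    -- The term with ε does not vanish as n → ∞, so ε is chosen first; the gap multiplied by 1 + ε⁻¹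
    -- then tends to 0.
    obtain ⟨ε, hε, hεη⟩ : ∃ ε : ℝ, 0 < ε ∧ ε * S * t ≤ η := by
      refine ⟨η / (S * t + 1), by positivity, ?_⟩
      rw [div_mul_eq_mul_div, div_mul_eq_mul_div, div_le_iff₀ (by positivity)]
      nlinarith
    have hG : Tendsto (fun n => (1 + ε⁻¹) * |S - energy r (Δ n) / tau r (Δ n) ^ 2| * t) atTop
        (𝓝 0) := by
      simpa using (((hc.const_sub S).abs).const_mul (1 + ε⁻¹)).mul_const t
    have hG' := ENNReal.tendsto_ofReal hG
    rw [ENNReal.ofReal_zero] at hG'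
    refine ⟨_, hG', Eventually.of_forall fun n => ?_⟩
    refine (lintegral_riemannAvg_le_riemannAvg (hpos n)
      (b := fun _ => (1 + ε⁻¹) * |S - energy r (Δ n) / tau r (Δ n) ^ 2| + ε * S)
      (fun i ω => abs_nonneg _) (fun i => ((hAm n i).sub (hBm n i)).norm)
      (fun i => by positivity) (fun i =>
      (hW.lintegral_abs_stepEnergy_sub_noiseEnergy_le hr (hpos n) hε i).trans
        (ENNReal.ofReal_le_ofReal ?_))).trans ?_
    · gcongr
      exact le_abs_self _
    · rw [← ENNReal.ofReal_add hη.le (by positivity)]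
      refine ENNReal.ofReal_le_ofReal ((riemannAvg_const_le (hpos n) ht (by positivity)).trans ?_)
      rw [add_mul]
      linarith
  have hpow := tendsto_lintegral_riemannAvg_abs_pow_sub hpos
    (fun n i ω => stepEnergy_nonneg r (Δ n) i ω) hAm
    (fun n i ω => noiseEnergy_nonneg r (Δ n) i ω) hBm
    (hW.exists_lintegral_stepEnergy_pow_le hr' hpos hc)
    (fun m => ⟨_, Eventually.of_forall fun n i _ =>
      hW.lintegral_noiseEnergy_pow_le hr (hpos n) i m⟩) ht hclose p
  exact tendsto_lintegral_abs_riemannAvg_sub hpos (fun n i => (hAm n i).pow_const p)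
    (fun n i => (hBm n i).pow_const p) hpow (hW.tendsto_riemannAvg_noiseEnergy hr hpos hlim p ht)

end HeatPV

namespace HeatPV

/-! ### The power variation of the solution -/

variable {Ω : Type*} [MeasurableSpace Ω] {P : Measure Ω}
  {W : Lp ℝ 2 spaceTimeMeasure → Ω → ℝ} {u : ℝ → ℝ → Ω → ℝ}

theorem ae_memH_solution [IsProbabilityMeasure P] (hW : IsWhiteNoise W P)
    (hu : IsRandomFieldSolution W P u) {r : ℝ} (hr : r < 1 / 2) {t : ℝ} (ht : 0 ≤ t) :
    ∀ᵐ ω ∂P, MemH r (coeffs fun x => u t x ω) := by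
  have hs : Summable fun k => eigenvalue k ^ r * ‖heatMode k t‖ ^ 2 := by
    refine Summable.of_nonneg_of_le
      (fun k => mul_nonneg (eigenvalue_rpow_pos r k).le (sq_nonneg _)) (fun k => ?_)
      (summable_eigenvalue_rpow (s := r - 1) (by linarith))
    rw [Real.rpow_sub_one (eigenvalue_pos k).ne', div_eq_mul_inv]
    exact mul_le_mul_of_nonneg_left (norm_sq_heatMode_le k ht) (eigenvalue_rpow_pos r k).le
  filter_upwards [hW.ae_summable (fun k => (eigenvalue_rpow_pos r k).le) hs,
    ae_all_iff.2 fun k => ae_coeffs_solution_eq hW hu ht k] with ω h1 h2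
  unfold MemH
  simpa only [h2] using h1

theorem ae_coeffs_increment_eq [IsProbabilityMeasure P] (hW : IsWhiteNoise W P)
    (hu : IsRandomFieldSolution W P u) {a b : ℝ} (ha : 0 ≤ a) (hb : 0 ≤ b) :
    ∀ᵐ ω ∂P, ∀ k, coeffs (fun x => u b x ω - u a x ω) k = W (heatIncr k a b) ω := by
  filter_upwards [ae_memLp_solution hW hu ha, ae_memLp_solution hW hu hb,
    ae_all_iff.2 fun k => ae_coeffs_solution_eq hW hu ha k,
    ae_all_iff.2 fun k => ae_coeffs_solution_eq hW hu hb k,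
    ae_all_iff.2 fun k => hW.map_sub (heatMode k b) (heatMode k a)] with ω h1 h2 h3 h4 h5 k
  rw [coeffs_sub h2 h1, h3, h4, heatIncr, h5, Pi.sub_apply]

/-- The normalized power variation is an average of powers of step energies. -/
theorem ae_powerVariation_eq [IsProbabilityMeasure P] (hW : IsWhiteNoise W P)
    (hu : IsRandomFieldSolution W P u) (r : ℝ) {δ : ℝ} (hδ : 0 < δ) (hτ : 0 ≤ tau r δ) (p : ℕ) :
    ∀ᵐ ω ∂P, ∀ t, powerVariation r (2 * (p : ℝ)) δ (fun s x => u s x ω) t =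
      riemannAvg δ t fun i => stepEnergy W r δ i ω ^ p := by
  -- Only countably many increments occur at a given mesh, so one null set serves all t.
  filter_upwards [ae_all_iff.2 fun i => ae_coeffs_increment_eq hW hu (gridPoint_nonneg hδ.le i)
    (add_nonneg (gridPoint_nonneg hδ.le i) hδ.le)] with ω hω t
  rw [powerVariation, riemannAvg]
  congr 1
  refine Finset.sum_congr rfl fun i hi => ?_
  have h1 : 1 ≤ i := (Finset.mem_Icc.1 hi).1
  rw [← gridPoint_add δ h1, ← gridPoint_eq δ h1, normH,
    Real.rpow_mul (div_nonneg (Real.sqrt_nonneg _) hτ), Real.rpow_ofNat, Real.rpow_natCast]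
  congr 1
  rw [div_pow, Real.sq_sqrt (tsum_nonneg fun k =>
    mul_nonneg (eigenvalue_rpow_pos r k).le (sq_nonneg _)), ← tsum_div_const, stepEnergy, quadForm]
  refine tsum_congr fun k => ?_
  rw [hω i k, weight, heatStep]
  ring

theorem IsWhiteNoise.tendsto_riemannAvg_stepEnergy [IsProbabilityMeasure P]
    (hW : IsWhiteNoise W P) {r : ℝ} (hr : r < 1 / 2) {Δ : ℕ → ℝ} (hpos : ∀ n, 0 < Δ n)
    (hlim : Tendsto Δ atTop (𝓝 0)) (p : ℕ) {t : ℝ} (ht : 0 ≤ t) :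
    Tendsto (fun n => ∫⁻ ω, ENNReal.ofReal
      |riemannAvg (Δ n) t (fun i => stepEnergy W r (Δ n) i ω ^ p) - limitConst r p * t| ∂P)
      atTop (𝓝 0) := by
  have hΔ := tendsto_nhdsGT_of_pos hpos hlim
  rcases lt_trichotomy r (-1 / 2) with h | rfl | h
  · exact hW.tendsto_riemannAvg_stepEnergy_of_lt h hpos hlim p ht
  · have h1 := hW.tendsto_riemannAvg_stepEnergy_of_ge le_rfl hr hpos hlim
      (tendsto_energy_neg_half.comp hΔ) p ht
    rwa [limitConst, if_neg (lt_irrefl _), if_pos rfl, ← one_div, ← one_div_pow]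
  · have h1 := hW.tendsto_riemannAvg_stepEnergy_of_ge h.le hr hpos hlim
      ((tendsto_energy_of_gt h hr).comp hΔ) p ht
    rwa [limitConst, if_neg h.not_gt, if_neg h.ne']

theorem exists_tendsto_energy {r : ℝ} (hr : r < 1 / 2) :
    ∃ c, Tendsto (fun δ => energy r δ / tau r δ ^ 2) (𝓝[>] 0) (𝓝 c) := by
  rcases lt_trichotomy r (-1 / 2) with h | rfl | h
  · exact ⟨_, tendsto_energy_of_lt h⟩
  · exact ⟨_, tendsto_energy_neg_half⟩
  · exact ⟨_, tendsto_energy_of_gt h hr⟩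

end HeatPV

/-! ### The main theorem -/

theorem theoremA {Ω : Type*} [MeasurableSpace Ω] (P : Measure Ω) [IsProbabilityMeasure P]
    (W : Lp ℝ 2 HeatPV.spaceTimeMeasure → Ω → ℝ) (hW : HeatPV.IsWhiteNoise W P)
    (u : ℝ → ℝ → Ω → ℝ) (hu : HeatPV.IsRandomFieldSolution W P u)
    (Δ : ℕ → ℝ) (hΔ_pos : ∀ n, 0 < Δ n) (hΔ_anti : Antitone Δ) (hΔ_lim : Tendsto Δ atTop (𝓝 0))
    (r : ℝ) (hr : r < 1 / 2) :
    (∀ t, 0 ≤ t → ∀ᵐ ω ∂P, MemLp (fun x => u t x ω) 2 HeatPV.spaceMeasure ∧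
      HeatPV.MemH r (HeatPV.coeffs fun x => u t x ω)) ∧
    ∀ p : ℕ, 1 ≤ p → ∀ q T : ℝ, 0 < q → 0 < T →
      Tendsto (fun n => ∫⁻ ω, ⨆ t ∈ Set.Icc (0 : ℝ) T, ENNReal.ofReal
          (|HeatPV.powerVariation r (2 * (p : ℝ)) (Δ n) (fun s x => u s x ω) t
            - HeatPV.limitConst r p * t| ^ q) ∂P)
        atTop (𝓝 0) := by
  refine ⟨fun t ht => (HeatPV.ae_memLp_solution hW hu ht).and (HeatPV.ae_memH_solution hW hu hr ht),
    fun p _ q T hq hT => ?_⟩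
  obtain ⟨c, hc⟩ := HeatPV.exists_tendsto_energy hr
  have hΔ := HeatPV.tendsto_nhdsGT_of_pos hΔ_pos hΔ_lim
  have hmain := HeatPV.tendsto_lintegral_iSup_riemannAvg (P := P) (K := HeatPV.limitConst r p)
    hΔ_pos (A := fun n i ω => HeatPV.stepEnergy W r (Δ n) i ω ^ p)
    (fun n i ω => pow_nonneg (HeatPV.stepEnergy_nonneg r (Δ n) i ω) p)
    (fun n i => (hW.aemeasurable_stepEnergy hr (hΔ_pos n).le i).pow_const p)
    (fun m => by
      simpa only [← pow_mul] using
        hW.exists_lintegral_stepEnergy_pow_le hr hΔ_pos (hc.comp hΔ) (p * m))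
    (fun t ht => hW.tendsto_riemannAvg_stepEnergy hr hΔ_pos hΔ_lim p ht) hq hT
  refine hmain.congr' ?_
  -- The identification with the power variation uses τ ≥ 0, obtained here from `tau_pos` for a mesh
  -- below 1; finitely many n are discarded.
  filter_upwards [hΔ.eventually HeatPV.eventually_small] with n hn
  refine lintegral_congr_ae ?_
  filter_upwards [HeatPV.ae_powerVariation_eq hW hu r hn.1
    (HeatPV.tau_pos r hn.1 (hn.2.trans (by norm_num))).le p] with ω hω
  simp only [hω]
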